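/- **Lemma 2.1 (Uchiyama's Lemma for the ball).** Let $n\ge 1$, let $\mathbb B_n$ be the open unit ball of $\mathbb C^n$, $\mathbb S$ its boundary, $\sigma$ the surface measure on $\mathbb S$ with $\sigma(\mathbb S)=1$, and $\langle z,w\rangle=\sum_j z_j\overline{w_j}$. Put $$\widetilde\Delta=4\sum_{i,j}\frac{1-|z|^2}{n+1}\,(\delta_{ij}-\overline z_i z_j)\,\bar\partial_i\partial_j,\qquad dg(z)=\frac{dV(z)}{(1-|z|^2)^{n+1}},\qquad G(z)=\frac{n+1}{2n}\int_{|z|}^1(1-t^2)^{n-1}t^{-2n+1}\,dt,$$ where $dV$ is Lebesgue measure. Let $H^2(\mathbb B_n)$ be the closure of the holomorphic polynomials in $L^2(\mathbb S,\sigma)$, with that norm. Each $F\in H^2(\mathbb B_n)$ has an analytic continuation $f$ to $\mathbb B_n$: some holomorphic polynomials converge to $F$ in $L^2(\sigma)$ and to $f$ locally uniformly in $\mathbb B_n$. We write $f\in H^2(\mathbb B_n)$ and $\|f\|_{H^2(\mathbb B_n)}=\|F\|_{L^2(\sigma)}$. For $a\in\mathbb B_n$ let $b_a$ be the automorphism of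 $\mathbb B_n$ given by $b_a(z)=\dfrac{a-P_az-\sqrt{1-|a|^2}\,(z-P_az)}{1-\langle z,a\rangle}$, where $P_a$ is the orthogonal projection onto $\mathbb Ca$. A function $\varphi:\mathbb B_n\to[-\infty,\infty)$ is *invariant subharmonic* if it is upper semicontinuous, $\varphi\not\equiv-\infty$, and $\varphi(a)\le\int_{\mathbb S}\varphi(b_a(r\xi))\,d\sigma(\xi)$ for all $a\in\mathbb B_n$, $0<r<1$. For such $\varphi$, $\widetilde\Delta\varphi\,dg$ denotes a Borel measure $m$ on $\mathbb B_n$, finite on compact subsets of $\mathbb B_n$, with $\int\varphi\,\widetilde\Delta\psi\,dg=\int\psi\,dm$ for all $\psi\in C_c^\infty(\mathbb B_n)$, where $\varphi$ is required to be locally integrable. Suppose that $\varphi\le 0$ on $\mathbb B_n$ and that either (a) $\varphi$ is of class $C^2$ on $\mathbb B_n$ with $\widetilde\Delta\varphi\ge0$, and $\widetilde\Delta\varphi$ is understood pointwise; or (b) $\varphi$ is invariant subharmonic, and $\widetilde\Delta\varphi\,dg$ is understood as above; in this case such a measure $\widetilde\Delta\varphi\,dg$ exists. Let $$d\nu=\frac{n!}{\pi^n}\,e^{\varphi}\,\widetilde\Delta\varphi\;G\,dg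 .$$ Then $\nu$ is a Carleson measure, that is, there is $C<\infty$ with $\nu(\{z\in\mathbb B_n:|1-\langle z,\xi\rangle|<r\})\le C\,r^n$ for all $\xi\in\mathbb S$ and $r>0$. Moreover $H^2(\mathbb B_n)\subset L^2(\nu)$ and this embedding is a contraction: $$\int_{\mathbb B_n}|f|^2\,d\nu\le\|f\|_{H^2(\mathbb B_n)}^2\qquad\text{for all } f\in H^2(\mathbb B_n).$$ -/

import Mathlib

open MeasureTheory Filter Topology
open scoped ENNReal NNReal

namespace BallUchiyama

noncomputable section

/-- The Hermitian space ℂⁿ. Its `volume` is Lebesgue measure on ℝ²ⁿ, and `inner ℂ a z` is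
`∑ⱼ zⱼ * conj aⱼ`, i.e. the product written ⟨z, a⟩ in complex analysis. -/
abbrev Cn (n : ℕ) : Type := EuclideanSpace ℂ (Fin n)

/-- The open unit ball of ℂⁿ. -/
abbrev unitBall (n : ℕ) : Set (Cn n) := Metric.ball (0 : Cn n) 1

/-- The unit sphere of ℂⁿ. -/
abbrev unitSphere (n : ℕ) : Set (Cn n) := Metric.sphere (0 : Cn n) 1

/-! ### Invariant Laplacian, invariant volume, Green's function -/

/-- The Wirtinger derivative ∂ⱼ = (∂/∂xⱼ - i ∂/∂yⱼ) / 2. -/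
def dz {n : ℕ} (j : Fin n) (f : Cn n → ℂ) (z : Cn n) : ℂ :=
  (1 / 2) * (fderiv ℝ f z (EuclideanSpace.single j 1)
    - Complex.I * fderiv ℝ f z (EuclideanSpace.single j Complex.I))

/-- The Wirtinger derivative ∂̄ⱼ = (∂/∂xⱼ + i ∂/∂yⱼ) / 2. -/
def dzbar {n : ℕ} (j : Fin n) (f : Cn n → ℂ) (z : Cn n) : ℂ :=
  (1 / 2) * (fderiv ℝ f z (EuclideanSpace.single j 1)
    + Complex.I * fderiv ℝ f z (EuclideanSpace.single j Complex.I))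

/-- The components gⁱʲ = (1 - |z|²) / (n + 1) * (δᵢⱼ - conj zᵢ * zⱼ) of the inverse of the
Bergman metric. -/
def bergmanInv {n : ℕ} (z : Cn n) (i j : Fin n) : ℂ :=
  ((1 - ‖z‖ ^ 2 : ℝ) : ℂ) / ((n : ℂ) + 1)
    * ((if i = j then 1 else 0) - (starRingEnd ℂ) (z i) * z j)

/-- The invariant Laplacian 4 ∑ᵢⱼ gⁱʲ ∂̄ᵢ ∂ⱼ u of a real function `u`. For `u` of class C² the sum
is a real number, since gⁱʲ and ∂̄ᵢ ∂ⱼ u are Hermitian matrices; taking the real part only changes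
the type. -/
def invLaplacian {n : ℕ} (u : Cn n → ℝ) (z : Cn n) : ℝ :=
  (4 * ∑ i : Fin n, ∑ j : Fin n,
    bergmanInv z i j * dzbar i (dz j (fun w => (u w : ℂ))) z).re

/-- The invariant volume dg = dV / (1 - |z|²)ⁿ⁺¹ on the unit ball (and zero outside it). -/
def invVolume (n : ℕ) : Measure (Cn n) :=
  (volume.restrict (unitBall n)).withDensity
    (fun z => ENNReal.ofReal (1 / (1 - ‖z‖ ^ 2) ^ (n + 1)))

/-- Green's function of the invariant Laplacian with pole at 0,
G(z) = (n + 1) / (2 n) * ∫_{|z|}^1 (1 - t²)ⁿ⁻¹ t⁻²ⁿ⁺¹ dt, with G(0) = ∞. -/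
def green {n : ℕ} (z : Cn n) : ℝ≥0∞ :=
  ENNReal.ofReal (((n : ℝ) + 1) / (2 * (n : ℝ))) *
    ∫⁻ t in Set.Ioo ‖z‖ 1, ENNReal.ofReal ((1 - t ^ 2) ^ (n - 1) / t ^ (2 * n - 1))

/-! ### Invariant subharmonic functions -/

/-- Normalized surface measure on the unit sphere. -/
def sphereMeasure (n : ℕ) : Measure (unitSphere n) :=
  ((volume : Measure (Cn n)).toSphere Set.univ)⁻¹ • (volume : Measure (Cn n)).toSphere

/-- The orthogonal projection of `z` to the complex line spanned by `a` (zero when `a = 0`). -/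
def lineProj {n : ℕ} (a z : Cn n) : Cn n :=
  (inner ℂ a z / ((‖a‖ ^ 2 : ℝ) : ℂ)) • a

/-- The involutive automorphism of the ball that exchanges `a` and `0`,
b_a(z) = (a - P z - (1 - |a|²)^(1/2) (z - P z)) / (1 - ⟨z, a⟩), with P the projection to ℂ a.
Every automorphism of the ball that sends 0 to `a` is b_a after a unitary map. -/
def ballAut {n : ℕ} (a z : Cn n) : Cn n :=
  (1 - inner ℂ a z)⁻¹ •
    (a - lineProj a z - ((Real.sqrt (1 - ‖a‖ ^ 2) : ℝ) : ℂ) • (z - lineProj a z))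

/-- The integral of an extended real function: integral of the positive part minus integral of
the negative part. It is used only where the positive part has finite integral. -/
def erealIntegral {α : Type*} [MeasurableSpace α] (μ : Measure α) (f : α → EReal) : EReal :=
  ((∫⁻ x, (f x).toENNReal ∂μ : ℝ≥0∞) : EReal) - ((∫⁻ x, (-f x).toENNReal ∂μ : ℝ≥0∞) : EReal)

/-- Invariant subharmonic functions on the unit ball: upper semicontinuous, with values in
[-∞, ∞), not identically -∞, and bounded at each point by the mean over each invariant sphere
around that point. Values of `φ` outside the ball play no role. -/
structure InvSubharmonic {n : ℕ} (φ : Cn n → EReal) : Prop where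
  usc : UpperSemicontinuousOn φ (unitBall n)
  ne_top : ∀ z ∈ unitBall n, φ z ≠ ⊤
  exists_ne_bot : ∃ z ∈ unitBall n, φ z ≠ ⊥
  sub_mean : ∀ a ∈ unitBall n, ∀ r : ℝ, 0 < r → r < 1 →
    φ a ≤ erealIntegral (sphereMeasure n) (fun ξ => φ (ballAut a ((r : ℂ) • (ξ : Cn n))))

/-- `m` is the measure Δ̃φ dg, where Δ̃φ is taken in the sense of distributions: `φ` is locally
integrable, `m` is a measure on the ball that is finite on compact subsets of the ball, and
∫ φ Δ̃ψ dg = ∫ ψ dm for all test functions ψ on the ball. -/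
structure IsInvLaplacianMeasure {n : ℕ} (φ : Cn n → EReal) (m : Measure (Cn n)) : Prop where
  compl_ball : m (unitBall n)ᶜ = 0
  finite_on_compacts : ∀ K : Set (Cn n), IsCompact K → K ⊆ unitBall n → m K < ⊤
  ae_ne_bot : ∀ᵐ z ∂(invVolume n), φ z ≠ ⊥
  integrable_on_compacts : ∀ K : Set (Cn n), IsCompact K → K ⊆ unitBall n →
    IntegrableOn (fun z => (φ z).toReal) K (invVolume n)
  integral_eq : ∀ ψ : Cn n → ℝ, ContDiff ℝ ((⊤ : ℕ∞) : WithTop ℕ∞) ψ → HasCompactSupport ψ →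
    tsupport ψ ⊆ unitBall n →
    ∫ z, (φ z).toReal * invLaplacian ψ z ∂(invVolume n) = ∫ z, ψ z ∂m

/-- The measure dν = (n! / πⁿ) e^φ G dm, to be used with dm = Δ̃φ dg. Here e^(-∞) = 0. -/
def uchiyamaMeasure {n : ℕ} (φ : Cn n → EReal) (m : Measure (Cn n)) : Measure (Cn n) :=
  ENNReal.ofReal ((n.factorial : ℝ) / Real.pi ^ n) •
    m.withDensity (fun z => EReal.exp (φ z) * green z)

/-! ### Hardy space and Carleson measures -/

/-- The Hardy space H²: the closure of the holomorphic polynomials in L² of the sphere. -/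
def hardySpace (n : ℕ) : Set (Lp ℂ 2 (sphereMeasure n)) :=
  closure {F | ∃ p : MvPolynomial (Fin n) ℂ,
    (F : unitSphere n → ℂ) =ᵐ[sphereMeasure n]
      fun ξ => MvPolynomial.eval (fun i => (ξ : Cn n) i) p}

/-- `f` is the analytic continuation to the ball of the boundary function `F`: some sequence of
holomorphic polynomials converges to `F` in L² of the sphere and to `f` locally uniformly in the
ball. -/
def IsContinuation {n : ℕ} (F : Lp ℂ 2 (sphereMeasure n)) (f : Cn n → ℂ) : Prop :=
  ∃ p : ℕ → MvPolynomial (Fin n) ℂ,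
    Tendsto (fun k => eLpNorm
      (fun ξ : unitSphere n => MvPolynomial.eval (fun i => (ξ : Cn n) i) (p k) - F ξ) 2
      (sphereMeasure n)) atTop (𝓝 0) ∧
    TendstoLocallyUniformlyOn
      (fun k (z : Cn n) => MvPolynomial.eval (fun i => z i) (p k)) f atTop (unitBall n)

/-- H² is contained in L²(ν), and the embedding is a contraction. -/
def EmbedsContractively {n : ℕ} (ν : Measure (Cn n)) : Prop :=
  ∀ F ∈ hardySpace n,
    (∃ f : Cn n → ℂ, IsContinuation F f) ∧
    ∀ f : Cn n → ℂ, IsContinuation F f →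
      MemLp f 2 ν ∧ ∫⁻ z, ‖f z‖ₑ ^ 2 ∂ν ≤ ‖F‖ₑ ^ 2

/-- Carleson measures on the ball: the mass of each nonisotropic Carleson region
{z ∈ 𝔹 : |1 - ⟨z, ξ⟩| < r} with `ξ` on the sphere is at most a constant times rⁿ. -/
def IsCarlesonMeasure {n : ℕ} (ν : Measure (Cn n)) : Prop :=
  ν (unitBall n)ᶜ = 0 ∧
  ∃ C : ℝ≥0, ∀ ξ ∈ unitSphere n, ∀ r : ℝ, 0 < r →
    ν {z | z ∈ unitBall n ∧ ‖1 - inner ℂ ξ z‖ < r} ≤ (C : ℝ≥0∞) * ENNReal.ofReal (r ^ n)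

end

end BallUchiyama

open BallUchiyama

namespace BallUchiyama

noncomputable section

/-! Write Δ̃ for the invariant Laplacian and take f holomorphic. The heart of the matter is the
pointwise inequality e^φ|f|²Δ̃φ ≤ Δ̃(e^φ|f|²) (`Lop_exp_mul_le`): the difference is e^φ times the
carré du champ of a single real covector, which is nonnegative in the ball by Cauchy–Schwarz
(`Gam_self_nonneg`). Put u = e^φ|f|² and integrate against Green's function. Green's formula turns ∫
G Δ̃u dg into a constant times the boundary mean of u minus u(0). Since φ ≤ 0, u ≤ |f|²; dropping
-u(0) leaves the norm of f, and the normalization n!/πⁿ makes the constant equal to one.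

The singularity of G and the boundary are avoided as follows. On functions of the squared
pseudohyperbolic distance `bx a z`, the operator Δ̃ becomes an ordinary differential operator
(`Lop_comp_bx`). Its radial solutions are potentials `pot n η` with a "flux" η: constant flux gives
G, and a smooth flux vanishing near 0 and 1 gives a test function with explicit Laplacian
(`invLaplacian_pot`). Green's inequality is proved for these truncations by symmetry of Δ̃
(`integral_invLaplacian_symm`), and Fatou's lemma gives the case of G (`lintegral_green_le`).

For an invariant subharmonic φ let K_s be the mean with the radial kernel `kern n s`, which has mass
one and shrinks to the pole as s → ∞. Invariance of dg upgrades the mean inequality on spheres to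
all radial weights, so K_s(-φ) ≤ -φ. Existence of the measure m = Δ̃φ dg: the difference K_t - K_s
is a negative multiple of a potential applied to Δ̃, so comparing means shows that the distribution
Δ̃φ is positive (`integral_negPart_mul_invLaplacian_nonpos`); M. Riesz extension and the Riesz
representation theorem then produce m. For the inequality, the regularization φ_t = K_tφ is of class
C² with Δ̃φ_t = K_t m, and φ ≤ φ_t almost everywhere. Jensen's inequality gives e^φ ≤ K_t(e^{φ_t})
at every point of the ball. This matters because m may be singular to dg. By symmetry of the kernel,
K_t moves from e^{φ_t} onto m, where it becomes Δ̃φ_t, and the C² case for φ_t applies.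

All this is carried out for entire functions. A bound for point evaluations, itself a consequence of
the C² case with exponent |z|² - 1, gives the analytic continuation, and Fatou extends the
contraction to H². The Carleson condition follows by testing on partial sums of (1 - ⟨z,a⟩)^{-(n+1)}
with a = (1 - r)ξ; their boundary norms are controlled by the Jacobian of b_a. -/

variable {n : ℕ}

/-! ### The invariant Laplacian as a real second-order operator -/

/-- The second real derivative. -/
def D2 (u : Cn n → ℝ) (z : Cn n) : Cn n →L[ℝ] Cn n →L[ℝ] ℝ := fderiv ℝ (fderiv ℝ u) z

/-- The trace of a real bilinear form over `ℂⁿ`, minus its values on `z` and `iz`. -/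
def bergmanTrace (z : Cn n) (B : Cn n → Cn n → ℝ) : ℝ :=
  (∑ i : Fin n, (B (EuclideanSpace.single i 1) (EuclideanSpace.single i 1)
    + B (EuclideanSpace.single i Complex.I) (EuclideanSpace.single i Complex.I)))
    - B z z - B (Complex.I • z) (Complex.I • z)

/-- The invariant Laplacian up to the factor `(1 - ‖z‖ ^ 2) / (n + 1)`. -/
def Lop (u : Cn n → ℝ) (z : Cn n) : ℝ := bergmanTrace z fun v w => D2 u z v w

/-- The carré du champ of `Lop` on covectors. -/
def Gam (z : Cn n) (α β : Cn n → ℝ) : ℝ := bergmanTrace z fun v w => α v * β w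

lemma bergmanTrace_add (z : Cn n) (B C : Cn n → Cn n → ℝ) :
    bergmanTrace z (fun v w => B v w + C v w) = bergmanTrace z B + bergmanTrace z C := by
  simp only [bergmanTrace, Finset.sum_add_distrib]; ring

lemma bergmanTrace_smul (z : Cn n) (c : ℝ) (B : Cn n → Cn n → ℝ) :
    bergmanTrace z (fun v w => c * B v w) = c * bergmanTrace z B := by
  simp only [bergmanTrace, ← mul_add, ← Finset.mul_sum]; ring

lemma Gam_comm (z : Cn n) (α β : Cn n → ℝ) : Gam z α β = Gam z β α := by
  simp only [Gam, mul_comm, bergmanTrace]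

lemma Gam_smul_left (z : Cn n) (c : ℝ) (α β : Cn n → ℝ) :
    Gam z (fun v => c * α v) β = c * Gam z α β := by
  simp only [Gam, mul_assoc, bergmanTrace_smul]

lemma Gam_smul_right (z : Cn n) (c : ℝ) (α β : Cn n → ℝ) :
    Gam z β (fun v => c * α v) = c * Gam z β α := by
  simp only [Gam_comm z β, Gam_smul_left]

lemma I_smul_single (i : Fin n) (c : ℂ) :
    Complex.I • (EuclideanSpace.single i c : Cn n) = EuclideanSpace.single i (Complex.I * c) := by
  ext j; by_cases h : j = i <;> simp [h]

lemma single_neg_one (i : Fin n) :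
    (EuclideanSpace.single i (-1 : ℂ) : Cn n) = -EuclideanSpace.single i (1 : ℂ) := by
  ext j; by_cases h : j = i <;> simp [h]

/-- Multiplication by i permutes the real frame, and the pair z, iz, up to signs; the signs cancel
because each term is a product of two covector values. -/
lemma Gam_I (z : Cn n) (α β : Cn n →L[ℝ] ℝ) :
    Gam z (fun v => α (Complex.I • v)) (fun v => β (Complex.I • v)) = Gam z α β := by
  simp only [Gam, bergmanTrace, I_smul_single, smul_smul, Complex.I_mul_I, mul_one,
    single_neg_one, neg_smul, one_smul, map_neg, neg_mul_neg]
  rw [Finset.sum_congr rfl fun i _ => add_comm _ _]; ring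

lemma eq_sum_single (v : Cn n) :
    v = ∑ i, ((v i).re • (EuclideanSpace.single i 1 : Cn n)
      + (v i).im • (EuclideanSpace.single i Complex.I : Cn n)) := by
  ext j
  simp only [WithLp.ofLp_sum, WithLp.ofLp_add, WithLp.ofLp_smul, Finset.sum_apply, Pi.add_apply, Pi.smul_apply,
    PiLp.ofLp_single, Pi.single_apply]
  simp [Finset.sum_add_distrib]

lemma clm_apply_eq_sum (α : Cn n →L[ℝ] ℝ) (v : Cn n) :
    α v = ∑ i, ((v i).re * α (EuclideanSpace.single i 1)
      + (v i).im * α (EuclideanSpace.single i Complex.I)) := by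
  conv_lhs => rw [eq_sum_single v]
  simp [map_sum]

lemma clm_apply_I_eq_sum (α : Cn n →L[ℝ] ℝ) (v : Cn n) :
    α (Complex.I • v) = ∑ i, (-(v i).im * α (EuclideanSpace.single i 1)
      + (v i).re * α (EuclideanSpace.single i Complex.I)) := by
  rw [clm_apply_eq_sum]; simp

lemma norm_sq_eq_sum (z : Cn n) : ‖z‖ ^ 2 = ∑ i, ((z i).re ^ 2 + (z i).im ^ 2) := by
  rw [EuclideanSpace.norm_sq_eq]
  refine Finset.sum_congr rfl fun i _ => ?_
  rw [Complex.sq_norm, Complex.normSq_apply]; ring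

/-- Ellipticity in the closed ball. The complex number λ = ∑ zᵢ(α(eᵢ) - iα(ieᵢ)) collects both
subtracted terms, |λ|² = α(z)² + α(iz)², and Cauchy–Schwarz bounds it by ‖z‖² times the Euclidean
trace. -/
lemma Gam_self_nonneg {z : Cn n} (hz : ‖z‖ ≤ 1) (α : Cn n →L[ℝ] ℝ) : 0 ≤ Gam z α α := by
  set lam : ℂ := ∑ i, z i * ((α (EuclideanSpace.single i 1) : ℂ)
    - Complex.I * α (EuclideanSpace.single i Complex.I)) with hlam
  have h1 : lam.re = α z := by
    rw [hlam, clm_apply_eq_sum]; simp [Complex.re_sum]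
  have h2 : lam.im = -α (Complex.I • z) := by
    rw [hlam, clm_apply_I_eq_sum, Complex.im_sum, ← Finset.sum_neg_distrib]
    refine Finset.sum_congr rfl fun i _ => ?_
    simp
  have h3 : ‖lam‖ ^ 2 ≤ ‖z‖ ^ 2 * ∑ i, (α (EuclideanSpace.single i 1) ^ 2
      + α (EuclideanSpace.single i Complex.I) ^ 2) := by
    have hle : ‖lam‖ ≤ ∑ i, ‖z i‖ * ‖((α (EuclideanSpace.single i 1) : ℂ)
        - Complex.I * α (EuclideanSpace.single i Complex.I))‖ := by
      refine (norm_sum_le _ _).trans_eq (by simp)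
    have := Finset.sum_mul_sq_le_sq_mul_sq Finset.univ (fun i => ‖z i‖)
      (fun i => ‖((α (EuclideanSpace.single i 1) : ℂ)
        - Complex.I * α (EuclideanSpace.single i Complex.I))‖)
    refine (pow_le_pow_left₀ (norm_nonneg _) hle 2).trans (this.trans_eq ?_)
    rw [EuclideanSpace.norm_sq_eq]
    congr 1
    refine Finset.sum_congr rfl fun i _ => ?_
    rw [Complex.sq_norm, Complex.normSq_apply]; simp; ring
  have h4 : ‖lam‖ ^ 2 = α z ^ 2 + α (Complex.I • z) ^ 2 := by
    rw [Complex.sq_norm, Complex.normSq_apply, h1, h2]; ring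
  have h5 : ‖z‖ ^ 2 ≤ 1 := by nlinarith [norm_nonneg z]
  have h6 : 0 ≤ ∑ i, (α (EuclideanSpace.single i 1) ^ 2
      + α (EuclideanSpace.single i Complex.I) ^ 2) := Finset.sum_nonneg fun i _ => by positivity
  have : Gam z α α = ∑ i, (α (EuclideanSpace.single i 1) ^ 2
      + α (EuclideanSpace.single i Complex.I) ^ 2) - α z ^ 2 - α (Complex.I • z) ^ 2 := by
    simp only [Gam, bergmanTrace, sq]
  nlinarith

lemma fderiv_differentiableAt {u : Cn n → ℝ} {z : Cn n} (hu : ContDiffAt ℝ 2 u z) :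
    DifferentiableAt ℝ (fderiv ℝ u) z :=
  (hu.fderiv_right (m := 1) (by norm_num)).differentiableAt one_ne_zero

lemma eventually_differentiableAt {u : Cn n → ℝ} {z : Cn n} (hu : ContDiffAt ℝ 2 u z) :
    ∀ᶠ w in 𝓝 z, DifferentiableAt ℝ u w :=
  (hu.eventually (by simp)).mono fun _ h => h.differentiableAt two_ne_zero

lemma hasFDerivAt_fderiv_apply {u : Cn n → ℝ} {z : Cn n} (hu : ContDiffAt ℝ 2 u z) (w : Cn n) :
    HasFDerivAt (fun y => fderiv ℝ u y w) ((D2 u z).flip w) z := by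
  have := (fderiv_differentiableAt hu).hasFDerivAt.clm_apply (hasFDerivAt_const w z)
  refine this.congr_fderiv ?_
  ext v; simp [D2]

lemma D2_congr {u v : Cn n → ℝ} {z : Cn n} (h : u =ᶠ[𝓝 z] v) : D2 u z = D2 v z :=
  (Filter.EventuallyEq.fderiv h).fderiv_eq

lemma Lop_congr {u v : Cn n → ℝ} {z : Cn n} (h : u =ᶠ[𝓝 z] v) : Lop u z = Lop v z := by
  simp only [Lop, D2_congr h]

lemma D2_mul {f g : Cn n → ℝ} {z : Cn n} (hf : ContDiffAt ℝ 2 f z) (hg : ContDiffAt ℝ 2 g z)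
    (v w : Cn n) : D2 (fun y => f y * g y) z v w = f z * D2 g z v w + g z * D2 f z v w
      + (fderiv ℝ f z v * fderiv ℝ g z w + fderiv ℝ g z v * fderiv ℝ f z w) := by
  have h1 : fderiv ℝ (fun y => f y * g y) =ᶠ[𝓝 z]
      fun y => f y • fderiv ℝ g y + g y • fderiv ℝ f y := by
    filter_upwards [eventually_differentiableAt hf, eventually_differentiableAt hg] with y h1 h2
    exact fderiv_fun_mul h1 h2
  rw [D2, h1.fderiv_eq]
  have hf' := (hf.differentiableAt two_ne_zero).hasFDerivAt
  have hg' := (hg.differentiableAt two_ne_zero).hasFDerivAt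
  have hf'' := (fderiv_differentiableAt hf).hasFDerivAt
  have hg'' := (fderiv_differentiableAt hg).hasFDerivAt
  rw [show fderiv ℝ (fun y => f y • fderiv ℝ g y + g y • fderiv ℝ f y) z = _ from
    ((hf'.smul hg'').add (hg'.smul hf'')).fderiv]
  simp [D2]; ring

lemma fderiv_comp_real {f : Cn n → ℝ} {h : ℝ → ℝ} {z : Cn n} (hf : DifferentiableAt ℝ f z)
    (hh : DifferentiableAt ℝ h (f z)) :
    fderiv ℝ (fun y => h (f y)) z = deriv h (f z) • fderiv ℝ f z :=
  (hh.hasDerivAt.comp_hasFDerivAt z hf.hasFDerivAt).fderiv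

lemma D2_comp {f : Cn n → ℝ} {h : ℝ → ℝ} {z : Cn n} (hf : ContDiffAt ℝ 2 f z)
    (hh : ContDiffAt ℝ 2 h (f z)) (v w : Cn n) :
    D2 (fun y => h (f y)) z v w = deriv h (f z) * D2 f z v w
      + deriv (deriv h) (f z) * (fderiv ℝ f z v * fderiv ℝ f z w) := by
  have hd : ∀ᶠ y in 𝓝 z, DifferentiableAt ℝ h (f y) :=
    hf.continuousAt.eventually ((hh.eventually (by simp)).mono
      fun _ h => h.differentiableAt two_ne_zero)
  have h1 : fderiv ℝ (fun y => h (f y)) =ᶠ[𝓝 z] fun y => deriv h (f y) • fderiv ℝ f y := by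
    filter_upwards [eventually_differentiableAt hf, hd] with y h1 h2
    exact fderiv_comp_real h1 h2
  have hh' : DifferentiableAt ℝ (deriv h) (f z) := by
    have := (hh.fderiv_right (m := 1) (by norm_num)).differentiableAt one_ne_zero
    exact (this.clm_apply (differentiableAt_const (1 : ℝ)))
  rw [D2, h1.fderiv_eq]
  have hf' := (hf.differentiableAt two_ne_zero).hasFDerivAt
  have hf'' := (fderiv_differentiableAt hf).hasFDerivAt
  rw [show fderiv ℝ (fun y => deriv h (f y) • fderiv ℝ f y) z = _ from
    ((hh'.hasDerivAt.comp_hasFDerivAt z hf').smul hf'').fderiv]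
  simp [D2]; ring

lemma D2_add {f g : Cn n → ℝ} {z : Cn n} (hf : ContDiffAt ℝ 2 f z) (hg : ContDiffAt ℝ 2 g z) :
    D2 (fun y => f y + g y) z = D2 f z + D2 g z := by
  have h1 : fderiv ℝ (fun y => f y + g y) =ᶠ[𝓝 z]
      fun y => fderiv ℝ f y + fderiv ℝ g y := by
    filter_upwards [eventually_differentiableAt hf, eventually_differentiableAt hg] with y h1 h2
    exact fderiv_fun_add h1 h2
  rw [D2, h1.fderiv_eq]
  exact fderiv_fun_add (fderiv_differentiableAt hf) (fderiv_differentiableAt hg)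

lemma Lop_mul {f g : Cn n → ℝ} {z : Cn n} (hf : ContDiffAt ℝ 2 f z) (hg : ContDiffAt ℝ 2 g z) :
    Lop (fun y => f y * g y) z = f z * Lop g z + g z * Lop f z
      + 2 * Gam z (fderiv ℝ f z) (fderiv ℝ g z) := by
  simp only [Lop, D2_mul hf hg, bergmanTrace_add, bergmanTrace_smul]
  have := Gam_comm z (fderiv ℝ f z) (fderiv ℝ g z)
  simp only [Gam] at this ⊢
  rw [← this]; ring

lemma Lop_add {f g : Cn n → ℝ} {z : Cn n} (hf : ContDiffAt ℝ 2 f z) (hg : ContDiffAt ℝ 2 g z) :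
    Lop (fun y => f y + g y) z = Lop f z + Lop g z := by
  simp only [Lop, D2_add hf hg, ← bergmanTrace_add]; rfl

lemma Lop_comp {f : Cn n → ℝ} {h : ℝ → ℝ} {z : Cn n} (hf : ContDiffAt ℝ 2 f z)
    (hh : ContDiffAt ℝ 2 h (f z)) :
    Lop (fun y => h (f y)) z = deriv h (f z) * Lop f z
      + deriv (deriv h) (f z) * Gam z (fderiv ℝ f z) (fderiv ℝ f z) := by
  simp only [Lop, D2_comp hf hh, bergmanTrace_add, bergmanTrace_smul, Gam]

lemma dzbar_dz_eq {u : Cn n → ℝ} {z : Cn n} (hu : ContDiffAt ℝ 2 u z) (i j : Fin n) :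
    dzbar i (dz j (fun w => (u w : ℂ))) z = (1 / 4) *
      ((D2 u z (EuclideanSpace.single i 1) (EuclideanSpace.single j 1)
        + D2 u z (EuclideanSpace.single i Complex.I) (EuclideanSpace.single j Complex.I) : ℝ)
      + Complex.I * (D2 u z (EuclideanSpace.single i Complex.I) (EuclideanSpace.single j 1)
        - D2 u z (EuclideanSpace.single i 1) (EuclideanSpace.single j Complex.I) : ℝ)) := by
  have h0 : ∀ᶠ w in 𝓝 z, fderiv ℝ (fun w => (u w : ℂ)) w = Complex.ofRealCLM ∘L fderiv ℝ u w := by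
    filter_upwards [eventually_differentiableAt hu] with w hw
    exact (Complex.ofRealCLM.hasFDerivAt.comp w hw.hasFDerivAt).fderiv
  have h1 : dz j (fun w => (u w : ℂ)) =ᶠ[𝓝 z] fun w => (1 / 2) *
      ((fderiv ℝ u w (EuclideanSpace.single j 1) : ℂ)
        - Complex.I * (fderiv ℝ u w (EuclideanSpace.single j Complex.I) : ℂ)) := by
    filter_upwards [h0] with w hw
    simp [dz, hw]
  have h2 : HasFDerivAt (fun w => (1 / 2 : ℂ) *
      ((fderiv ℝ u w (EuclideanSpace.single j 1) : ℂ)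
        - Complex.I * (fderiv ℝ u w (EuclideanSpace.single j Complex.I) : ℂ))) _ z :=
    (((Complex.ofRealCLM.hasFDerivAt.comp z
      (hasFDerivAt_fderiv_apply hu (EuclideanSpace.single j 1))).sub
      ((Complex.ofRealCLM.hasFDerivAt.comp z
      (hasFDerivAt_fderiv_apply hu (EuclideanSpace.single j Complex.I))).const_mul
        Complex.I)).const_mul (1 / 2))
  rw [dzbar, h1.fderiv_eq, h2.fderiv]
  simp
  ring_nf
  simp only [Complex.I_sq]
  ring

/-- The bridge from Wirtinger derivatives to the real Hessian; the calculus below is done with `Lop`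
only. -/
lemma invLaplacian_eq {u : Cn n → ℝ} {z : Cn n} (hu : ContDiffAt ℝ 2 u z) :
    invLaplacian u z = (1 - ‖z‖ ^ 2) / (n + 1) * Lop u z := by
  -- No symmetry of B is needed: the mixed entries occur as the same difference as in the imaginary
  -- part of ∂̄ᵢ∂ⱼ.
  have hzz : ∀ B : Cn n →L[ℝ] Cn n →L[ℝ] ℝ, B z z + B (Complex.I • z) (Complex.I • z) =
      ∑ i, ∑ j, (((z i).re * (z j).re + (z i).im * (z j).im) *
        (B (EuclideanSpace.single i 1) (EuclideanSpace.single j 1)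
        + B (EuclideanSpace.single i Complex.I) (EuclideanSpace.single j Complex.I))
        - ((z i).re * (z j).im - (z i).im * (z j).re) *
        (B (EuclideanSpace.single i Complex.I) (EuclideanSpace.single j 1)
        - B (EuclideanSpace.single i 1) (EuclideanSpace.single j Complex.I))) := by
    intro B
    have h1 : ∀ v w, B v w = ∑ i, ((v i).re * B (EuclideanSpace.single i 1) w
        + (v i).im * B (EuclideanSpace.single i Complex.I) w) := fun v w =>
      clm_apply_eq_sum (B.flip w) v
    rw [h1 z z, h1 (Complex.I • z), ← Finset.sum_add_distrib]
    refine Finset.sum_congr rfl fun i _ => ?_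
    simp only [clm_apply_eq_sum (B _) z, clm_apply_I_eq_sum (B _) z, Finset.mul_sum,
      ← Finset.sum_add_distrib]
    refine Finset.sum_congr rfl fun j _ => ?_
    simp; ring
  have hterm : ∀ i j, (4 * (bergmanInv z i j * dzbar i (dz j (fun w => (u w : ℂ))) z)).re =
      (1 - ‖z‖ ^ 2) / (n + 1) * ((if i = j then
        (D2 u z (EuclideanSpace.single i 1) (EuclideanSpace.single j 1)
        + D2 u z (EuclideanSpace.single i Complex.I) (EuclideanSpace.single j Complex.I)) else 0)
        - (((z i).re * (z j).re + (z i).im * (z j).im) *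
        (D2 u z (EuclideanSpace.single i 1) (EuclideanSpace.single j 1)
        + D2 u z (EuclideanSpace.single i Complex.I) (EuclideanSpace.single j Complex.I))
        - ((z i).re * (z j).im - (z i).im * (z j).re) *
        (D2 u z (EuclideanSpace.single i Complex.I) (EuclideanSpace.single j 1)
        - D2 u z (EuclideanSpace.single i 1) (EuclideanSpace.single j Complex.I)))) := by
    intro i j
    rw [dzbar_dz_eq hu, bergmanInv]
    have hc : ((1 - ‖z‖ ^ 2 : ℝ) : ℂ) / ((n : ℂ) + 1) = (((1 - ‖z‖ ^ 2) / (n + 1) : ℝ) : ℂ) := by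
      push_cast; ring
    rw [hc]
    generalize D2 u z (EuclideanSpace.single i 1) (EuclideanSpace.single j 1) = A1
    generalize D2 u z (EuclideanSpace.single i Complex.I) (EuclideanSpace.single j Complex.I) = A2
    generalize D2 u z (EuclideanSpace.single i Complex.I) (EuclideanSpace.single j 1) = A3
    generalize D2 u z (EuclideanSpace.single i 1) (EuclideanSpace.single j Complex.I) = A4
    generalize (1 - ‖z‖ ^ 2) / ((n : ℝ) + 1) = c
    have : (4 : ℂ) * (((c : ℝ) : ℂ) * ((if i = j then 1 else 0) - (starRingEnd ℂ) (z i) * z j) *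
        (1 / 4 * (((A1 + A2 : ℝ) : ℂ) + Complex.I * ((A3 - A4 : ℝ) : ℂ))))
        = (c : ℂ) * ((((if i = j then 1 else 0 : ℝ) : ℂ) - (starRingEnd ℂ) (z i) * z j) *
        (((A1 + A2 : ℝ) : ℂ) + Complex.I * ((A3 - A4 : ℝ) : ℂ))) := by
      split_ifs <;> push_cast <;> ring
    rw [this, Complex.re_ofReal_mul]
    congr 1
    split_ifs
    · simp; ring
    · simp only [Complex.mul_re, Complex.sub_re, Complex.sub_im, Complex.add_re, Complex.add_im,
        Complex.mul_im, Complex.ofReal_re, Complex.ofReal_im, Complex.I_re, Complex.I_im,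
        Complex.conj_re, Complex.conj_im]
      ring
  rw [invLaplacian, Finset.mul_sum, Complex.re_sum]
  simp only [Finset.mul_sum, Complex.re_sum, hterm]
  simp only [← Finset.mul_sum, Finset.sum_sub_distrib, Finset.sum_ite_eq, Finset.mem_univ, if_true]
  rw [Lop, bergmanTrace, sub_sub, hzz (D2 u z)]
  simp only [Finset.sum_sub_distrib]

/-! ### Calculus of the pseudohyperbolic distance -/

/-- The squared pseudohyperbolic distance `‖b_a z‖ ^ 2` of two points of the ball. -/
def bx (a z : Cn n) : ℝ := 1 - (1 - ‖a‖ ^ 2) * (1 - ‖z‖ ^ 2) / ‖1 - inner ℂ a z‖ ^ 2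

/-- The real linear form `v ↦ Re ⟨v, a⟩`. -/
def reInner (a : Cn n) : Cn n →L[ℝ] ℝ := Complex.reCLM ∘L (innerSL ℂ a).restrictScalars ℝ

lemma reInner_apply (a v : Cn n) : reInner a v = (inner ℂ a v).re := rfl

lemma reInner_I (a v : Cn n) : reInner a (Complex.I • v) = -(inner ℂ a v).im := by
  simp [reInner_apply]

lemma inner_eq (a v : Cn n) : inner ℂ a v = ∑ i, v i * (starRingEnd ℂ) (a i) := by
  simp [PiLp.inner_apply]

lemma reInner_single (a : Cn n) (i : Fin n) : reInner a (EuclideanSpace.single i 1) = (a i).re := by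
  simp [reInner_apply, inner_eq]

lemma reInner_single_I (a : Cn n) (i : Fin n) :
    reInner a (EuclideanSpace.single i Complex.I) = (a i).im := by
  simp [reInner_apply, inner_eq]

lemma reInner_comm (a v : Cn n) : reInner a v = reInner v a := by
  rw [reInner_apply, reInner_apply, ← inner_conj_symm, Complex.conj_re]

lemma reInner_self (z : Cn n) : reInner z z = ‖z‖ ^ 2 := by
  rw [reInner_apply]
  exact (inner_self_eq_norm_sq (𝕜 := ℂ) z)

lemma reInner_self_I (z : Cn n) : reInner z (Complex.I • z) = 0 := by
  rw [reInner_I, ← RCLike.im_eq_complex_im, inner_self_im, neg_zero]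

lemma Gam_reInner_self (z : Cn n) (α : Cn n →L[ℝ] ℝ) :
    Gam z (reInner z) α = (1 - ‖z‖ ^ 2) * α z := by
  simp only [Gam, bergmanTrace, reInner_single, reInner_single_I, ← clm_apply_eq_sum, reInner_self,
    reInner_self_I]
  ring

lemma Gam_reInner (z a : Cn n) :
    Gam z (reInner a) (reInner a) = ‖a‖ ^ 2 - ‖inner ℂ a z‖ ^ 2 := by
  simp only [Gam, bergmanTrace, reInner_single, reInner_single_I, reInner_I]
  rw [reInner_apply, norm_sq_eq_sum, Complex.sq_norm, Complex.normSq_apply]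
  simp only [sq]; ring

/-- The form `v ↦ Re ⟨iv, a⟩`. -/
def reInnerI (a : Cn n) : Cn n →L[ℝ] ℝ :=
  reInner a ∘L ((Complex.I • ContinuousLinearMap.id ℂ (Cn n)).restrictScalars ℝ)

lemma reInnerI_apply (a v : Cn n) : reInnerI a v = reInner a (Complex.I • v) := by
  simp [reInnerI]

lemma reInnerI_I (a v : Cn n) : reInnerI a (Complex.I • v) = -reInner a v := by
  simp [reInnerI, smul_smul]

lemma Gam_reInnerI (z a : Cn n) : Gam z (reInnerI a) (reInnerI a) =
    Gam z (reInner a) (reInner a) := by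
  rw [← Gam_I z (reInner a)]; congr 1

/-- By `Gam_I` the value equals Γ(-β, α), its own negative. This is the orthogonality of the
gradients of the real and imaginary parts of a holomorphic function. -/
lemma Gam_eq_zero_of_I (z : Cn n) (α β : Cn n →L[ℝ] ℝ) (h1 : ∀ v, α (Complex.I • v) = -β v)
    (h2 : ∀ v, β (Complex.I • v) = α v) : Gam z α β = 0 := by
  have h := Gam_I z α β
  simp only [h1, h2] at h
  have h3 := Gam_smul_left z (-1) β α
  simp only [neg_mul, one_mul] at h3
  rw [Gam_comm z α β] at h ⊢
  linarith

lemma Gam_reInner_reInnerI (z a : Cn n) : Gam z (reInner a) (reInnerI a) = 0 := by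
  rw [Gam_comm]
  exact Gam_eq_zero_of_I z _ _ (fun v => reInnerI_I a v) fun v => (reInnerI_apply a v).symm

lemma hasFDerivAt_norm_sq (z : Cn n) :
    HasFDerivAt (fun z : Cn n => ‖z‖ ^ 2) ((2 : ℝ) • reInner z) z := by
  refine (hasStrictFDerivAt_norm_sq z).hasFDerivAt.congr_fderiv ?_
  ext v
  simp [reInner_apply, PiLp.inner_apply, Complex.re_sum, two_smul]

lemma contDiff_norm_sq' {m : WithTop ℕ∞} : ContDiff ℝ m (fun z : Cn n => ‖z‖ ^ 2) := contDiff_norm_sq ℝ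

lemma D2_norm_sq (z v w : Cn n) : D2 (fun z : Cn n => ‖z‖ ^ 2) z v w = 2 * reInner v w := by
  have h := hasFDerivAt_fderiv_apply (u := fun z : Cn n => ‖z‖ ^ 2) (z := z)
    contDiff_norm_sq'.contDiffAt w
  have h2 : (fun y => fderiv ℝ (fun z : Cn n => ‖z‖ ^ 2) y w)
      = fun y => ((2 : ℝ) • reInner w) y := by
    ext y
    rw [(hasFDerivAt_norm_sq y).fderiv]
    simp only [smul_apply, smul_eq_mul, reInner_apply]
    rw [← inner_conj_symm, Complex.conj_re]
  rw [h2] at h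
  have := h.unique ((2 : ℝ) • reInner w).hasFDerivAt
  have := DFunLike.congr_fun this v
  simp only [ContinuousLinearMap.flip_apply, smul_apply, smul_eq_mul] at this
  rw [this, reInner_apply, ← inner_conj_symm, Complex.conj_re]; rfl

lemma Lop_norm_sq (z : Cn n) : Lop (fun z : Cn n => ‖z‖ ^ 2) z = 4 * (n - ‖z‖ ^ 2) := by
  simp only [Lop, bergmanTrace, D2_norm_sq, reInner_self, norm_smul, Complex.norm_I, one_mul,
    PiLp.norm_single, norm_one]
  simp; ring

lemma D2_affine (c : ℝ) (α : Cn n →L[ℝ] ℝ) (z : Cn n) : D2 (fun y => c + α y) z = 0 := by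
  have : fderiv ℝ (fun y => c + α y) = fun _ => α := by
    ext1 y; simp
  rw [D2, this]; simp

lemma Lop_affine (c : ℝ) (α : Cn n →L[ℝ] ℝ) (z : Cn n) : Lop (fun y => c + α y) z = 0 := by
  simp [Lop, D2_affine, bergmanTrace]

lemma norm_one_sub_inner_sq (a z : Cn n) :
    ‖1 - inner ℂ a z‖ ^ 2 = (1 + (-reInner a) z) * (1 + (-reInner a) z)
      + (0 + reInnerI a z) * (0 + reInnerI a z) := by
  rw [Complex.sq_norm, Complex.normSq_apply]
  simp [reInnerI_apply, reInner_apply]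
  ring

lemma contDiff_affine {m : WithTop ℕ∞} (c : ℝ) (α : Cn n →L[ℝ] ℝ) : ContDiff ℝ m fun y => c + α y :=
  contDiff_const.add α.contDiff

lemma contDiff_norm_one_sub_inner_sq {m : WithTop ℕ∞} (a : Cn n) :
    ContDiff ℝ m (fun z => ‖1 - inner ℂ a z‖ ^ 2) := by
  simp only [norm_one_sub_inner_sq]
  exact ((contDiff_affine _ _).mul (contDiff_affine _ _)).add
    ((contDiff_affine _ _).mul (contDiff_affine _ _))

lemma fderiv_norm_one_sub_inner_sq (a z : Cn n) :
    fderiv ℝ (fun z => ‖1 - inner ℂ a z‖ ^ 2) z =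
      (-2 * (1 - reInner a z)) • reInner a + (2 * reInnerI a z) • reInnerI a := by
  simp only [norm_one_sub_inner_sq]
  have h1 : HasFDerivAt (fun y => 1 + (-reInner a) y) (-reInner a) z :=
    (-reInner a).hasFDerivAt.const_add 1
  have h2 : HasFDerivAt (fun y => 0 + reInnerI a y) (reInnerI a) z :=
    (reInnerI a).hasFDerivAt.const_add 0
  rw [show fderiv ℝ (fun z => (1 + (-reInner a) z) * (1 + (-reInner a) z)
    + (0 + reInnerI a z) * (0 + reInnerI a z)) z = _ from ((h1.mul h1).add (h2.mul h2)).fderiv]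
  ext v; simp; ring

/-- The function is a sum of two squares of real affine functions, so only the carré du champ terms
survive, and both are equal. -/
lemma Lop_norm_one_sub_inner_sq (a z : Cn n) :
    Lop (fun z => ‖1 - inner ℂ a z‖ ^ 2) z = 4 * Gam z (reInner a) (reInner a) := by
  simp only [norm_one_sub_inner_sq]
  have hf : ContDiffAt ℝ 2 (fun y => 1 + (-reInner a) y) z := (contDiff_affine _ _).contDiffAt
  have hg : ContDiffAt ℝ 2 (fun y => 0 + reInnerI a y) z := (contDiff_affine _ _).contDiffAt
  rw [Lop_add (hf.mul hf) (hg.mul hg), Lop_mul hf hf, Lop_mul hg hg, Lop_affine, Lop_affine]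
  simp only [fderiv_const_add, ContinuousLinearMap.fderiv, Gam_reInnerI]
  have : Gam z (-reInner a : Cn n →L[ℝ] ℝ) (-reInner a : Cn n →L[ℝ] ℝ)
      = Gam z (reInner a) (reInner a) := by simp [Gam]
  rw [this]; ring

lemma Gam_add_smul (z : Cn n) (α β γ δ : Cn n →L[ℝ] ℝ) (a b c d : ℝ) :
    Gam z (a • α + b • β : Cn n →L[ℝ] ℝ) (c • γ + d • δ : Cn n →L[ℝ] ℝ) =
      a * c * Gam z α γ + a * d * Gam z α δ + b * c * Gam z β γ + b * d * Gam z β δ := by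
  simp only [Gam, bergmanTrace, add_apply, smul_apply, smul_eq_mul]
  have : ∀ e : Cn n, (a * α e + b * β e) * (c * γ e + d * δ e) = a * c * (α e * γ e)
    + a * d * (α e * δ e) + b * c * (β e * γ e) + b * d * (β e * δ e) := fun e => by ring
  simp only [this, mul_sub, mul_add, Finset.sum_add_distrib, Finset.mul_sum]
  ring

section bx

variable {a z : Cn n}

lemma contDiffAt_bx {m : WithTop ℕ∞} (h : inner ℂ a z ≠ 1) : ContDiffAt ℝ m (bx a) z := by
  have h0 : ‖1 - inner ℂ a z‖ ^ 2 ≠ 0 := by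
    simpa [sub_eq_zero] using Ne.symm h
  exact contDiffAt_const.sub ((contDiffAt_const.mul (contDiffAt_const.sub
    contDiff_norm_sq'.contDiffAt)).div (contDiff_norm_one_sub_inner_sq a).contDiffAt h0)

/-- Up to the factor 1 - ‖z‖², both the Laplacian and the squared gradient of `bx a` depend on `bx a
z` alone, and not on a. This direct computation takes the place of the invariance of the Laplacian
under automorphisms. -/
lemma Lop_bx_aux (h : inner ℂ a z ≠ 1) :
    (1 - ‖z‖ ^ 2) * Lop (bx a) z = 4 * (1 - bx a z) * (n - bx a z) ∧
    (1 - ‖z‖ ^ 2) * Gam z (fderiv ℝ (bx a) z) (fderiv ℝ (bx a) z)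
      = 4 * (1 - bx a z) ^ 2 * bx a z := by
  set s2 := 1 - ‖a‖ ^ 2 with hs2
  set f : Cn n → ℝ := fun z => ‖z‖ ^ 2 with hf
  set g : Cn n → ℝ := fun z => ‖1 - inner ℂ a z‖ ^ 2 with hg
  have hN : g z ≠ 0 := by simpa [hg, sub_eq_zero] using Ne.symm h
  have cf : ContDiffAt ℝ 2 f z := contDiff_norm_sq'.contDiffAt
  have cg : ContDiffAt ℝ 2 g z := (contDiff_norm_one_sub_inner_sq a).contDiffAt
  have cgi : ContDiffAt ℝ 2 (fun y => (g y)⁻¹) z := cg.inv hN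
  have hinv : ContDiffAt ℝ 2 (fun x : ℝ => x⁻¹) (g z) := contDiffAt_inv ℝ hN
  have cl : ContDiffAt ℝ 2 (fun y => -s2 + s2 * f y) z :=
    contDiffAt_const.add (contDiffAt_const.mul cf)
  have hbx : bx a = fun y => 1 + (-s2 + s2 * f y) * (g y)⁻¹ := by
    ext y; simp only [bx, hf, hg]; rw [div_eq_mul_inv]; ring
  have c1 : ∀ c : ℝ, ContDiffAt ℝ 2 (fun _ : Cn n => c) z := fun c => contDiffAt_const
  have Lc : ∀ c : ℝ, Lop (fun _ : Cn n => c) z = 0 := fun c => by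
    simp [Lop, D2, bergmanTrace]
  have L1 : Lop (fun y => -s2 + s2 * f y) z = s2 * (4 * (n - ‖z‖ ^ 2)) := by
    rw [Lop_add (c1 _) ((c1 _).mul cf), Lc, Lop_mul (c1 _) cf, Lop_norm_sq, Lc]
    simp [Gam, bergmanTrace]
  have F1 : fderiv ℝ (fun y => -s2 + s2 * f y) z = (2 * s2) • reInner z := by
    rw [show fderiv ℝ (fun y => -s2 + s2 * f y) z = _ from
      (((hasFDerivAt_norm_sq z).const_mul s2).const_add (-s2)).fderiv, smul_smul]
    ring_nf
  have Fg := fderiv_norm_one_sub_inner_sq a z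
  rw [← hg] at Fg
  have Lg := Lop_norm_one_sub_inner_sq a z
  rw [← hg] at Lg
  have dinv : deriv (fun x : ℝ => x⁻¹) = fun x => -(x ^ 2)⁻¹ := by ext x; simp
  have ddinv : deriv (fun x : ℝ => -(x ^ 2)⁻¹) (g z) = 2 * (g z)⁻¹ ^ 3 := by
    rw [deriv.fun_neg, deriv_fun_inv'' (by fun_prop) (by positivity)]
    simp; field_simp
  have Fgi : fderiv ℝ (fun y => (g y)⁻¹) z = (-((g z) ^ 2)⁻¹) • fderiv ℝ g z := by
    rw [fderiv_comp_real (h := fun x => x⁻¹) (cg.differentiableAt two_ne_zero)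
      (hinv.differentiableAt two_ne_zero), dinv]
  have Lgi := Lop_comp (h := fun x => x⁻¹) cg hinv
  rw [dinv, ddinv] at Lgi
  set G := Gam z (reInner a) (reInner a) with hG
  have GN : Gam z (fderiv ℝ g z) (fderiv ℝ g z) = 4 * g z * G := by
    have h0 : g z = (1 - reInner a z) ^ 2 + reInnerI a z ^ 2 := by
      simp only [hg, norm_one_sub_inner_sq, neg_apply]; ring
    rw [Fg, Gam_add_smul, Gam_reInnerI, Gam_reInner_reInnerI, Gam_comm z (reInnerI a),
      Gam_reInner_reInnerI, h0]
    ring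
  have GDN : Gam z (reInner z) (fderiv ℝ g z) = (1 - ‖z‖ ^ 2) * (2 * g z - 2 * (1 - reInner a z)) := by
    have h0 : g z = (1 - reInner a z) ^ 2 + reInnerI a z ^ 2 := by
      simp only [hg, norm_one_sub_inner_sq, neg_apply]; ring
    rw [Gam_reInner_self, Fg, h0]
    simp only [add_apply, smul_apply, smul_eq_mul]
    ring
  have GD : Gam z (reInner z) (reInner z) = (1 - ‖z‖ ^ 2) * ‖z‖ ^ 2 := by
    rw [Gam_reInner_self, reInner_self]
  -- From |t|² = |1-t|² - 1 + 2 Re t with t = ⟨z,a⟩. Everything is now expressed through g, ‖z‖²,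
  -- ‖a‖² and Re t, and Re t cancels at the end.
  have hGe : G = ‖a‖ ^ 2 - (1 - 2 * (1 - reInner a z) + g z) := by
    rw [hG, Gam_reInner, Complex.sq_norm, Complex.normSq_apply]
    have : g z = (1 - (inner ℂ a z).re) ^ 2 + (inner ℂ a z).im ^ 2 := by
      simp only [hg]; rw [Complex.sq_norm, Complex.normSq_apply]; simp; ring
    rw [this, reInner_apply]; ring
  have gsm : ∀ (α β : Cn n →L[ℝ] ℝ) (c d : ℝ), Gam z (c • α : Cn n →L[ℝ] ℝ)
      (d • β : Cn n →L[ℝ] ℝ) = c * d * Gam z α β := fun α β c d => by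
    have := Gam_add_smul z α 0 β 0 c 0 d 0
    simpa using this
  have hbz : bx a z = 1 + (-s2 + s2 * ‖z‖ ^ 2) * (g z)⁻¹ := by rw [hbx]
  have ha : ‖a‖ ^ 2 = 1 - s2 := by rw [hs2]; ring
  constructor
  · rw [hbz, hbx, Lop_add (c1 1) (cl.mul cgi), Lc, Lop_mul cl cgi, Lgi, L1, F1, Fgi, gsm, GN, GDN, Lg,
      hGe, ha]
    simp only [hf]
    generalize g z = N at *
    generalize ‖z‖ ^ 2 = Z
    field_simp
    ring
  · rw [hbz, hbx]
    have Fb : fderiv ℝ (fun y => 1 + (-s2 + s2 * f y) * (g y)⁻¹) z =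
        (2 * s2 * (g z)⁻¹) • reInner z
        + (-(-s2 + s2 * f z) * ((g z) ^ 2)⁻¹) • fderiv ℝ g z := by
      rw [fderiv_const_add, fderiv_fun_mul (cl.differentiableAt two_ne_zero)
        (cgi.differentiableAt two_ne_zero), F1, Fgi]
      ext v; simp; ring
    rw [Fb, Gam_add_smul, GD, Gam_comm z (fderiv ℝ g z) (reInner z), GDN, GN, hGe, ha]
    simp only [hf]
    generalize g z = N at *
    generalize ‖z‖ ^ 2 = Z
    field_simp
    ring

/-- The Laplacian becomes a second-order ordinary differential operator in x = `bx a z`. -/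
lemma Lop_comp_bx (h : inner ℂ a z ≠ 1) {k : ℝ → ℝ} (hk : ContDiffAt ℝ 2 k (bx a z)) :
    (1 - ‖z‖ ^ 2) * Lop (fun y => k (bx a y)) z = 4 * (1 - bx a z) *
      ((n - bx a z) * deriv k (bx a z)
        + bx a z * (1 - bx a z) * deriv (deriv k) (bx a z)) := by
  obtain ⟨h1, h2⟩ := Lop_bx_aux h
  rw [Lop_comp (contDiffAt_bx h) hk, mul_add, mul_left_comm, h1, mul_left_comm _ (deriv (deriv k) _), h2]
  ring

lemma bx_comm (a z : Cn n) : bx a z = bx z a := by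
  have : ‖1 - inner ℂ a z‖ = ‖1 - inner ℂ z a‖ := by
    rw [← RCLike.norm_conj, map_sub, map_one, inner_conj_symm]
  rw [bx, bx, this, mul_comm (1 - ‖a‖ ^ 2)]

end bx

/-! ### Integration by parts and symmetry of the invariant Laplacian -/

lemma isOpen_unitBall : IsOpen (unitBall n) := Metric.isOpen_ball

lemma mem_unitBall {z : Cn n} : z ∈ unitBall n ↔ ‖z‖ < 1 := by simp

lemma one_sub_norm_sq_pos {z : Cn n} (hz : z ∈ unitBall n) : 0 < 1 - ‖z‖ ^ 2 := by
  rw [mem_unitBall] at hz; nlinarith [norm_nonneg z]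

lemma contDiff_of_eq_zero_off {E F : Type*} [NormedAddCommGroup E] [NormedSpace ℝ E]
    [NormedAddCommGroup F] [NormedSpace ℝ F] {m : WithTop ℕ∞} {f : E → F} {U K : Set E}
    (hK : IsClosed K) (hKU : K ⊆ U) (hf : ∀ z ∈ U, ContDiffAt ℝ m f z) (h0 : ∀ z ∉ K, f z = 0) :
    ContDiff ℝ m f := by
  rw [contDiff_iff_contDiffAt]
  intro z
  by_cases hz : z ∈ K
  · exact hf z (hKU hz)
  · have : f =ᶠ[𝓝 z] fun _ => 0 := by
      filter_upwards [hK.isOpen_compl.mem_nhds hz] with y hy using h0 y hy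
    exact contDiffAt_const.congr_of_eventuallyEq this

lemma integrableOn_of_continuousOn {E F : Type*} [TopologicalSpace E] [T2Space E] [MeasurableSpace E]
    [OpensMeasurableSpace E] [SecondCountableTopology E]
    [NormedAddCommGroup F] {μ : Measure E} {K : Set E} (hK : IsCompact K)
    (hμ : μ K < ⊤) {f : E → F} (hf : ContinuousOn f K) : IntegrableOn f K μ := by
  obtain ⟨C, hC⟩ := hK.exists_bound_of_continuousOn hf
  have : IsFiniteMeasure (μ.restrict K) := ⟨by simpa using hμ⟩
  exact Integrable.of_bound (hf.aestronglyMeasurable_of_isCompact hK hK.measurableSet) C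
    (ae_restrict_of_forall_mem hK.measurableSet hC)

lemma integrable_of_continuousOn_zero_off {E F : Type*} [TopologicalSpace E] [T2Space E] [MeasurableSpace E]
    [OpensMeasurableSpace E] [SecondCountableTopology E]
    [NormedAddCommGroup F] {μ : Measure E} {K : Set E} (hK : IsCompact K)
    (hμ : μ K < ⊤) {f : E → F} (hf : ContinuousOn f K) (h0 : ∀ z ∉ K, f z = 0) : Integrable f μ := by
  rw [← integrableOn_iff_integrable_of_support_subset (s := K)]
  · exact integrableOn_of_continuousOn hK hμ hf
  · intro z hz; by_contra h; exact hz (h0 z h)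

lemma integral_clm_mul_fderiv {w : Cn n → ℝ} (hw : ContDiff ℝ 1 w) (hc : HasCompactSupport w)
    (α : Cn n →L[ℝ] ℝ) (v : Cn n) : ∫ z, α z * fderiv ℝ w z v = -(α v * ∫ z, w z) := by
  have hw' : Continuous fun z => fderiv ℝ w z v :=
    (hw.continuous_fderiv one_ne_zero).clm_apply continuous_const
  have hc' : HasCompactSupport fun z => fderiv ℝ w z v :=
    hc.fderiv_apply (𝕜 := ℝ) v
  rw [integral_mul_fderiv_eq_neg_fderiv_mul_of_integrable]
  · simp [integral_const_mul]
  · simp only [ContinuousLinearMap.fderiv]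
    exact (hw.continuous.integrable_of_hasCompactSupport hc).const_mul _
  · exact (α.continuous.mul hw').integrable_of_hasCompactSupport hc'.mul_left
  · exact (α.continuous.mul hw.continuous).integrable_of_hasCompactSupport hc.mul_left
  · exact fun x _ => α.differentiableAt
  · exact fun x _ => hw.differentiable one_ne_zero x

lemma integral_fderiv_apply_eq_zero {w : Cn n → ℝ} (hw : ContDiff ℝ 1 w) (hc : HasCompactSupport w)
    (v : Cn n) : ∫ z, fderiv ℝ w z v = 0 := by
  have hw' : Continuous fun z => fderiv ℝ w z v :=
    (hw.continuous_fderiv one_ne_zero).clm_apply continuous_const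
  have hc' : HasCompactSupport fun z => fderiv ℝ w z v :=
    hc.fderiv_apply (𝕜 := ℝ) v
  have := integral_mul_fderiv_eq_neg_fderiv_mul_of_integrable (μ := (volume : Measure (Cn n)))
    (f := fun _ => (1 : ℝ)) (g := w) (v := v) (by simp)
    (by simpa using hw'.integrable_of_hasCompactSupport hc')
    (by simpa using hw.continuous.integrable_of_hasCompactSupport hc)
    (fun x _ => by simp) (fun x _ => hw.differentiable one_ne_zero x)
  simpa using this

lemma integrable_mul_fderiv {w : Cn n → ℝ} (hw : ContDiff ℝ 1 w) (hc : HasCompactSupport w)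
    (α : Cn n →L[ℝ] ℝ) (v : Cn n) : Integrable fun z => α z * fderiv ℝ w z v := by
  have hw' : Continuous fun z => fderiv ℝ w z v :=
    (hw.continuous_fderiv one_ne_zero).clm_apply continuous_const
  have hc' : HasCompactSupport fun z => fderiv ℝ w z v :=
    hc.fderiv_apply (𝕜 := ℝ) v
  exact (α.continuous.mul hw').integrable_of_hasCompactSupport hc'.mul_left

/-- The radial vector field has divergence 2n. -/
lemma integral_fderiv_self {w : Cn n → ℝ} (hw : ContDiff ℝ 1 w) (hc : HasCompactSupport w) :
    ∫ z, fderiv ℝ w z z = -(2 * n * ∫ z, w z) := by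
  have h : ∀ z : Cn n, fderiv ℝ w z z = ∑ i,
      (reInner (EuclideanSpace.single i 1) z * fderiv ℝ w z (EuclideanSpace.single i 1)
      + reInner (EuclideanSpace.single i Complex.I) z
        * fderiv ℝ w z (EuclideanSpace.single i Complex.I)) := by
    intro z
    rw [clm_apply_eq_sum]
    simp [reInner_comm _ z, reInner_single, reInner_single_I]
  simp only [h]
  rw [integral_finsetSum]
  swap
  · exact fun i _ => (integrable_mul_fderiv hw hc _ _).add (integrable_mul_fderiv hw hc _ _)
  simp_rw [integral_add (integrable_mul_fderiv hw hc _ _) (integrable_mul_fderiv hw hc _ _),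
    integral_clm_mul_fderiv hw hc]
  simp [reInner_self]; ring

/-- The rotation field z ↦ iz has divergence zero. -/
lemma integral_fderiv_I {w : Cn n → ℝ} (hw : ContDiff ℝ 1 w) (hc : HasCompactSupport w) :
    ∫ z, fderiv ℝ w z (Complex.I • z) = 0 := by
  have h : ∀ z : Cn n, fderiv ℝ w z (Complex.I • z) = ∑ i,
      ((-reInner (EuclideanSpace.single i Complex.I)) z * fderiv ℝ w z (EuclideanSpace.single i 1)
      + reInner (EuclideanSpace.single i 1) z
        * fderiv ℝ w z (EuclideanSpace.single i Complex.I)) := by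
    intro z
    rw [clm_apply_I_eq_sum]
    simp [reInner_comm _ z, reInner_single, reInner_single_I]
  simp only [h]
  rw [integral_finsetSum]
  swap
  · exact fun i _ => (integrable_mul_fderiv hw hc _ _).add (integrable_mul_fderiv hw hc _ _)
  simp_rw [integral_add (integrable_mul_fderiv hw hc _ _) (integrable_mul_fderiv hw hc _ _),
    integral_clm_mul_fderiv hw hc]
  simp [reInner_single, reInner_single_I]

/-- The divergence identity behind the symmetry of the invariant Laplacian. -/
lemma integral_bergmanTrace_fderiv {Θ : Cn n → Cn n →L[ℝ] ℝ} (hΘ : ContDiff ℝ 1 Θ)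
    (hc : HasCompactSupport Θ) :
    ∫ z, (bergmanTrace z (fun v w => fderiv ℝ Θ z v w) - 2 * n * Θ z z) = 0 := by
  have hd : ∀ z, HasFDerivAt Θ (fderiv ℝ Θ z) z := fun z =>
    (hΘ.differentiable one_ne_zero z).hasFDerivAt
  have cS : ∀ e : Cn n → Cn n, HasCompactSupport fun z => Θ z (e z) := fun e =>
    hc.mono' fun z hz => subset_tsupport _ fun h => hz (by simp [h])
  have h1 : ∀ v : Cn n, ContDiff ℝ 1 fun z => Θ z v := fun v => hΘ.clm_apply contDiff_const
  have h2 : ContDiff ℝ 1 fun z => Θ z z := hΘ.clm_apply contDiff_id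
  have hI : ContDiff ℝ 1 fun z : Cn n => Complex.I • z := contDiff_const_smul _
  have h3 : ContDiff ℝ 1 fun z => Θ z (Complex.I • z) := hΘ.clm_apply hI
  have d1 : ∀ v z w, fderiv ℝ (fun z => Θ z v) z w = fderiv ℝ Θ z w v := fun v z w => by
    rw [((hd z).clm_apply (hasFDerivAt_const v z)).fderiv]; simp
  have d2 : ∀ z w, fderiv ℝ (fun z => Θ z z) z w = fderiv ℝ Θ z w z + Θ z w := fun z w => by
    rw [show fderiv ℝ (fun z => Θ z z) z = _ from ((hd z).clm_apply (hasFDerivAt_id z)).fderiv]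
    simp [add_comm]
  have hId : ∀ z, HasFDerivAt (fun z : Cn n => Complex.I • z)
      (Complex.I • ContinuousLinearMap.id ℝ (Cn n)) z := fun z => (hasFDerivAt_id z).const_smul Complex.I
  have d3 : ∀ z w, fderiv ℝ (fun z => Θ z (Complex.I • z)) z w =
      fderiv ℝ Θ z w (Complex.I • z) + Θ z (Complex.I • w) := fun z w => by
    rw [((hd z).clm_apply (hId z)).fderiv]; simp [add_comm]
  -- Divergence theorem for the constant, radial and rotation fields. By the product rule the last
  -- two produce the extra terms Θ z z and -Θ z z, so the total coefficient of ∫ Θ z z is (2n + 1) -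
  -- 1 - 2n = 0.
  have i1 := fun v => integral_fderiv_apply_eq_zero (h1 v) (cS _) v
  have i2 := integral_fderiv_self h2 (cS _)
  have i3 := integral_fderiv_I h3 (cS _)
  simp only [d1, d2, d3, smul_smul, Complex.I_mul_I, neg_smul, one_smul, map_neg] at i1 i2 i3
  have cf : Continuous (fderiv ℝ Θ) := hΘ.continuous_fderiv one_ne_zero
  have cf' := hc.fderiv (𝕜 := ℝ)
  have cS' : ∀ e f : Cn n → Cn n, HasCompactSupport fun z => fderiv ℝ Θ z (e z) (f z) := fun e f =>
    cf'.mono' fun z hz => subset_tsupport _ fun h => hz (by simp [h])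
  have j1 : ∀ v, Integrable fun z => fderiv ℝ Θ z v v := fun v =>
    ((cf.clm_apply continuous_const).clm_apply continuous_const).integrable_of_hasCompactSupport
      (cS' (fun _ => v) fun _ => v)
  have j2 : Integrable fun z => fderiv ℝ Θ z z z :=
    ((cf.clm_apply continuous_id).clm_apply continuous_id).integrable_of_hasCompactSupport
      (cS' (fun z => z) fun z => z)
  have j3 : Integrable fun z => fderiv ℝ Θ z (Complex.I • z) (Complex.I • z) :=
    ((cf.clm_apply hI.continuous).clm_apply hI.continuous).integrable_of_hasCompactSupport
      (cS' (fun z => Complex.I • z) fun z => Complex.I • z)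
  have j4 : Integrable fun z => Θ z z := h2.continuous.integrable_of_hasCompactSupport (cS _)
  rw [integral_add j2 j4] at i2
  have j5 : Integrable fun z => -Θ z z := j4.neg
  rw [integral_add j3 j5, integral_neg] at i3
  have j0 : Integrable fun z => ∑ i : Fin n,
      (fderiv ℝ Θ z (EuclideanSpace.single i 1) (EuclideanSpace.single i 1)
      + fderiv ℝ Θ z (EuclideanSpace.single i Complex.I) (EuclideanSpace.single i Complex.I)) :=
    integrable_finsetSum _ fun i _ => (j1 _).add (j1 _)
  have i0 : ∫ z, ∑ i : Fin n, (fderiv ℝ Θ z (EuclideanSpace.single i 1) (EuclideanSpace.single i 1)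
      + fderiv ℝ Θ z (EuclideanSpace.single i Complex.I) (EuclideanSpace.single i Complex.I)) = 0 := by
    rw [integral_finsetSum]
    swap
    · exact fun i _ => (j1 _).add (j1 _)
    simp_rw [integral_add (j1 _) (j1 _), i1]
    simp
  simp only [bergmanTrace]
  have k1 := j0.sub' j2
  have k2 := k1.sub' j3
  rw [integral_sub k2 (j4.const_mul _), integral_sub k1 j3,
    integral_sub j0 j2, integral_const_mul]
  rw [i0]
  linarith

lemma contDiffAt_of_ball {u : Cn n → ℝ} {m : WithTop ℕ∞} (hu : ContDiffOn ℝ m u (unitBall n))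
    {z : Cn n} (hz : z ∈ unitBall n) : ContDiffAt ℝ m u z :=
  hu.contDiffAt (isOpen_unitBall.mem_nhds hz)

lemma continuousAt_Lop {u : Cn n → ℝ} {z : Cn n} (hu : ContDiffAt ℝ 2 u z) :
    ContinuousAt (Lop u) z := by
  have h : ContinuousAt (D2 u) z :=
    ((hu.fderiv_right (m := 1) (by norm_num)).fderiv_right (m := 0) (by norm_num)).continuousAt
  have hI : ContinuousAt (fun z : Cn n => Complex.I • z) z := by fun_prop
  unfold Lop bergmanTrace
  refine ContinuousAt.sub (ContinuousAt.sub ?_ ((h.clm_apply continuousAt_id).clm_apply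
    continuousAt_id)) ((h.clm_apply hI).clm_apply hI)
  refine tendsto_finsetSum _ fun i _ => ?_
  exact ContinuousAt.add ((h.clm_apply continuousAt_const).clm_apply continuousAt_const)
    ((h.clm_apply continuousAt_const).clm_apply continuousAt_const)

lemma continuousOn_Lop {u : Cn n → ℝ} (hu : ContDiffOn ℝ 2 u (unitBall n)) :
    ContinuousOn (Lop u) (unitBall n) := fun _ hz =>
  (continuousAt_Lop (contDiffAt_of_ball hu hz)).continuousWithinAt

lemma continuousOn_invLaplacian {u : Cn n → ℝ} (hu : ContDiffOn ℝ 2 u (unitBall n)) :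
    ContinuousOn (invLaplacian u) (unitBall n) := by
  have : ContinuousOn (fun z : Cn n => (1 - ‖z‖ ^ 2) / (n + 1) * Lop u z) (unitBall n) :=
    ContinuousOn.mul (by fun_prop) (continuousOn_Lop hu)
  exact this.congr fun z hz => invLaplacian_eq (contDiffAt_of_ball hu hz)

lemma Lop_eq_zero_of_notMem_tsupport {ψ : Cn n → ℝ} {z : Cn n} (h : z ∉ tsupport ψ) :
    Lop ψ z = 0 := by
  rw [Lop_congr (notMem_tsupport_iff_eventuallyEq.1 h)]
  have : D2 (0 : Cn n → ℝ) z = 0 := by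
    rw [D2]
    simp
  simp [Lop, this, bergmanTrace]

lemma invLaplacian_eq_zero_of_notMem_tsupport {ψ : Cn n → ℝ} {z : Cn n} (h : z ∉ tsupport ψ) :
    invLaplacian ψ z = 0 := by
  have hz := notMem_tsupport_iff_eventuallyEq.1 h
  rw [invLaplacian_eq (contDiffAt_const.congr_of_eventuallyEq hz : ContDiffAt ℝ 2 ψ z),
    Lop_eq_zero_of_notMem_tsupport h, mul_zero]

lemma fderiv_weight {z : Cn n} (hz : z ∈ unitBall n) :
    HasFDerivAt (fun z : Cn n => ((1 - ‖z‖ ^ 2) ^ n)⁻¹)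
      ((2 * (n : ℝ) * ((1 - ‖z‖ ^ 2) ^ (n + 1))⁻¹) • reInner z) z := by
  have hp := one_sub_norm_sq_pos hz
  have h1 : HasDerivAt (fun x : ℝ => ((1 - x) ^ n)⁻¹)
      (n * ((1 - ‖z‖ ^ 2) ^ (n + 1))⁻¹) (‖z‖ ^ 2) := by
    have h := (((hasDerivAt_id (‖z‖ ^ 2)).const_sub 1).pow n).inv (pow_pos hp n).ne'
    refine h.congr_deriv ?_
    rcases n with _ | m
    · simp
    · simp only [id, Nat.add_sub_cancel, Pi.pow_apply]; field_simp; ring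
  refine (h1.comp_hasFDerivAt z (hasFDerivAt_norm_sq z)).congr_fderiv ?_
  rw [smul_smul]; ring_nf

/-- The weight has exponent n because the density of dg has exponent n + 1 and the invariant
Laplacian carries one factor 1 - ‖z‖². The integrand is the divergence expression of the form W(ψ du
- u dψ). -/
theorem integral_Lop_symm {u ψ : Cn n → ℝ} (hu : ContDiffOn ℝ 2 u (unitBall n))
    (hψ : ContDiff ℝ 2 ψ) (hc : HasCompactSupport ψ) (hs : tsupport ψ ⊆ unitBall n) :
    ∫ z, ((1 - ‖z‖ ^ 2) ^ n)⁻¹ * (ψ z * Lop u z - u z * Lop ψ z) = 0 := by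
  set W : Cn n → ℝ := fun z => ((1 - ‖z‖ ^ 2) ^ n)⁻¹ with hW
  set Θ : Cn n → Cn n →L[ℝ] ℝ := fun z => W z • (ψ z • fderiv ℝ u z - u z • fderiv ℝ ψ z) with hΘ
  have hψ0 : ∀ z ∉ tsupport ψ, ψ z = 0 := fun z hz => image_eq_zero_of_notMem_tsupport hz
  have hψ1 : ∀ z ∉ tsupport ψ, fderiv ℝ ψ z = 0 := fun z hz => fderiv_of_notMem_tsupport ℝ hz
  have hΘ0 : ∀ z ∉ tsupport ψ, Θ z = 0 := fun z hz => by simp [hΘ, hψ0 z hz, hψ1 z hz]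
  have hWc : ∀ z ∈ unitBall n, ContDiffAt ℝ 1 W z := fun z hz => by
    have hp := one_sub_norm_sq_pos hz
    exact ContDiffAt.inv ((contDiff_const.sub contDiff_norm_sq').pow n).contDiffAt
      (pow_pos hp n).ne'
  have hcd : ContDiff ℝ 1 Θ := by
    refine contDiff_of_eq_zero_off (isClosed_tsupport ψ) hs (fun z hz => ?_) hΘ0
    have hu' := contDiffAt_of_ball hu hz
    exact (hWc z hz).smul (((hψ.contDiffAt.of_le (by norm_num)).smul
      (hu'.fderiv_right (by norm_num))).sub ((hu'.of_le (by norm_num)).smul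
      (hψ.contDiffAt.fderiv_right (by norm_num))))
  have hΘs : HasCompactSupport Θ := HasCompactSupport.intro hc hΘ0
  rw [← integral_bergmanTrace_fderiv hcd hΘs]
  congr 1 with z
  by_cases hz : z ∈ unitBall n
  · have hu' := contDiffAt_of_ball hu hz
    have hψ' : ContDiffAt ℝ 2 ψ z := hψ.contDiffAt
    have dW := fderiv_weight hz
    have du := (hu'.differentiableAt two_ne_zero).hasFDerivAt
    have dψ := (hψ'.differentiableAt two_ne_zero).hasFDerivAt
    have ddu := (fderiv_differentiableAt hu').hasFDerivAt
    have ddψ := (fderiv_differentiableAt hψ').hasFDerivAt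
    have hD : ∀ v w, fderiv ℝ Θ z v w = (2 * n * ((1 - ‖z‖ ^ 2) ^ (n + 1))⁻¹) *
        (reInner z v * (ψ z • fderiv ℝ u z - u z • fderiv ℝ ψ z) w)
        + (W z * (ψ z * D2 u z v w + (-u z) * D2 ψ z v w)
        + (W z * (fderiv ℝ ψ z v * fderiv ℝ u z w)
        + (- W z) * (fderiv ℝ u z v * fderiv ℝ ψ z w))) := by
      intro v w
      rw [show fderiv ℝ Θ z = _ from (dW.smul ((dψ.smul ddu).sub (du.smul ddψ))).fderiv]
      simp [D2, hW]; ring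
    -- The derivative of the weight is 2n(1 - ‖z‖²)^{-n-1} Re⟨·,z⟩. Contracted with the form it
    -- yields exactly 2n Θ z z, the term subtracted in `integral_bergmanTrace_fderiv`; the
    -- first-order cross terms cancel by symmetry of Γ.
    have hG := Gam_reInner_self z (ψ z • fderiv ℝ u z - u z • fderiv ℝ ψ z)
    have hG2 := Gam_comm z (fderiv ℝ ψ z) (fderiv ℝ u z)
    simp only [Gam] at hG hG2
    simp only [hD, bergmanTrace_add, bergmanTrace_smul, hG]
    rw [hG2]
    have hp := one_sub_norm_sq_pos hz
    simp only [hΘ, hW, Lop, smul_apply, sub_apply, smul_eq_mul]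
    rw [pow_succ]
    field_simp
    ring
  · have hz' : z ∉ tsupport ψ := fun h => hz (hs h)
    have h1 : fderiv ℝ Θ z = 0 := fderiv_of_notMem_tsupport ℝ fun h =>
      hz' (closure_minimal (fun y hy => by by_contra h; exact hy (hΘ0 y h))
        (isClosed_tsupport ψ) h)
    simp [hψ0 z hz', Lop_eq_zero_of_notMem_tsupport hz', h1, hΘ0 z hz', bergmanTrace]

lemma invVolume_density_measurable :
    Measurable fun z : Cn n => ENNReal.ofReal (1 / (1 - ‖z‖ ^ 2) ^ (n + 1)) := by fun_prop

lemma integral_invVolume {f : Cn n → ℝ} :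
    ∫ z, f z ∂(invVolume n) = ∫ z in unitBall n, ((1 - ‖z‖ ^ 2) ^ (n + 1))⁻¹ * f z := by
  rw [invVolume, integral_withDensity_eq_integral_toReal_smul invVolume_density_measurable (by simp)]
  refine setIntegral_congr_fun isOpen_unitBall.measurableSet fun z hz => ?_
  have := one_sub_norm_sq_pos hz
  simp only [smul_eq_mul, one_div]
  rw [ENNReal.toReal_ofReal (by positivity)]

lemma invVolume_lt_top_of_isCompact {K : Set (Cn n)} (hK : IsCompact K) (hs : K ⊆ unitBall n) :
    invVolume n K < ⊤ := by
  rw [invVolume, withDensity_apply _ hK.measurableSet, Measure.restrict_restrict hK.measurableSet,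
    Set.inter_eq_self_of_subset_left hs]
  have hc : ContinuousOn (fun z : Cn n => 1 / (1 - ‖z‖ ^ 2) ^ (n + 1)) K := by
    refine ContinuousOn.div continuousOn_const (by fun_prop) fun z hz => ?_
    have := one_sub_norm_sq_pos (hs hz)
    positivity
  obtain ⟨C, hC⟩ := hK.exists_bound_of_continuousOn hc
  refine (setLIntegral_mono (g := fun _ => ENNReal.ofReal C) measurable_const fun z hz =>
    ENNReal.ofReal_le_ofReal ((le_abs_self _).trans (hC z hz))).trans_lt ?_
  rw [setLIntegral_const]
  exact ENNReal.mul_lt_top (by simp) hK.measure_lt_top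

/-- The invariant Laplacian is symmetric with respect to the invariant volume. -/
theorem integral_invLaplacian_symm {u ψ : Cn n → ℝ} (hu : ContDiffOn ℝ 2 u (unitBall n))
    (hψ : ContDiff ℝ 2 ψ) (hc : HasCompactSupport ψ) (hs : tsupport ψ ⊆ unitBall n) :
    ∫ z, ψ z * invLaplacian u z ∂(invVolume n) = ∫ z, u z * invLaplacian ψ z ∂(invVolume n) := by
  have hg := invVolume_lt_top_of_isCompact hc hs
  have i1 : Integrable (fun z => ψ z * invLaplacian u z) (invVolume n) :=
    integrable_of_continuousOn_zero_off hc hg (hψ.continuous.continuousOn.mul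
      ((continuousOn_invLaplacian hu).mono hs)) fun z hz => by
        rw [image_eq_zero_of_notMem_tsupport hz, zero_mul]
  have i2 : Integrable (fun z => u z * invLaplacian ψ z) (invVolume n) :=
    integrable_of_continuousOn_zero_off hc hg ((hu.continuousOn.mono hs).mul
      ((continuousOn_invLaplacian hψ.contDiffOn).mono hs)) fun z hz => by
        rw [invLaplacian_eq_zero_of_notMem_tsupport hz, mul_zero]
  rw [← sub_eq_zero, ← integral_sub i1 i2, integral_invVolume]
  have h := congrArg (fun t => (1 / ((n : ℝ) + 1)) * t) (integral_Lop_symm hu hψ hc hs)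
  simp only [mul_zero] at h
  rw [← h, ← integral_const_mul, ← integral_indicator isOpen_unitBall.measurableSet]
  congr 1 with z
  by_cases hz : z ∈ unitBall n
  · rw [Set.indicator_of_mem hz, invLaplacian_eq (contDiffAt_of_ball hu hz), invLaplacian_eq hψ.contDiffAt,
      pow_succ]
    have := one_sub_norm_sq_pos hz
    field_simp
  · have hz' : z ∉ tsupport ψ := fun h => hz (hs h)
    rw [Set.indicator_of_notMem hz, image_eq_zero_of_notMem_tsupport hz',
      Lop_eq_zero_of_notMem_tsupport hz']
    simp

/-! ### Polar coordinates -/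

section polar

lemma finrank_Cn (n : ℕ) : Module.finrank ℝ (Cn n) = 2 * n := by
  rw [finrank_real_of_complex]; simp

lemma nontrivial_Cn (hn : 1 ≤ n) : Nontrivial (Cn n) := by
  have : NeZero n := ⟨by omega⟩
  infer_instance

/-- The total mass `2 n vol(𝔹)` of the unnormalized surface measure. -/
lemma toSphere_univ (hn : 1 ≤ n) : (volume : Measure (Cn n)).toSphere Set.univ
    = ENNReal.ofReal (2 * n * (Real.pi ^ n / n.factorial)) := by
  have := nontrivial_Cn hn
  rw [Measure.toSphere_apply_univ, InnerProductSpace.volume_ball_of_dim_even (finrank_Cn n),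
    finrank_Cn, ENNReal.ofReal_one, one_pow, one_mul, ENNReal.ofReal_mul (by positivity)]
  congr 1
  rw [← ENNReal.ofReal_natCast]
  simp

lemma toSphere_univ_ne_zero (hn : 1 ≤ n) : (volume : Measure (Cn n)).toSphere Set.univ ≠ 0 := by
  rw [toSphere_univ hn]
  have : 0 < n := hn
  simp only [ne_eq, ENNReal.ofReal_eq_zero, not_le]
  positivity

lemma toSphere_eq (hn : 1 ≤ n) : (volume : Measure (Cn n)).toSphere
    = ENNReal.ofReal (2 * n * (Real.pi ^ n / n.factorial)) • sphereMeasure n := by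
  rw [sphereMeasure, smul_smul, ← toSphere_univ hn, ENNReal.mul_inv_cancel
    (toSphere_univ_ne_zero hn) (measure_ne_top _ _), one_smul]

lemma isProbabilityMeasure_sphereMeasure (hn : 1 ≤ n) : IsProbabilityMeasure (sphereMeasure n) := by
  constructor
  rw [sphereMeasure, Measure.smul_apply, smul_eq_mul, ENNReal.inv_mul_cancel
    (toSphere_univ_ne_zero hn) (measure_ne_top _ _)]

lemma lintegral_polar_aux (hn : 1 ≤ n) {f : Cn n → ℝ≥0∞} (hf : Measurable f) :
    ∫⁻ z, f z = ∫⁻ r in Set.Ioi (0 : ℝ), ENNReal.ofReal (r ^ (2 * n - 1)) *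
      ∫⁻ ξ, f (r • (ξ : Cn n)) ∂(volume : Measure (Cn n)).toSphere := by
  have := nontrivial_Cn hn
  have hmp := (volume : Measure (Cn n)).measurePreserving_homeomorphUnitSphereProd
  have hm : Measurable fun p : (Metric.sphere (0 : Cn n) 1) × Set.Ioi (0 : ℝ) =>
      f ((p.2 : ℝ) • (p.1 : Cn n)) := by fun_prop
  have h1 : ∫⁻ z, f z = ∫⁻ z : ({(0)}ᶜ : Set (Cn n)), f z ∂((volume : Measure (Cn n)).comap Subtype.val) := by
    rw [lintegral_subtype_comap (measurableSet_singleton _).compl, restrict_compl_singleton]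
  have h2 : ∫⁻ z : ({(0)}ᶜ : Set (Cn n)), f z ∂((volume : Measure (Cn n)).comap Subtype.val) =
      ∫⁻ p : (Metric.sphere (0 : Cn n) 1) × Set.Ioi (0 : ℝ), f ((p.2 : ℝ) • (p.1 : Cn n))
        ∂((volume : Measure (Cn n)).toSphere.prod (.volumeIoiPow (Module.finrank ℝ (Cn n) - 1))) := by
    rw [← hmp.lintegral_comp hm]
    refine lintegral_congr fun z => ?_
    have hz : ‖(z : Cn n)‖ ≠ 0 := norm_ne_zero_iff.2 z.2
    simp [homeomorphUnitSphereProd, smul_smul, hz]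
  have hm2 : Measurable fun r : Set.Ioi (0 : ℝ) =>
      ∫⁻ ξ, f ((r : ℝ) • (ξ : Cn n)) ∂(volume : Measure (Cn n)).toSphere :=
    Measurable.lintegral_prod_right' (f := fun p : Set.Ioi (0 : ℝ) × _ =>
      f ((p.1 : ℝ) • ((p.2 : Metric.sphere (0 : Cn n) 1) : Cn n))) (by fun_prop)
  rw [h1, h2, lintegral_prod_symm' _ hm, finrank_Cn, Measure.volumeIoiPow,
    lintegral_withDensity_eq_lintegral_mul _ (by fun_prop) hm2]
  simp only [Pi.mul_apply]
  rw [lintegral_subtype_comap measurableSet_Ioi fun r : ℝ => ENNReal.ofReal (r ^ (2 * n - 1)) *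
    ∫⁻ ξ, f (r • (ξ : Cn n)) ∂(volume : Measure (Cn n)).toSphere]

/-- Polar coordinates in the unit ball. -/
lemma lintegral_polar (hn : 1 ≤ n) {f : Cn n → ℝ≥0∞} (hf : Measurable f) :
    ∫⁻ z in unitBall n, f z = ENNReal.ofReal (2 * n * (Real.pi ^ n / n.factorial)) *
      ∫⁻ r in Set.Ioo (0 : ℝ) 1, ENNReal.ofReal (r ^ (2 * n - 1)) *
      ∫⁻ ξ, f (r • (ξ : Cn n)) ∂(sphereMeasure n) := by
  rw [← lintegral_indicator isOpen_unitBall.measurableSet,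
    lintegral_polar_aux hn (hf.indicator isOpen_unitBall.measurableSet), toSphere_eq hn,
    ← lintegral_const_mul' _ _ ENNReal.ofReal_ne_top, ← Set.Ioi_inter_Iio,
    ← lintegral_indicator measurableSet_Ioi,
    ← lintegral_indicator (measurableSet_Ioi.inter measurableSet_Iio)]
  refine lintegral_congr fun r => ?_
  by_cases hr : 0 < r
  · rw [Set.indicator_of_mem (show r ∈ Set.Ioi (0 : ℝ) from hr), lintegral_smul_measure, smul_eq_mul]
    have hmem : ∀ ξ : Metric.sphere (0 : Cn n) 1, r • (ξ : Cn n) ∈ unitBall n ↔ r < 1 := fun ξ => by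
      rw [mem_unitBall, norm_smul, norm_eq_of_mem_sphere, mul_one, Real.norm_of_nonneg hr.le]
    by_cases hr1 : r < 1
    · rw [Set.indicator_of_mem (show r ∈ Set.Ioi (0 : ℝ) ∩ Set.Iio 1 from ⟨hr, hr1⟩)]
      simp only [Set.indicator_of_mem ((hmem _).2 hr1)]
      ring
    · rw [Set.indicator_of_notMem (show r ∉ Set.Ioi (0 : ℝ) ∩ Set.Iio 1 from fun h => hr1 h.2)]
      simp only [Set.indicator_of_notMem (fun h => hr1 ((hmem _).1 h))]
      simp
  · rw [Set.indicator_of_notMem (show r ∉ Set.Ioi (0 : ℝ) from hr),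
      Set.indicator_of_notMem (fun h => hr h.1)]

lemma lintegral_invVolume {f : Cn n → ℝ≥0∞} (hf : Measurable f) :
    ∫⁻ z, f z ∂(invVolume n) =
      ∫⁻ z in unitBall n, ENNReal.ofReal (1 / (1 - ‖z‖ ^ 2) ^ (n + 1)) * f z := by
  rw [invVolume, lintegral_withDensity_eq_lintegral_mul _ invVolume_density_measurable hf]
  rfl

lemma lintegral_invVolume_polar (hn : 1 ≤ n) {f : Cn n → ℝ≥0∞} (hf : Measurable f) :
    ∫⁻ z, f z ∂(invVolume n) = ENNReal.ofReal (2 * n * (Real.pi ^ n / n.factorial)) *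
      ∫⁻ r in Set.Ioo (0 : ℝ) 1, ENNReal.ofReal (r ^ (2 * n - 1) / (1 - r ^ 2) ^ (n + 1)) *
      ∫⁻ ξ, f (r • (ξ : Cn n)) ∂(sphereMeasure n) := by
  rw [lintegral_invVolume hf, lintegral_polar hn (by fun_prop)]
  congr 1
  refine setLIntegral_congr_fun measurableSet_Ioo fun r hr => ?_
  have h : ∀ ξ : Metric.sphere (0 : Cn n) 1, ‖r • (ξ : Cn n)‖ ^ 2 = r ^ 2 := fun ξ => by
    rw [norm_smul, norm_eq_of_mem_sphere, mul_one, Real.norm_of_nonneg hr.1.le]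
  simp only [h]
  rw [lintegral_const_mul _ (by fun_prop), ← mul_assoc, ← ENNReal.ofReal_mul (pow_nonneg hr.1.le _),
    mul_one_div]

end polar

/-! ### Algebra of the involutions b_a -/

section ballAut

variable {a z : Cn n}

lemma norm_inner_lt_one (ha : a ∈ unitBall n) (hz : ‖z‖ ≤ 1) : ‖inner ℂ a z‖ < 1 := by
  rw [mem_unitBall] at ha
  refine (norm_inner_le_norm a z).trans_lt ?_
  nlinarith [norm_nonneg a, norm_nonneg z]

lemma inner_ne_one (ha : a ∈ unitBall n) (hz : ‖z‖ ≤ 1) : inner ℂ a z ≠ 1 := fun h => by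
  have := norm_inner_lt_one ha hz
  rw [h] at this; simp at this

/-- The square root in the definition of `ballAut`. -/
def sq1 (a : Cn n) : ℝ := Real.sqrt (1 - ‖a‖ ^ 2)

lemma sq1_pos (ha : a ∈ unitBall n) : 0 < sq1 a := Real.sqrt_pos.2 (one_sub_norm_sq_pos ha)

lemma sq1_sq (ha : a ∈ unitBall n) : sq1 a ^ 2 = 1 - ‖a‖ ^ 2 :=
  Real.sq_sqrt (one_sub_norm_sq_pos ha).le

lemma inner_self_eq (ha : a ∈ unitBall n) : inner ℂ a a = 1 - (sq1 a : ℂ) ^ 2 := by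
  rw [inner_self_eq_norm_sq_to_K]
  have := sq1_sq ha
  norm_cast
  rw [this]; simp

lemma one_add_sq1_ne (ha : a ∈ unitBall n) : (1 + (sq1 a : ℂ)) ≠ 0 := by
  have := sq1_pos ha
  norm_cast; positivity

/-- With s² = 1 - ‖a‖² one has ‖a‖² = (1-s)(1+s), so (1-s)P_a z = ⟨z,a⟩/(1+s) · a. The projection
and its division by ‖a‖² disappear, and a = 0 is no longer special. -/
lemma ballAut_eq (ha : a ∈ unitBall n) (z : Cn n) : ballAut a z = (1 - inner ℂ a z)⁻¹ •
    ((1 - inner ℂ a z / (1 + (sq1 a : ℂ))) • a - (sq1 a : ℂ) • z) := by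
  rw [ballAut]
  change (1 - inner ℂ a z)⁻¹ • (a - lineProj a z - (sq1 a : ℂ) • (z - lineProj a z)) = _
  congr 1
  have hL : lineProj a z = (inner ℂ a z / (((1 - sq1 a ^ 2 : ℝ)) : ℂ)) • a := by
    rw [lineProj, sq1_sq ha]; congr 4; ring
  have key : (1 - (sq1 a : ℂ)) • lineProj a z = (inner ℂ a z / (1 + (sq1 a : ℂ))) • a := by
    by_cases h0 : a = 0
    · simp [h0, lineProj]
    · have h1 : (1 - (sq1 a : ℂ)) ≠ 0 := by
        have h3 : 0 < ‖a‖ := norm_pos_iff.2 h0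
        have h4 := sq1_sq ha
        have h5 := sq1_pos ha
        have : (1 - sq1 a) ≠ 0 := fun h => by
          have : sq1 a = 1 := by linarith
          rw [this] at h4; nlinarith
        exact_mod_cast this
      have h2 := one_add_sq1_ne ha
      rw [hL, smul_smul]
      congr 1
      have : ((1 - sq1 a ^ 2 : ℝ) : ℂ) = (1 - sq1 a) * (1 + sq1 a) := by push_cast; ring
      rw [this]; field_simp
  calc a - lineProj a z - (sq1 a : ℂ) • (z - lineProj a z)
      = a - (1 - (sq1 a : ℂ)) • lineProj a z - (sq1 a : ℂ) • z := by module
    _ = _ := by rw [key]; module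

lemma inner_ballAut (ha : a ∈ unitBall n) (hz : inner ℂ a z ≠ 1) :
    inner ℂ a (ballAut a z) = (1 - (sq1 a : ℂ) ^ 2 - inner ℂ a z) / (1 - inner ℂ a z) := by
  have h1 : 1 - inner ℂ a z ≠ 0 := sub_ne_zero.2 hz.symm
  have h2 := one_add_sq1_ne ha
  rw [ballAut_eq ha, inner_smul_right, inner_sub_right, inner_smul_right, inner_smul_right,
    inner_self_eq ha]
  field_simp
  ring

lemma one_sub_inner_ballAut (ha : a ∈ unitBall n) (hz : inner ℂ a z ≠ 1) :
    1 - inner ℂ a (ballAut a z) = (sq1 a : ℂ) ^ 2 / (1 - inner ℂ a z) := by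
  have h1 : 1 - inner ℂ a z ≠ 0 := sub_ne_zero.2 hz.symm
  rw [inner_ballAut ha hz]; field_simp; ring

lemma ballAut_ballAut (ha : a ∈ unitBall n) (hz : inner ℂ a z ≠ 1) :
    ballAut a (ballAut a z) = z := by
  have h1 : 1 - inner ℂ a z ≠ 0 := sub_ne_zero.2 hz.symm
  have h2 := one_add_sq1_ne ha
  have h3 : (sq1 a : ℂ) ≠ 0 := by exact_mod_cast (sq1_pos ha).ne'
  rw [ballAut_eq ha (ballAut a z), one_sub_inner_ballAut ha hz, inner_ballAut ha hz, ballAut_eq ha z]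
  set t := inner ℂ a z
  set s := (sq1 a : ℂ)
  have e1 : (s ^ 2 / (1 - t))⁻¹ * (1 - (1 - s ^ 2 - t) / (1 - t) / (1 + s))
      = (s ^ 2 / (1 - t))⁻¹ * (s * ((1 - t)⁻¹ * (1 - t / (1 + s)))) := by
    field_simp; ring
  have e2 : (s ^ 2 / (1 - t))⁻¹ * (s * ((1 - t)⁻¹ * s)) = 1 := by
    field_simp
  simp only [smul_sub, smul_smul]
  rw [e1, e2]
  module

lemma norm_ballAut_sq (ha : a ∈ unitBall n) (hz : inner ℂ a z ≠ 1) :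
    ‖ballAut a z‖ ^ 2 = bx a z := by
  have h1 : 1 - inner ℂ a z ≠ 0 := sub_ne_zero.2 hz.symm
  have hN : ‖1 - inner ℂ a z‖ ≠ 0 := norm_ne_zero_iff.2 h1
  have h2 := sq1_pos ha
  rw [ballAut_eq ha, norm_smul, mul_pow, norm_inv, bx]
  have : ‖((1 - inner ℂ a z / (1 + (sq1 a : ℂ))) • a - (sq1 a : ℂ) • z)‖ ^ 2 =
      ‖1 - inner ℂ a z‖ ^ 2 - (1 - ‖a‖ ^ 2) * (1 - ‖z‖ ^ 2) := by
    rw [@norm_sub_sq ℂ, norm_smul, norm_smul, mul_pow, mul_pow, inner_smul_left, inner_smul_right]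
    have hs := sq1_sq ha
    have ha' : ‖a‖ ^ 2 = 1 - sq1 a ^ 2 := by linarith
    rw [ha', Complex.norm_real, Real.norm_of_nonneg h2.le]
    have e : (1 - inner ℂ a z / (1 + (sq1 a : ℂ)))
        = (1 - inner ℂ a z * (((1 + sq1 a)⁻¹ : ℝ) : ℂ)) := by
      push_cast; rw [div_eq_mul_inv]
    have hp : (1 + sq1 a) * (1 + sq1 a)⁻¹ = 1 := mul_inv_cancel₀ (by positivity)
    rw [e]
    set μ := (1 + sq1 a)⁻¹
    set s := sq1 a
    simp only [Complex.sq_norm, Complex.normSq_apply]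
    set t := inner ℂ a z
    simp only [Complex.sub_re, Complex.sub_im, Complex.mul_re, Complex.mul_im, Complex.one_re,
      Complex.one_im, Complex.ofReal_re, Complex.ofReal_im, Complex.conj_re, Complex.conj_im,
      map_sub, map_mul, map_one, Complex.conj_ofReal, RCLike.re_eq_complex_re]
    linear_combination (-2 * t.re * (1 - s) + (t.re ^ 2 + t.im ^ 2) * (1 - (s - 1) * μ)) * hp
  rw [this]
  field_simp

end ballAut

/-! ### Mapping properties and Jacobian of b_a -/

section ballAut

variable {a z : Cn n}

lemma bx_lt_one (ha : a ∈ unitBall n) (hz : z ∈ unitBall n) : bx a z < 1 := by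
  have h := inner_ne_one ha (mem_unitBall.1 hz).le
  have hN : 0 < ‖1 - inner ℂ a z‖ := norm_pos_iff.2 (sub_ne_zero.2 h.symm)
  have h1 := one_sub_norm_sq_pos ha
  have h2 := one_sub_norm_sq_pos hz
  rw [bx]
  have : 0 < (1 - ‖a‖ ^ 2) * (1 - ‖z‖ ^ 2) / ‖1 - inner ℂ a z‖ ^ 2 := by positivity
  linarith

lemma bx_nonneg (ha : a ∈ unitBall n) (hz : z ∈ unitBall n) : 0 ≤ bx a z := by
  rw [← norm_ballAut_sq ha (inner_ne_one ha (mem_unitBall.1 hz).le)]; positivity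

lemma ballAut_mem (ha : a ∈ unitBall n) (hz : z ∈ unitBall n) : ballAut a z ∈ unitBall n := by
  have h := bx_lt_one ha hz
  rw [← norm_ballAut_sq ha (inner_ne_one ha (mem_unitBall.1 hz).le)] at h
  rw [mem_unitBall]
  nlinarith [norm_nonneg (ballAut a z)]

lemma bx_ballAut (ha : a ∈ unitBall n) (hz : z ∈ unitBall n) : bx a (ballAut a z) = ‖z‖ ^ 2 := by
  rw [← norm_ballAut_sq ha (inner_ne_one ha (mem_unitBall.1 (ballAut_mem ha hz)).le),
    ballAut_ballAut ha (inner_ne_one ha (mem_unitBall.1 hz).le)]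

/-- Compares the invariant and the Euclidean distance. The reason is the identity |1 - ⟨z,a⟩|² bx =
(1 - ‖a‖²)‖z - a‖² + |⟨z - a, a⟩|², together with |1 - ⟨z,a⟩| ≤ 2. -/
lemma bx_lower (ha : a ∈ unitBall n) (hz : z ∈ unitBall n) :
    (1 - ‖a‖ ^ 2) * ‖z - a‖ ^ 2 ≤ 4 * bx a z := by
  have h := inner_ne_one ha (mem_unitBall.1 hz).le
  have hN : 0 < ‖1 - inner ℂ a z‖ := norm_pos_iff.2 (sub_ne_zero.2 h.symm)
  have hN2 : ‖1 - inner ℂ a z‖ ≤ 2 := by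
    refine (norm_sub_le _ _).trans ?_
    have := norm_inner_lt_one ha (mem_unitBall.1 hz).le
    simp; linarith
  have h4 : ‖1 - inner ℂ a z‖ ^ 2 ≤ 4 := by nlinarith
  have key : (1 - ‖a‖ ^ 2) * ‖z - a‖ ^ 2 ≤ bx a z * ‖1 - inner ℂ a z‖ ^ 2 := by
    have e : bx a z * ‖1 - inner ℂ a z‖ ^ 2 =
        ‖1 - inner ℂ a z‖ ^ 2 - (1 - ‖a‖ ^ 2) * (1 - ‖z‖ ^ 2) := by
      rw [bx]; field_simp
    have e2 : ‖z - a‖ ^ 2 = ‖z‖ ^ 2 - 2 * (inner ℂ a z).re + ‖a‖ ^ 2 := by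
      rw [@norm_sub_sq ℂ]; simp [reInner_comm a z, ← reInner_apply]
    rw [e, e2, Complex.sq_norm, Complex.normSq_apply]
    simp only [Complex.sub_re, Complex.one_re, Complex.sub_im, Complex.one_im]
    nlinarith [sq_nonneg (‖a‖ ^ 2 - (inner ℂ a z).re), sq_nonneg (inner ℂ a z).im]
  nlinarith [bx_nonneg ha hz]

lemma ballAut_image (ha : a ∈ unitBall n) : ballAut a '' unitBall n = unitBall n := by
  refine Set.Subset.antisymm ?_ fun z hz => ⟨ballAut a z, ballAut_mem ha hz,
    ballAut_ballAut ha (inner_ne_one ha (mem_unitBall.1 hz).le)⟩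
  rintro _ ⟨z, hz, rfl⟩
  exact ballAut_mem ha hz

lemma ballAut_injOn (ha : a ∈ unitBall n) : Set.InjOn (ballAut a) (unitBall n) := by
  intro z hz w hw h
  rw [← ballAut_ballAut ha (inner_ne_one ha (mem_unitBall.1 hz).le), h,
    ballAut_ballAut ha (inner_ne_one ha (mem_unitBall.1 hw).le)]

/-- The matrix determinant lemma, after extracting the scalar c. -/
lemma det_add_rankOne (c : ℂ) (hc : c ≠ 0) (w a : Cn n) :
    LinearMap.det ((c • LinearMap.id + (innerSL ℂ a).toLinearMap.smulRight w : Cn n →ₗ[ℂ] Cn n))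
      = c ^ n * (1 + c⁻¹ * inner ℂ a w) := by
  have h1 : (c • LinearMap.id + (innerSL ℂ a).toLinearMap.smulRight w : Cn n →ₗ[ℂ] Cn n)
      = c • (LinearMap.id + (innerSL ℂ a).toLinearMap.smulRight (c⁻¹ • w)) := by
    ext x j
    simp only [LinearMap.add_apply, LinearMap.smul_apply, LinearMap.smulRight_apply, smul_add,
      smul_smul, LinearMap.id_apply]
    rw [mul_left_comm, mul_inv_cancel₀ hc, mul_one]
  rw [h1, LinearMap.det_smul, finrank_euclideanSpace_fin]
  congr 1
  rw [← LinearMap.det_toMatrix (EuclideanSpace.basisFun (Fin n) ℂ).toBasis]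
  have h2 : LinearMap.toMatrix (EuclideanSpace.basisFun (Fin n) ℂ).toBasis
      (EuclideanSpace.basisFun (Fin n) ℂ).toBasis
      (LinearMap.id + (innerSL ℂ a).toLinearMap.smulRight (c⁻¹ • w))
      = 1 + Matrix.replicateCol Unit (fun i => c⁻¹ * w i)
        * Matrix.replicateRow Unit (fun i => (starRingEnd ℂ) (a i)) := by
    ext i j
    rw [LinearMap.toMatrix_apply]
    simp [Matrix.mul_apply, Matrix.one_apply, inner_eq, mul_comm]
  rw [h2, Matrix.det_one_add_mul_comm]
  simp [Matrix.det_unique, Matrix.mul_apply, inner_eq, Finset.mul_sum]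
  refine Finset.sum_congr rfl fun i _ => by ring

/-- The complex derivative of `ballAut`. -/
def ballAutDeriv (a z : Cn n) : Cn n →L[ℂ] Cn n :=
  (1 - inner ℂ a z)⁻¹ • (-(sq1 a : ℂ) • ContinuousLinearMap.id ℂ (Cn n)
    + (innerSL ℂ a).smulRight (ballAut a z - (1 + (sq1 a : ℂ))⁻¹ • a))

lemma hasFDerivAt_ballAut (ha : a ∈ unitBall n) (hz : z ∈ unitBall n) :
    HasFDerivAt (ballAut a) (ballAutDeriv a z) z := by
  have h1 : 1 - inner ℂ a z ≠ 0 :=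
    sub_ne_zero.2 (inner_ne_one ha (mem_unitBall.1 hz).le).symm
  have hL : HasFDerivAt (fun z => inner ℂ a z) (innerSL ℂ a) z := (innerSL ℂ a).hasFDerivAt
  have h2 : HasFDerivAt (fun z => (1 - inner ℂ a z)⁻¹)
      (((1 - inner ℂ a z) ^ 2)⁻¹ • innerSL ℂ a) z := by
    have := (hasDerivAt_inv h1).comp_hasFDerivAt z (hL.const_sub 1)
    refine this.congr_fderiv ?_
    ext v; simp
  have h3 : HasFDerivAt (fun z => (1 - inner ℂ a z / (1 + (sq1 a : ℂ))) • a - (sq1 a : ℂ) • z)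
      (-((1 + (sq1 a : ℂ))⁻¹ • (innerSL ℂ a).smulRight a)
        - (sq1 a : ℂ) • ContinuousLinearMap.id ℂ (Cn n)) z := by
    have := ((((hL.mul_const (1 + (sq1 a : ℂ))⁻¹).const_sub 1).smul_const a).sub
      ((hasFDerivAt_id z).const_smul (sq1 a : ℂ)))
    simp only [← div_eq_mul_inv] at this
    refine this.congr_fderiv ?_
    ext v; simp [mul_assoc]
  have h4 := h2.smul h3
  have h5 : ballAut a = fun z => (1 - inner ℂ a z)⁻¹ •
      ((1 - inner ℂ a z / (1 + (sq1 a : ℂ))) • a - (sq1 a : ℂ) • z) := by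
    ext1 z; exact ballAut_eq ha z
  have h6 := ballAut_eq ha z
  rw [h5]
  refine h4.congr_fderiv ?_
  ext1 v
  rw [ballAutDeriv, h6]
  simp only [add_apply, smul_apply, sub_apply, neg_apply, ContinuousLinearMap.smulRight_apply,
    ContinuousLinearMap.id_apply, innerSL_apply_apply]
  rw [sq, mul_inv]
  module

/-- The complex derivative is a multiple of a scalar plus a rank one map, with determinant
(-1)ⁿ(s/(1 - ⟨z,a⟩))^{n+1}. The real determinant is the squared modulus of the complex one. -/
lemma det_ballAutDeriv (ha : a ∈ unitBall n) (hz : z ∈ unitBall n) :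
    |((ballAutDeriv a z).restrictScalars ℝ).det| = ((1 - ‖a‖ ^ 2) / ‖1 - inner ℂ a z‖ ^ 2) ^ (n + 1) := by
  have hne := inner_ne_one ha (mem_unitBall.1 hz).le
  have h1 : 1 - inner ℂ a z ≠ 0 := sub_ne_zero.2 hne.symm
  have hs := sq1_pos ha
  have hs' : (sq1 a : ℂ) ≠ 0 := by exact_mod_cast hs.ne'
  have h2 := one_add_sq1_ne ha
  have e : ((ballAutDeriv a z : Cn n →L[ℂ] Cn n) : Cn n →ₗ[ℂ] Cn n) = (1 - inner ℂ a z)⁻¹ •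
      ((-(sq1 a : ℂ)) • LinearMap.id + (innerSL ℂ a).toLinearMap.smulRight
        (ballAut a z - (1 + (sq1 a : ℂ))⁻¹ • a)) := by
    ext v; rfl
  have hd : LinearMap.det ((ballAutDeriv a z : Cn n →L[ℂ] Cn n) : Cn n →ₗ[ℂ] Cn n) =
      (-1) ^ n * (sq1 a / (1 - inner ℂ a z)) ^ (n + 1) := by
    rw [e, LinearMap.det_smul, finrank_euclideanSpace_fin, det_add_rankOne _ (neg_ne_zero.2 hs'),
      inner_sub_right, inner_smul_right, inner_self_eq ha, inner_ballAut ha hne]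
    obtain ⟨E, hE⟩ : ∃ E, E = 1 - inner ℂ a z := ⟨_, rfl⟩
    have ht : inner ℂ a z = 1 - E := by rw [hE]; ring
    rw [← hE] at h1
    rw [neg_pow, ← hE, ht, div_pow, inv_pow]
    have h1n := pow_ne_zero n h1
    field_simp
    ring
  have hR : ((ballAutDeriv a z).restrictScalars ℝ).det = LinearMap.det
      (((ballAutDeriv a z : Cn n →L[ℂ] Cn n) : Cn n →ₗ[ℂ] Cn n).restrictScalars ℝ) := rfl
  rw [hR, LinearMap.det_restrictScalars, hd, Algebra.norm_complex_apply, Complex.normSq_eq_norm_sq,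
    abs_of_nonneg (by positivity)]
  simp only [norm_mul, norm_pow, norm_neg, norm_one, one_pow, one_mul, norm_div, Complex.norm_real,
    Real.norm_of_nonneg hs.le]
  rw [← pow_mul, mul_comm, pow_mul, div_pow, sq1_sq ha]

lemma lintegral_ballAut (ha : a ∈ unitBall n) (f : Cn n → ℝ≥0∞) :
    ∫⁻ z in unitBall n, f z = ∫⁻ z in unitBall n,
      ENNReal.ofReal (((1 - ‖a‖ ^ 2) / ‖1 - inner ℂ a z‖ ^ 2) ^ (n + 1)) * f (ballAut a z) := by
  have h := lintegral_image_eq_lintegral_abs_det_fderiv_mul (volume : Measure (Cn n))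
    (f' := fun z => (ballAutDeriv a z).restrictScalars ℝ) isOpen_unitBall.measurableSet
    (fun z hz => ((hasFDerivAt_ballAut ha hz).restrictScalars ℝ).hasFDerivWithinAt)
    (ballAut_injOn ha) f
  rw [ballAut_image ha] at h
  rw [h]
  refine setLIntegral_congr_fun isOpen_unitBall.measurableSet fun z hz => ?_
  simp only [det_ballAutDeriv ha hz]

lemma measurable_ballAut (ha : a ∈ unitBall n) : Measurable (ballAut a) := by
  have h5 : ballAut a = fun z => (1 - inner ℂ a z)⁻¹ •
      ((1 - inner ℂ a z / (1 + (sq1 a : ℂ))) • a - (sq1 a : ℂ) • z) := by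
    ext1 z; exact ballAut_eq ha z
  rw [h5]
  fun_prop

/-- The invariant volume is invariant under automorphisms. -/
lemma lintegral_invVolume_ballAut (ha : a ∈ unitBall n) {f : Cn n → ℝ≥0∞} (hf : Measurable f) :
    ∫⁻ z, f (ballAut a z) ∂(invVolume n) = ∫⁻ z, f z ∂(invVolume n) := by
  rw [lintegral_invVolume hf, lintegral_invVolume (f := fun z => f (ballAut a z)) (hf.comp (measurable_ballAut ha)),
    lintegral_ballAut ha]
  refine setLIntegral_congr_fun isOpen_unitBall.measurableSet fun z hz => ?_
  have hne := inner_ne_one ha (mem_unitBall.1 hz).le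
  have hN : 0 < ‖1 - inner ℂ a z‖ := norm_pos_iff.2 (sub_ne_zero.2 hne.symm)
  have h1 := one_sub_norm_sq_pos ha
  have h2 := one_sub_norm_sq_pos hz
  rw [← mul_assoc, ← ENNReal.ofReal_mul (by positivity), norm_ballAut_sq ha hne, bx]
  rw [ballAut_ballAut ha hne]
  congr 2
  rw [sub_sub_cancel, div_pow, div_pow, mul_pow]
  field_simp

end ballAut

/-! ### Supports and smoothness of radial kernels -/

section kernel

variable {a z : Cn n} {k : ℝ → ℝ} {R : ℝ}

/-- Locates the supports of the kernels uniformly in the pole: bx < R means (1-R)|1 - ⟨z,a⟩|² <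
(1-‖a‖²)(1-‖z‖²), and |1 - ⟨z,a⟩| ≥ 1 - ρ. That z lies in the ball is a consequence, not an
assumption. -/
lemma norm_sq_lt_of_bx_lt {ρ : ℝ} (hρ : ρ < 1) (ha : ‖a‖ ≤ ρ) (hR : R ≤ 1) (h : bx a z < R) :
    ‖z‖ ^ 2 < 1 - (1 - R) * (1 - ρ) ^ 2 := by
  have ha1 : a ∈ unitBall n := mem_unitBall.2 (ha.trans_lt hρ)
  have h1 := one_sub_norm_sq_pos ha1
  -- If ⟨z,a⟩ = 1, division by zero gives `bx a z` the value 1, which R ≤ 1 excludes.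
  have hne : inner ℂ a z ≠ 1 := fun h' => by
    rw [bx, h'] at h; simp at h; linarith
  have hN : 0 < ‖1 - inner ℂ a z‖ ^ 2 :=
    pow_pos (norm_pos_iff.2 (sub_ne_zero.2 hne.symm)) 2
  have e : bx a z * ‖1 - inner ℂ a z‖ ^ 2 =
      ‖1 - inner ℂ a z‖ ^ 2 - (1 - ‖a‖ ^ 2) * (1 - ‖z‖ ^ 2) := by
    rw [bx, sub_mul, one_mul, div_mul_cancel₀ _ hN.ne']
  have h2 : (1 - R) * ‖1 - inner ℂ a z‖ ^ 2 < (1 - ‖a‖ ^ 2) * (1 - ‖z‖ ^ 2) := by nlinarith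
  have h3 : 0 < 1 - ‖z‖ ^ 2 := by
    by_contra hc
    have : (1 - ‖a‖ ^ 2) * (1 - ‖z‖ ^ 2) ≤ 0 := mul_nonpos_of_nonneg_of_nonpos h1.le (not_lt.1 hc)
    have : 0 ≤ (1 - R) * ‖1 - inner ℂ a z‖ ^ 2 := mul_nonneg (by linarith) hN.le
    linarith
  have hz : ‖z‖ ≤ 1 := by nlinarith [norm_nonneg z]
  have h4 : 1 - ρ ≤ ‖1 - inner ℂ a z‖ := by
    have h5 : ‖inner ℂ a z‖ ≤ ρ := by
      refine (norm_inner_le_norm a z).trans ?_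
      nlinarith [norm_nonneg a, norm_nonneg z]
    have := norm_sub_norm_le (1 : ℂ) (inner ℂ a z)
    simp only [norm_one] at this
    linarith
  have h6 : (1 - ρ) ^ 2 ≤ ‖1 - inner ℂ a z‖ ^ 2 := pow_le_pow_left₀ (by linarith) h4 2
  nlinarith [sq_nonneg ‖a‖]

/-- Smoothness holds jointly and for all z in ℂⁿ. The singularities ⟨z,a⟩ = 1 of `bx` lie outside
the closed ball, where bx ≥ 1 and the kernel vanishes. -/
lemma contDiffAt_kernel {m : WithTop ℕ∞} (hk : ContDiff ℝ m k) (hR : R ≤ 1)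
    (hk0 : ∀ x, R ≤ x → k x = 0) (ha : a ∈ unitBall n) (z : Cn n) :
    ContDiffAt ℝ m (fun p : Cn n × Cn n => k (bx p.1 p.2)) (a, z) := by
  by_cases hne : inner ℂ a z = 1
  · have hz : 1 < ‖z‖ := by
      by_contra h; exact inner_ne_one ha (not_lt.1 h) hne
    have : (fun p : Cn n × Cn n => k (bx p.1 p.2)) =ᶠ[𝓝 (a, z)] fun _ => 0 := by
      have h1 : ∀ᶠ p : Cn n × Cn n in 𝓝 (a, z), ‖p.1‖ < 1 :=
        (continuous_fst.norm.continuousAt (x := (a, z))).eventually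
          (gt_mem_nhds (mem_unitBall.1 ha))
      have h2 : ∀ᶠ p : Cn n × Cn n in 𝓝 (a, z), 1 < ‖p.2‖ :=
        (continuous_snd.norm.continuousAt (x := (a, z))).eventually (lt_mem_nhds hz)
      filter_upwards [h1, h2] with p h1 h2
      refine hk0 _ (hR.trans ?_)
      have h3 : 0 ≤ 1 - ‖p.1‖ ^ 2 := by nlinarith [norm_nonneg p.1]
      have h4 : 1 - ‖p.2‖ ^ 2 ≤ 0 := by nlinarith
      have : (1 - ‖p.1‖ ^ 2) * (1 - ‖p.2‖ ^ 2) / ‖1 - inner ℂ p.1 p.2‖ ^ 2 ≤ 0 :=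
        div_nonpos_of_nonpos_of_nonneg (mul_nonpos_of_nonneg_of_nonpos h3 h4) (by positivity)
      rw [bx]; linarith
    exact contDiffAt_const.congr_of_eventuallyEq this
  · have h0 : (1 - inner ℂ a z) ≠ 0 := sub_ne_zero.2 (Ne.symm hne)
    have hin : ContDiffAt ℝ m (fun p : Cn n × Cn n => ‖1 - inner ℂ p.1 p.2‖ ^ 2) (a, z) := by
      refine ContDiffAt.norm_sq ℝ ?_
      exact contDiffAt_const.sub (contDiff_fst.inner ℂ contDiff_snd).contDiffAt
    refine hk.contDiffAt.comp (a, z) ?_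
    refine contDiffAt_const.sub (ContDiffAt.div ?_ hin (by simpa using h0))
    exact (contDiffAt_const.sub (contDiff_fst.norm_sq ℝ).contDiffAt).mul
      (contDiffAt_const.sub (contDiff_snd.norm_sq ℝ).contDiffAt)

lemma contDiff_kernel_right {m : WithTop ℕ∞} (hk : ContDiff ℝ m k) (hR : R ≤ 1)
    (hk0 : ∀ x, R ≤ x → k x = 0) (ha : a ∈ unitBall n) :
    ContDiff ℝ m (fun z => k (bx a z)) := by
  rw [contDiff_iff_contDiffAt]
  intro z
  exact (contDiffAt_kernel hk hR hk0 ha z).comp z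
    (contDiff_const.prodMk contDiff_id).contDiffAt

/-- The radius of a ball that contains the supports of the kernels with pole in the ball of
radius `ρ`. -/
def suppRadius (R ρ : ℝ) : ℝ := Real.sqrt (1 - (1 - R) * (1 - ρ) ^ 2)

lemma suppRadius_lt_one {R ρ : ℝ} (hR : R < 1) (hρ : ρ < 1) : suppRadius R ρ < 1 := by
  rw [suppRadius, Real.sqrt_lt' one_pos]
  have : 0 < (1 - R) * (1 - ρ) ^ 2 := mul_pos (by linarith) (pow_pos (by linarith) 2)
  linarith

lemma kernel_eq_zero {ρ : ℝ} (hρ : ρ < 1) (ha : ‖a‖ ≤ ρ) (hR : R ≤ 1)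
    (hk0 : ∀ x, R ≤ x → k x = 0) (hz : z ∉ Metric.closedBall (0 : Cn n) (suppRadius R ρ)) :
    k (bx a z) = 0 := by
  refine hk0 _ (not_lt.1 fun h => hz ?_)
  have := norm_sq_lt_of_bx_lt hρ ha hR h
  rw [mem_closedBall_zero_iff]
  exact Real.le_sqrt_of_sq_le this.le

lemma closedBall_subset_unitBall {r : ℝ} (hr : r < 1) :
    Metric.closedBall (0 : Cn n) r ⊆ unitBall n := Metric.closedBall_subset_ball hr

lemma kernel_tsupport_subset {ρ : ℝ} (hρ : ρ < 1) (ha : ‖a‖ ≤ ρ) (hR : R ≤ 1)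
    (hk0 : ∀ x, R ≤ x → k x = 0) :
    tsupport (fun z => k (bx a z)) ⊆ Metric.closedBall (0 : Cn n) (suppRadius R ρ) :=
  closure_minimal (fun z hz => by
    by_contra h; exact hz (kernel_eq_zero hρ ha hR hk0 h)) Metric.isClosed_closedBall

lemma kernel_hasCompactSupport (hR : R ≤ 1) (hk0 : ∀ x, R ≤ x → k x = 0) (ha : a ∈ unitBall n) :
    HasCompactSupport (fun z => k (bx a z)) :=
  HasCompactSupport.intro (isCompact_closedBall (0 : Cn n) (suppRadius R ‖a‖)) fun _ hz =>
    kernel_eq_zero (mem_unitBall.1 ha) le_rfl hR hk0 hz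

end kernel

/-! ### Radial potentials and their fluxes -/

section potential

/-- The constant `2 n vol(𝔹)`, the mass of the unnormalized surface measure. -/
def sphereConst (n : ℕ) : ℝ := 2 * n * (Real.pi ^ n / n.factorial)

lemma sphereConst_pos (hn : 1 ≤ n) : 0 < sphereConst n := by
  have : 0 < n := hn
  unfold sphereConst; positivity

/-- The density of the radial potential with flux `η`. -/
def potDensity (n : ℕ) (η : ℝ → ℝ) (y : ℝ) : ℝ := η y * (1 - y) ^ (n - 1) / y ^ n

/-- The radial potential with flux `η`. -/
def pot (n : ℕ) (η : ℝ → ℝ) (x : ℝ) : ℝ := ∫ y in x..1, potDensity n η y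

/-- The radial kernel that represents the invariant Laplacian of a potential. -/
def fluxKernel (n : ℕ) (η : ℝ → ℝ) (x : ℝ) : ℝ := deriv η x * (1 - x) ^ (n + 1) / x ^ (n - 1)

variable {η : ℝ → ℝ} {δ R : ℝ}

lemma contDiff_div_pow {f : ℝ → ℝ} {m : WithTop ℕ∞} (hf : ContDiff ℝ m f) (hδ : 0 < δ)
    (h0 : ∀ y ≤ δ, f y = 0) (j : ℕ) : ContDiff ℝ m fun y => f y / y ^ j := by
  rw [contDiff_iff_contDiffAt]
  intro y
  by_cases hy : y < δ
  · have : (fun y => f y / y ^ j) =ᶠ[𝓝 y] fun _ => 0 := by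
      filter_upwards [gt_mem_nhds hy] with x hx
      rw [h0 x (le_of_lt hx), zero_div]
    exact contDiffAt_const.congr_of_eventuallyEq this
  · have hy' : y ≠ 0 := by intro h; linarith
    exact hf.contDiffAt.div (contDiffAt_id.pow j) (pow_ne_zero j hy')

lemma contDiff_potDensity {m : WithTop ℕ∞} (hη : ContDiff ℝ m η) (hδ : 0 < δ)
    (h0 : ∀ y ≤ δ, η y = 0) : ContDiff ℝ m (potDensity n η) :=
  contDiff_div_pow (hη.mul ((contDiff_const.sub contDiff_id).pow _)) hδ
    (fun y hy => by simp [h0 y hy]) n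

lemma hasDerivAt_pot (hη : Continuous (potDensity n η)) (x : ℝ) :
    HasDerivAt (pot n η) (-potDensity n η x) x :=
  intervalIntegral.integral_hasDerivAt_left (hη.intervalIntegrable _ _)
    (hη.stronglyMeasurableAtFilter _ _) hη.continuousAt

lemma deriv_pot (hη : Continuous (potDensity n η)) : deriv (pot n η) = fun x => -potDensity n η x := by
  ext x; exact (hasDerivAt_pot hη x).deriv

lemma contDiff_pot (hη : ContDiff ℝ ((⊤ : ℕ∞) : WithTop ℕ∞) η) (hδ : 0 < δ)
    (h0 : ∀ y ≤ δ, η y = 0) : ContDiff ℝ ((⊤ : ℕ∞) : WithTop ℕ∞) (pot n η) := by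
  have h := contDiff_potDensity (n := n) hη hδ h0
  rw [contDiff_infty_iff_deriv]
  refine ⟨fun x => (hasDerivAt_pot h.continuous x).differentiableAt, ?_⟩
  rw [deriv_pot h.continuous]
  exact h.neg

lemma pot_eq_zero (hR : R ≤ 1) (h1 : ∀ y, R ≤ y → η y = 0) {x : ℝ} (hx : R ≤ x) : pot n η x = 0 := by
  rw [pot, intervalIntegral.integral_congr (g := fun _ => (0 : ℝ)), intervalIntegral.integral_zero]
  intro y hy
  have : R ≤ y := (le_min hx hR).trans hy.1
  simp [potDensity, h1 y this]

lemma pot_nonneg (h : ∀ y, 0 ≤ y → y ≤ 1 → 0 ≤ η y) {x : ℝ} (h0 : 0 ≤ x) (h1 : x ≤ 1) :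
    0 ≤ pot n η x := by
  refine intervalIntegral.integral_nonneg h1 fun y hy => ?_
  have hy0 := h0.trans hy.1
  exact div_nonneg (mul_nonneg (h y hy0 hy.2) (pow_nonneg (by linarith [hy.2]) _)) (pow_nonneg hy0 _)

/-- The function p(x) = (1-x)^{n-1}/xⁿ satisfies (n-x)p + x(1-x)p' = 0. As the derivative of the
potential is -ηp, only the term with η' survives. -/
lemma pot_ode (hn : 1 ≤ n) (hη : ContDiff ℝ ((⊤ : ℕ∞) : WithTop ℕ∞) η) (hδ : 0 < δ)
    (h0 : ∀ y ≤ δ, η y = 0) (x : ℝ) :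
    (1 - x) * ((n - x) * deriv (pot n η) x + x * (1 - x) * deriv (deriv (pot n η)) x) =
      -fluxKernel n η x := by
  have hc := (contDiff_potDensity (n := n) hη hδ h0).continuous
  rw [deriv_pot hc]
  by_cases hx : x < δ
  · have e1 : η =ᶠ[𝓝 x] fun _ => 0 := by
      filter_upwards [gt_mem_nhds hx] with y hy using h0 y (le_of_lt hy)
    have e2 : (fun x => -potDensity n η x) =ᶠ[𝓝 x] fun _ => 0 := by
      filter_upwards [e1] with y hy
      simp [potDensity, hy]
    have e3 := e2.eq_of_nhds
    rw [fluxKernel, e1.deriv_eq, e2.deriv_eq]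
    simp only [e3]; simp
  · have hx0 : x ≠ 0 := by intro h; linarith
    obtain ⟨m, rfl⟩ : ∃ m, n = m + 1 := ⟨n - 1, by omega⟩
    have hd : HasDerivAt η (deriv η x) x := (hη.differentiable (by simp) x).hasDerivAt
    have h2 : HasDerivAt (fun x : ℝ => (1 - x) ^ m) (m * (1 - x) ^ (m - 1) * (-1)) x := by
      exact ((hasDerivAt_id x).const_sub 1).pow m
    have h3 : HasDerivAt (fun x : ℝ => x ^ (m + 1)) ((m + 1 : ℕ) * x ^ m) x := by
      simpa using hasDerivAt_pow (m + 1) x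
    have h4 : HasDerivAt (fun x => -potDensity (m + 1) η x) _ x :=
      ((hd.mul h2).div h3 (pow_ne_zero _ hx0)).neg
    rw [h4.deriv]
    simp only [potDensity, fluxKernel, Nat.add_sub_cancel, Pi.mul_apply]
    have hp := pow_ne_zero m hx0
    rcases m with _ | m
    · simp; field_simp; ring
    · simp only [Nat.add_sub_cancel]
      push_cast
      field_simp
      ring

lemma invLaplacian_pot (hn : 1 ≤ n) (hη : ContDiff ℝ ((⊤ : ℕ∞) : WithTop ℕ∞) η) (hδ : 0 < δ)
    (h0 : ∀ y ≤ δ, η y = 0) {a z : Cn n} (ha : a ∈ unitBall n) (hz : z ∈ unitBall n) :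
    invLaplacian (fun y => pot n η (bx a y)) z = -(4 / (n + 1)) * fluxKernel n η (bx a z) := by
  have hp : ContDiff ℝ 2 (pot n η) := contDiff_infty.1 (contDiff_pot (n := n) hη hδ h0) 2
  have hne := inner_ne_one ha (mem_unitBall.1 hz).le
  have h2 : ContDiffAt ℝ 2 (fun y => pot n η (bx a y)) z :=
    hp.contDiffAt.comp z (contDiffAt_bx hne)
  rw [invLaplacian_eq h2, div_mul_eq_mul_div, Lop_comp_bx hne hp.contDiffAt, mul_assoc, pot_ode hn hη hδ h0]
  ring

lemma contDiff_fluxKernel (hη : ContDiff ℝ ((⊤ : ℕ∞) : WithTop ℕ∞) η) (hδ : 0 < δ)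
    (h0 : ∀ y ≤ δ, deriv η y = 0) : ContDiff ℝ ((⊤ : ℕ∞) : WithTop ℕ∞) (fluxKernel n η) := by
  have := (contDiff_infty_iff_deriv.1 hη).2
  exact contDiff_div_pow (this.mul ((contDiff_const.sub contDiff_id).pow _)) hδ
    (fun y hy => by simp [h0 y hy]) _

/-- The powers of r and 1 - r² in the polar form of dg cancel those in `fluxKernel` and leave r
η'(r²), an exact derivative. The mass of the kernel is thus determined by the increment of η. -/
lemma lintegral_fluxKernel (hn : 1 ≤ n) (hη : Measurable (fluxKernel n η)) {F : Cn n → ℝ≥0∞}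
    (hF : Measurable F) :
    ∫⁻ z, ENNReal.ofReal (fluxKernel n η (‖z‖ ^ 2)) * F z ∂(invVolume n) =
      ENNReal.ofReal (sphereConst n) * ∫⁻ r in Set.Ioo (0 : ℝ) 1, ENNReal.ofReal (r * deriv η (r ^ 2)) *
        ∫⁻ ξ, F (r • (ξ : Cn n)) ∂(sphereMeasure n) := by
  rw [lintegral_invVolume_polar hn (by fun_prop)]
  congr 1
  refine setLIntegral_congr_fun measurableSet_Ioo fun r hr => ?_
  have h : ∀ ξ : Metric.sphere (0 : Cn n) 1, ‖r • (ξ : Cn n)‖ ^ 2 = r ^ 2 := fun ξ => by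
    rw [norm_smul, norm_eq_of_mem_sphere, mul_one, Real.norm_of_nonneg hr.1.le]
  simp only [h]
  rw [lintegral_const_mul _ (by fun_prop), ← mul_assoc]
  have h1 : 0 < 1 - r ^ 2 := by nlinarith [hr.1, hr.2]
  have h0 := hr.1
  rw [← ENNReal.ofReal_mul (by positivity)]
  congr 2
  obtain ⟨m, rfl⟩ : ∃ m, n = m + 1 := ⟨n - 1, by omega⟩
  rw [fluxKernel, show 2 * (m + 1) - 1 = 2 * m + 1 by omega, Nat.add_sub_cancel, ← pow_mul]
  field_simp
  ring

lemma lintegral_mul_deriv_sq (hη : ContDiff ℝ 1 η) (h : ∀ x, 0 ≤ deriv η x) :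
    ∫⁻ r in Set.Ioo (0 : ℝ) 1, ENNReal.ofReal (r * deriv η (r ^ 2)) =
      ENNReal.ofReal ((η 1 - η 0) / 2) := by
  have hc : Continuous fun r : ℝ => r * deriv η (r ^ 2) :=
    continuous_id.mul ((hη.continuous_deriv le_rfl).comp (continuous_pow 2))
  rw [← ofReal_integral_eq_lintegral_ofReal]
  · rw [← integral_Ioc_eq_integral_Ioo, ← intervalIntegral.integral_of_le zero_le_one]
    have : ∀ r : ℝ, HasDerivAt (fun r => η (r ^ 2) / 2) (r * deriv η (r ^ 2)) r := fun r => by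
      have h1 := ((hη.differentiable one_ne_zero (r ^ 2)).hasDerivAt.comp r (hasDerivAt_pow 2 r)).div_const 2
      refine h1.congr_deriv ?_
      simp; ring
    rw [intervalIntegral.integral_eq_sub_of_hasDerivAt (fun r _ => this r) (hc.intervalIntegrable _ _)]
    congr 1
    simp; ring
  · exact (hc.integrableOn_Icc (a := 0) (b := 1)).mono_set Set.Ioo_subset_Icc_self
  · exact ae_restrict_of_forall_mem measurableSet_Ioo fun r hr => mul_nonneg hr.1.le (h _)

end potential

/-! ### Cutoffs and mean kernels of mass one -/

section cutoff

/-- A smooth monotone cutoff that is `0` for `x ≤ 1 / s` and `1` for `x ≥ 2 / s`. -/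
def lam (s x : ℝ) : ℝ := Real.smoothTransition (s * x - 1)

variable {s x : ℝ}

lemma lam_contDiff {m : ℕ∞} (s : ℝ) : ContDiff ℝ m (lam s) :=
  Real.smoothTransition.contDiff.comp ((contDiff_const.mul contDiff_id).sub contDiff_const)

lemma lam_eq_zero (h : s * x ≤ 1) : lam s x = 0 :=
  Real.smoothTransition.zero_of_nonpos (by linarith)

lemma lam_eq_one (h : 2 ≤ s * x) : lam s x = 1 :=
  Real.smoothTransition.one_of_one_le (by linarith)

lemma lam_nonneg (s x : ℝ) : 0 ≤ lam s x := Real.smoothTransition.nonneg _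

lemma lam_le_one (s x : ℝ) : lam s x ≤ 1 := Real.smoothTransition.le_one _

lemma lam_mono {s t : ℝ} (h : s ≤ t) (hx : 0 ≤ x) : lam s x ≤ lam t x :=
  Real.smoothTransition.monotone (by nlinarith)

lemma lam_monotone (hs : 0 ≤ s) : Monotone (lam s) := fun x y hxy =>
  Real.smoothTransition.monotone (by nlinarith)

lemma deriv_lam_nonneg (hs : 0 ≤ s) (x : ℝ) : 0 ≤ deriv (lam s) x := (lam_monotone hs).deriv_nonneg

/-- Every such x is a minimum of the cutoff; this includes the endpoint 1/s. -/
lemma deriv_lam_eq_zero_left (hs : 0 < s) (h : x ≤ 1 / s) : deriv (lam s) x = 0 := by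
  have : IsMinOn (lam s) Set.univ x := fun y _ => by
    change lam s x ≤ lam s y
    rw [lam_eq_zero (by rw [mul_comm]; exact (le_div_iff₀ hs).1 h)]; exact lam_nonneg _ _
  exact this.isLocalMin Filter.univ_mem |>.deriv_eq_zero

lemma deriv_lam_eq_zero_right (hs : 0 < s) (h : 2 / s ≤ x) : deriv (lam s) x = 0 := by
  have : IsMaxOn (lam s) Set.univ x := fun y _ => by
    change lam s y ≤ lam s x
    rw [lam_eq_one (x := x) (by rw [mul_comm]; exact (div_le_iff₀ hs).1 h)]; exact lam_le_one _ _
  exact this.isLocalMax Filter.univ_mem |>.deriv_eq_zero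

/-- Smooth nonnegative radial kernels of mass one that concentrate at the pole as `s → ∞`. -/
def kern (n : ℕ) (s x : ℝ) : ℝ := 2 / sphereConst n * fluxKernel n (lam s) x

lemma kern_contDiff (hs : 0 < s) : ContDiff ℝ ((⊤ : ℕ∞) : WithTop ℕ∞) (kern n s) :=
  contDiff_const.mul (contDiff_fluxKernel (lam_contDiff s) (one_div_pos.2 hs) fun _ hy =>
    deriv_lam_eq_zero_left hs hy)

lemma kern_eq_zero (hs : 0 < s) (h : 2 / s ≤ x) : kern n s x = 0 := by
  rw [kern, fluxKernel, deriv_lam_eq_zero_right hs h]; simp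

lemma kern_nonneg (hs : 0 < s) (h0 : 0 ≤ x) (h1 : x ≤ 1) : 0 ≤ kern n s x := by
  have : 0 ≤ sphereConst n := by unfold sphereConst; positivity
  refine mul_nonneg (by positivity) (div_nonneg (mul_nonneg (deriv_lam_nonneg hs.le x)
    (pow_nonneg (by linarith) _)) (pow_nonneg h0 _))

lemma lintegral_kern_mul (hn : 1 ≤ n) (hs : 0 < s) {F : Cn n → ℝ≥0∞} (hF : Measurable F) :
    ∫⁻ z, ENNReal.ofReal (kern n s (‖z‖ ^ 2)) * F z ∂(invVolume n) =
      2 * ∫⁻ r in Set.Ioo (0 : ℝ) 1, ENNReal.ofReal (r * deriv (lam s) (r ^ 2)) *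
        ∫⁻ ξ, F (r • (ξ : Cn n)) ∂(sphereMeasure n) := by
  have hC := sphereConst_pos hn
  have hm : Measurable (fluxKernel n (lam s)) := (contDiff_fluxKernel (lam_contDiff s)
    (one_div_pos.2 hs) fun _ hy => deriv_lam_eq_zero_left hs hy).continuous.measurable
  simp only [kern]
  simp_rw [ENNReal.ofReal_mul (show 0 ≤ 2 / sphereConst n by positivity), mul_assoc]
  rw [lintegral_const_mul _ (by fun_prop), lintegral_fluxKernel hn hm hF, ← mul_assoc,
    ← ENNReal.ofReal_mul (by positivity), div_mul_cancel₀ _ hC.ne']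
  simp

/-- The kernels have mass one. -/
lemma lintegral_kern (hn : 1 ≤ n) (hs : 2 ≤ s) :
    ∫⁻ z : Cn n, ENNReal.ofReal (kern n s (‖z‖ ^ 2)) ∂(invVolume n) = 1 := by
  have := isProbabilityMeasure_sphereMeasure hn
  have h := lintegral_kern_mul (n := n) hn (by linarith) (F := fun _ => 1) (s := s) measurable_const
  simp only [mul_one, lintegral_const, measure_univ] at h
  rw [h, lintegral_mul_deriv_sq (lam_contDiff (m := 1) s) (deriv_lam_nonneg (by linarith)),
    lam_eq_one (by linarith), lam_eq_zero (by simp),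
    show (2 : ℝ≥0∞) = ENNReal.ofReal 2 by simp, ← ENNReal.ofReal_mul (by norm_num)]
  simp

end cutoff

/-! ### Subharmonicity of e^φ|f|² -/

section holomorphic

variable {F : Cn n → ℂ} {z : Cn n}

lemma contDiff_re (hF : ContDiff ℂ 2 F) : ContDiff ℝ 2 fun y => (F y).re :=
  Complex.reCLM.contDiff.comp (hF.restrict_scalars ℝ)

lemma contDiff_im (hF : ContDiff ℂ 2 F) : ContDiff ℝ 2 fun y => (F y).im :=
  Complex.imCLM.contDiff.comp (hF.restrict_scalars ℝ)

lemma fderiv_re (hF : ContDiff ℂ 2 F) (y v : Cn n) :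
    fderiv ℝ (fun y => (F y).re) y v = (fderiv ℂ F y v).re := by
  have h := ((hF.differentiable two_ne_zero y).hasFDerivAt.restrictScalars ℝ)
  rw [show fderiv ℝ (fun y => (F y).re) y = _ from (Complex.reCLM.hasFDerivAt.comp y h).fderiv]
  rfl

lemma fderiv_im (hF : ContDiff ℂ 2 F) (y v : Cn n) :
    fderiv ℝ (fun y => (F y).im) y v = (fderiv ℂ F y v).im := by
  have h := ((hF.differentiable two_ne_zero y).hasFDerivAt.restrictScalars ℝ)
  rw [show fderiv ℝ (fun y => (F y).im) y = _ from (Complex.imCLM.hasFDerivAt.comp y h).fderiv]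
  rfl

lemma fderiv_re_I (hF : ContDiff ℂ 2 F) (y v : Cn n) :
    fderiv ℝ (fun y => (F y).re) y (Complex.I • v) = -fderiv ℝ (fun y => (F y).im) y v := by
  rw [fderiv_re hF, fderiv_im hF]; simp

lemma fderiv_im_I (hF : ContDiff ℂ 2 F) (y v : Cn n) :
    fderiv ℝ (fun y => (F y).im) y (Complex.I • v) = fderiv ℝ (fun y => (F y).re) y v := by
  rw [fderiv_re hF, fderiv_im hF]; simp

lemma D2_symm {u : Cn n → ℝ} (hu : ContDiffAt ℝ 2 u z) (v w : Cn n) : D2 u z v w = D2 u z w v :=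
  (hu.isSymmSndFDerivAt (by simp)).eq v w

/-- Differentiate the Cauchy–Riemann equations and use symmetry of the Hessian: the real and
imaginary parts are pluriharmonic, so `Lop` annihilates them. -/
lemma D2_re_I (hF : ContDiff ℂ 2 F) (v : Cn n) :
    D2 (fun y => (F y).re) z (Complex.I • v) (Complex.I • v) = -D2 (fun y => (F y).re) z v v ∧
    D2 (fun y => (F y).im) z (Complex.I • v) (Complex.I • v) = -D2 (fun y => (F y).im) z v v := by
  have hf := (contDiff_re hF).contDiffAt (x := z)
  have hg := (contDiff_im hF).contDiffAt (x := z)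
  have h1 : ∀ w v, D2 (fun y => (F y).re) z w (Complex.I • v) = -D2 (fun y => (F y).im) z w v := by
    intro w v
    have a1 := hasFDerivAt_fderiv_apply hf (Complex.I • v)
    have a2 := (hasFDerivAt_fderiv_apply hg v).neg
    have e : (fun y => fderiv ℝ (fun y => (F y).re) y (Complex.I • v)) =
        -fun y => fderiv ℝ (fun y => (F y).im) y v := by
      ext y; exact fderiv_re_I hF y v
    rw [e] at a1
    simpa using DFunLike.congr_fun (a1.unique a2) w
  have h2 : ∀ w v, D2 (fun y => (F y).im) z w (Complex.I • v) = D2 (fun y => (F y).re) z w v := by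
    intro w v
    have a1 := hasFDerivAt_fderiv_apply hg (Complex.I • v)
    have a2 := (hasFDerivAt_fderiv_apply hf v)
    have e : (fun y => fderiv ℝ (fun y => (F y).im) y (Complex.I • v)) =
        fun y => fderiv ℝ (fun y => (F y).re) y v := by
      ext y; exact fderiv_im_I hF y v
    rw [e] at a1
    simpa using DFunLike.congr_fun (a1.unique a2) w
  constructor
  · rw [h1, D2_symm hg, h2]
  · rw [h2, D2_symm hf, h1]

lemma bergmanTrace_eq_zero_of_I (B : Cn n → Cn n → ℝ)
    (h : ∀ v, B (Complex.I • v) (Complex.I • v) = -B v v) : bergmanTrace z B = 0 := by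
  have : ∀ i : Fin n, B (EuclideanSpace.single i Complex.I) (EuclideanSpace.single i Complex.I)
      = - B (EuclideanSpace.single i 1) (EuclideanSpace.single i 1) := fun i => by
    rw [← h, I_smul_single, mul_one]
  simp [bergmanTrace, this, h]

lemma Lop_re (hF : ContDiff ℂ 2 F) : Lop (fun y => (F y).re) z = 0 :=
  bergmanTrace_eq_zero_of_I _ fun v => (D2_re_I hF v).1

lemma Lop_im (hF : ContDiff ℂ 2 F) : Lop (fun y => (F y).im) z = 0 :=
  bergmanTrace_eq_zero_of_I _ fun v => (D2_re_I hF v).2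

lemma norm_sq_eq_re_im (w : ℂ) : ‖w‖ ^ 2 = w.re * w.re + w.im * w.im := by
  rw [Complex.sq_norm, Complex.normSq_apply]

lemma contDiff_norm_sq_comp (hF : ContDiff ℂ 2 F) : ContDiff ℝ 2 fun y => ‖F y‖ ^ 2 := by
  simp only [norm_sq_eq_re_im]
  exact ((contDiff_re hF).mul (contDiff_re hF)).add ((contDiff_im hF).mul (contDiff_im hF))

/-- The identity `|f|² e^φ Δφ ≤ Δ(e^φ |f|²)` for holomorphic `f`. -/
lemma Lop_exp_mul_le (hF : ContDiff ℂ 2 F) {φ : Cn n → ℝ} (hφ : ContDiffAt ℝ 2 φ z) (hz : ‖z‖ ≤ 1) :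
    Real.exp (φ z) * ‖F z‖ ^ 2 * Lop φ z ≤ Lop (fun y => Real.exp (φ y) * ‖F y‖ ^ 2) z := by
  have hf := (contDiff_re hF).contDiffAt (x := z)
  have hg := (contDiff_im hF).contDiffAt (x := z)
  have hE : ContDiffAt ℝ 2 (fun y => Real.exp (φ y)) z := Real.contDiff_exp.contDiffAt.comp z hφ
  set α := fderiv ℝ (fun y => (F y).re) z with hα
  set β := fderiv ℝ (fun y => (F y).im) z with hβ
  set χ := fderiv ℝ φ z with hχ
  set f := (F z).re with hf0
  set g := (F z).im with hg0
  have dE : fderiv ℝ (fun y => Real.exp (φ y)) z = Real.exp (φ z) • χ := by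
    rw [fderiv_comp_real (hφ.differentiableAt two_ne_zero) Real.differentiableAt_exp, Real.deriv_exp]
  have LE : Lop (fun y => Real.exp (φ y)) z = Real.exp (φ z) * (Lop φ z + Gam z χ χ) := by
    rw [Lop_comp hφ Real.contDiff_exp.contDiffAt]; simp; ring
  have LN : Lop (fun y => (F y).re * (F y).re + (F y).im * (F y).im) z
      = 2 * Gam z α α + 2 * Gam z β β := by
    rw [Lop_add (hf.mul hf) (hg.mul hg), Lop_mul hf hf, Lop_mul hg hg, Lop_re hF, Lop_im hF]
    ring
  have dN : fderiv ℝ (fun y => (F y).re * (F y).re + (F y).im * (F y).im) z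
      = (2 * f) • α + (2 * g) • β := by
    have h1 := (hf.differentiableAt two_ne_zero).hasFDerivAt
    have h2 := (hg.differentiableAt two_ne_zero).hasFDerivAt
    rw [show fderiv ℝ (fun y => (F y).re * (F y).re + (F y).im * (F y).im) z = _ from
      ((h1.mul h1).add (h2.mul h2)).fderiv]
    ext v; simp [hα, hβ, hf0, hg0]; ring
  have hβα : Gam z β β = Gam z α α := by
    rw [← Gam_I z β β]
    have : (fun v => β (Complex.I • v)) = α := by ext v; exact fderiv_im_I hF z v
    rw [this]
  simp only [norm_sq_eq_re_im]
  rw [Lop_mul hE ((hf.mul hf).add (hg.mul hg)), LN, LE, dE, dN]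
  rw [← hf0, ← hg0, hβα]
  -- The covector dφ∘i. By the Cauchy–Riemann equations Γ(dφ, d Im F) = Γ(dφ∘i, d Re F), so d Im F
  -- can be eliminated and the remainder becomes a perfect square.
  set χI : Cn n →L[ℝ] ℝ :=
    χ ∘L ((Complex.I • ContinuousLinearMap.id ℂ (Cn n)).restrictScalars ℝ) with hχI
  have hχIa : ∀ v, χI v = χ (Complex.I • v) := fun v => by simp [hχI]
  have q1 : Gam z χI χI = Gam z χ χ := by
    rw [← Gam_I z χ χ]; rfl
  have q2 : Gam z χ χI = 0 := by
    rw [Gam_comm]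
    refine Gam_eq_zero_of_I z _ _ (fun v => ?_) fun v => (hχIa v).symm
    rw [hχIa, smul_smul, Complex.I_mul_I]; simp
  have q3 : Gam z χI α = Gam z χ β := by
    rw [← Gam_I z χI α]
    have e1 : (fun v => χI (Complex.I • v)) = fun v => (-1) * χ v := by
      ext v; rw [hχIa, smul_smul, Complex.I_mul_I]; simp
    have e2 : (fun v => α (Complex.I • v)) = fun v => (-1) * β v := by
      ext v; rw [hα, fderiv_re_I hF]; simp [hβ]
    rw [e1, e2, Gam_smul_left, Gam_smul_right]; ring
  -- With f = Re F and g = Im F, the excess of the right side over the left is exactly e^φ Γ(ω, ω)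
  -- for ω = f dφ + g dφ∘i + 2 d Re F.
  have key := Gam_self_nonneg hz (f • χ + (1 : ℝ) • (g • χI + (2 : ℝ) • α))
  have g1 := Gam_add_smul z χ (g • χI + (2 : ℝ) • α) χ (g • χI + (2 : ℝ) • α) f 1 f 1
  have g2 := Gam_add_smul z χI α χI α g 2 g 2
  have g4 := Gam_add_smul z χ χ α β (Real.exp (φ z)) 0 (2 * f) (2 * g)
  simp only [zero_smul, add_zero, one_smul, zero_mul] at g4 g1 key
  have g5 := Gam_add_smul z χ χ χI α 1 0 g 2
  simp only [zero_smul, add_zero, one_smul, zero_mul] at g5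
  rw [g4]
  have g6 := Gam_comm z (g • χI + (2 : ℝ) • α : Cn n →L[ℝ] ℝ) χ
  have g7 := Gam_comm z α χI
  rw [g1, g6, g5, g2, g7, q1, q2, q3] at key
  linear_combination Real.exp (φ z) * key

lemma invLaplacian_exp_mul_le (hF : ContDiff ℂ 2 F) {φ : Cn n → ℝ} (hφ : ContDiffAt ℝ 2 φ z)
    (hz : z ∈ unitBall n) : Real.exp (φ z) * ‖F z‖ ^ 2 * invLaplacian φ z ≤
      invLaplacian (fun y => Real.exp (φ y) * ‖F y‖ ^ 2) z := by
  have hu : ContDiffAt ℝ 2 (fun y => Real.exp (φ y) * ‖F y‖ ^ 2) z :=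
    (Real.contDiff_exp.contDiffAt.comp z hφ).mul (contDiff_norm_sq_comp hF).contDiffAt
  rw [invLaplacian_eq hφ, invLaplacian_eq hu, mul_left_comm]
  have := one_sub_norm_sq_pos hz
  exact mul_le_mul_of_nonneg_left (Lop_exp_mul_le hF hφ (mem_unitBall.1 hz).le) (by positivity)

end holomorphic

/-! ### Truncated Green's functions and Green's inequality -/

section green

/-- A flux that increases to `1` on `(0, 1)`. -/
def flux (s x : ℝ) : ℝ := lam s x + lam s (1 - x) - 1

/-- Smooth compactly supported functions that increase to Green's function. -/
def truncGreen (s : ℝ) (z : Cn n) : ℝ := (n + 1) / (4 * n) * pot n (flux s) (‖z‖ ^ 2)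

variable {s : ℝ}

lemma flux_contDiff (s : ℝ) {m : ℕ∞} : ContDiff ℝ m (flux s) :=
  ((lam_contDiff s).add ((lam_contDiff s).comp (contDiff_const.sub contDiff_id))).sub contDiff_const

/-- The condition s ≥ 4 keeps the two transition zones, [1/s, 2/s] and [1 - 2/s, 1 - 1/s], on
different sides of 1/2. -/
lemma flux_eq_zero_left (hs : 4 ≤ s) {x : ℝ} (hx : x ≤ 1 / s) : flux s x = 0 := by
  have h : s * x ≤ 1 := by rw [mul_comm]; exact (le_div_iff₀ (by linarith)).1 hx
  rw [flux, lam_eq_zero h, lam_eq_one (by nlinarith)]; ring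

lemma flux_eq_zero_right (hs : 4 ≤ s) {x : ℝ} (hx : 1 - 1 / s ≤ x) : flux s x = 0 := by
  have := flux_eq_zero_left hs (x := 1 - x) (by linarith)
  rw [flux, sub_sub_cancel] at this
  rw [flux]; linarith

lemma flux_nonneg (hs : 4 ≤ s) (x : ℝ) : 0 ≤ flux s x := by
  unfold flux
  rcases le_total x (1 / 2) with h | h
  · rw [lam_eq_one (x := 1 - x) (by nlinarith)]; linarith [lam_nonneg s x]
  · rw [lam_eq_one (x := x) (by nlinarith)]; linarith [lam_nonneg s (1 - x)]

lemma bx_zero (z : Cn n) : bx 0 z = ‖z‖ ^ 2 := by simp [bx]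

lemma zero_mem_unitBall : (0 : Cn n) ∈ unitBall n := by simp

lemma one_sub_inv_lt_one (hs : 4 ≤ s) : 1 - 1 / s < 1 := by
  have : 0 < 1 / s := by positivity
  linarith

lemma truncGreen_eq (s : ℝ) (z : Cn n) :
    truncGreen s z = (n + 1) / (4 * n) * pot n (flux s) (bx 0 z) := by rw [bx_zero, truncGreen]

lemma contDiff_pot_flux (hs : 4 ≤ s) : ContDiff ℝ ((⊤ : ℕ∞) : WithTop ℕ∞) (pot n (flux s)) :=
  contDiff_pot (flux_contDiff s) (δ := 1 / s) (by positivity) fun _ hy => flux_eq_zero_left hs hy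

lemma pot_flux_eq_zero (hs : 4 ≤ s) : ∀ x, 1 - 1 / s ≤ x → pot n (flux s) x = 0 := fun _ hx =>
  pot_eq_zero (one_sub_inv_lt_one hs).le (fun _ hy => flux_eq_zero_right hs hy) hx

lemma truncGreen_contDiff (hs : 4 ≤ s) : ContDiff ℝ ((⊤ : ℕ∞) : WithTop ℕ∞) (truncGreen (n := n) s) := by
  have := contDiff_kernel_right (n := n) (a := 0) (contDiff_pot_flux (n := n) hs)
    (one_sub_inv_lt_one hs).le (pot_flux_eq_zero hs) (zero_mem_unitBall (n := n))
  simp only [bx_zero] at this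
  exact contDiff_const.mul this

lemma truncGreen_zero_off (hs : 4 ≤ s) {z : Cn n}
    (hz : z ∉ Metric.closedBall (0 : Cn n) (suppRadius (1 - 1 / s) 0)) : truncGreen s z = 0 := by
  rw [truncGreen_eq, kernel_eq_zero zero_lt_one (by simp) (one_sub_inv_lt_one hs).le
    (pot_flux_eq_zero hs) hz, mul_zero]

lemma truncGreen_hasCompactSupport (hs : 4 ≤ s) : HasCompactSupport (truncGreen (n := n) s) :=
  HasCompactSupport.intro (isCompact_closedBall _ _) fun _ hz => truncGreen_zero_off hs hz

lemma truncGreen_tsupport (hs : 4 ≤ s) : tsupport (truncGreen (n := n) s) ⊆ unitBall n :=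
  (closure_minimal (fun z hz => by
    by_contra h; exact hz (truncGreen_zero_off hs h)) Metric.isClosed_closedBall).trans
    (closedBall_subset_unitBall (suppRadius_lt_one (one_sub_inv_lt_one hs) zero_lt_one))

lemma truncGreen_nonneg (hs : 4 ≤ s) {z : Cn n} (hz : z ∈ unitBall n) : 0 ≤ truncGreen s z :=
  mul_nonneg (by positivity) (pot_nonneg (fun _ _ _ => flux_nonneg hs _) (by positivity)
    (by linarith [one_sub_norm_sq_pos hz]))

lemma invLaplacian_const_mul (c : ℝ) {u : Cn n → ℝ} {z : Cn n} (hu : ContDiffAt ℝ 2 u z) :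
    invLaplacian (fun y => c * u y) z = c * invLaplacian u z := by
  have hc : ContDiffAt ℝ 2 (fun _ : Cn n => c) z := contDiffAt_const
  rw [invLaplacian_eq (hc.mul hu), invLaplacian_eq hu, Lop_mul hc hu]
  have : Lop (fun _ : Cn n => c) z = 0 := by simp [Lop, D2, bergmanTrace]
  rw [this]
  simp [Gam, bergmanTrace]; ring

lemma invLaplacian_truncGreen (hn : 1 ≤ n) (hs : 4 ≤ s) {z : Cn n} (hz : z ∈ unitBall n) :
    invLaplacian (truncGreen s) z = -(1 / n) * fluxKernel n (flux s) (‖z‖ ^ 2) := by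
  have e : truncGreen s = fun z : Cn n => (n + 1) / (4 * n) * pot n (flux s) (bx 0 z) := by
    ext z; exact truncGreen_eq s z
  have h2 : ContDiffAt ℝ 2 (fun z : Cn n => pot n (flux s) (bx 0 z)) z :=
    contDiff_infty.1 (contDiff_kernel_right (contDiff_pot_flux (n := n) hs)
      (one_sub_inv_lt_one hs).le (pot_flux_eq_zero hs) zero_mem_unitBall) 2 |>.contDiffAt
  rw [e, invLaplacian_const_mul _ h2, invLaplacian_pot hn (flux_contDiff s) (δ := 1 / s)
    (by positivity) (fun _ hy => flux_eq_zero_left hs hy) zero_mem_unitBall hz, bx_zero]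
  have : (0 : ℝ) < n := by exact_mod_cast hn
  field_simp

lemma ofReal_integral_le {α : Type*} [MeasurableSpace α] {μ : Measure α} {f : α → ℝ}
    (hf : Integrable f μ) : ENNReal.ofReal (∫ x, f x ∂μ) ≤ ∫⁻ x, ENNReal.ofReal (f x) ∂μ := by
  have h1 : ∫ x, f x ∂μ ≤ ∫ x, max (f x) 0 ∂μ :=
    integral_mono hf hf.pos_part fun x => le_max_left _ _
  refine (ENNReal.ofReal_le_ofReal h1).trans_eq ?_
  rw [ofReal_integral_eq_lintegral_ofReal hf.pos_part (ae_of_all _ fun x => le_max_right _ _)]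
  refine lintegral_congr fun x => ?_
  rcases le_total (f x) 0 with h | h
  · rw [max_eq_right h, ENNReal.ofReal_of_nonpos h, ENNReal.ofReal_zero]
  · rw [max_eq_left h]

/-- The decreasing part of the flux, with the sign changed. -/
lemma deriv_flux_ge (hs : 4 ≤ s) (x : ℝ) :
    -deriv (flux s) x ≤ deriv (fun x => -lam s (1 - x)) x := by
  have d1 : DifferentiableAt ℝ (lam s) x := (lam_contDiff (m := 1) s).differentiable (by simp) x
  have d2 : DifferentiableAt ℝ (fun x => lam s (1 - x)) x :=
    ((lam_contDiff (m := 1) s).differentiable (by simp)).comp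
      ((differentiable_const 1).sub differentiable_id) x
  have e : deriv (flux s) x = deriv (lam s) x + deriv (fun x => lam s (1 - x)) x := by
    unfold flux
    rw [deriv_sub_const, deriv_fun_add d1 d2]
  rw [e, deriv.fun_neg]
  have := deriv_lam_nonneg (s := s) (by linarith) x
  linarith

lemma deriv_neg_lam (s x : ℝ) : deriv (fun x => -lam s (1 - x)) x = deriv (lam s) (1 - x) := by
  rw [deriv.fun_neg, deriv_comp_const_sub, neg_neg]

/-- Green's inequality for `e^φ |f|²` with a truncated Green's function. -/
theorem lintegral_truncGreen_le (hn : 1 ≤ n) (hs : 4 ≤ s) {F : Cn n → ℂ} (hF : ContDiff ℂ 2 F)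
    {φ : Cn n → ℝ} (hφ : ContDiffOn ℝ 2 φ (unitBall n))
    (hL : ∀ z ∈ unitBall n, 0 ≤ invLaplacian φ z) (hφ0 : ∀ z ∈ unitBall n, φ z ≤ 0) {B : ℝ≥0∞}
    (hB : ∀ r : ℝ, 0 < r → r < 1 → 1 - 2 / s ≤ r ^ 2 →
      ∫⁻ ξ, ‖F (r • (ξ : Cn n))‖ₑ ^ 2 ∂(sphereMeasure n) ≤ B) :
    ENNReal.ofReal (n.factorial / Real.pi ^ n) * ∫⁻ z, ENNReal.ofReal
      (truncGreen s z * (Real.exp (φ z) * ‖F z‖ ^ 2 * invLaplacian φ z)) ∂(invVolume n) ≤ B := by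
  set u : Cn n → ℝ := fun y => Real.exp (φ y) * ‖F y‖ ^ 2 with hu
  have hn0 : (0 : ℝ) < n := by exact_mod_cast hn
  have hs0 : 0 < s := by linarith
  have cu : ContDiffOn ℝ 2 u (unitBall n) := fun z hz =>
    ((Real.contDiff_exp.contDiffAt.comp z (contDiffAt_of_ball hφ hz)).mul
      (contDiff_norm_sq_comp hF).contDiffAt).contDiffWithinAt
  have cψ : ContDiff ℝ 2 (truncGreen (n := n) s) := contDiff_infty.1 (truncGreen_contDiff hs) 2
  have hc := truncGreen_hasCompactSupport (n := n) hs
  have hsub := truncGreen_tsupport (n := n) hs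
  have hg := invVolume_lt_top_of_isCompact hc hsub
  have hz0 : ∀ z ∉ tsupport (truncGreen (n := n) s), truncGreen s z = 0 := fun z hz =>
    image_eq_zero_of_notMem_tsupport hz
  have hball : ∀ᵐ z ∂(invVolume n), z ∈ unitBall n :=
    (withDensity_absolutelyContinuous _ _).ae_le (ae_restrict_mem isOpen_unitBall.measurableSet)
  have i1 : Integrable (fun z => truncGreen s z * (u z * invLaplacian φ z)) (invVolume n) :=
    integrable_of_continuousOn_zero_off hc hg (cψ.continuous.continuousOn.mul
      ((cu.continuousOn.mono hsub).mul ((continuousOn_invLaplacian hφ).mono hsub))) fun z hz => by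
        rw [hz0 z hz, zero_mul]
  have i2 : Integrable (fun z => truncGreen s z * invLaplacian u z) (invVolume n) :=
    integrable_of_continuousOn_zero_off hc hg (cψ.continuous.continuousOn.mul
      ((continuousOn_invLaplacian cu).mono hsub)) fun z hz => by
        rw [hz0 z hz, zero_mul]
  have i3 : Integrable (fun z => u z * invLaplacian (truncGreen s) z) (invVolume n) :=
    integrable_of_continuousOn_zero_off hc hg ((cu.continuousOn.mono hsub).mul
      ((continuousOn_invLaplacian cψ.contDiffOn).mono hsub)) fun z hz => by
        rw [invLaplacian_eq_zero_of_notMem_tsupport hz, mul_zero]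
  -- Subharmonicity inequality multiplied by the nonnegative test function, then symmetry of the
  -- Laplacian.
  have h1 : ∫ z, truncGreen s z * (u z * invLaplacian φ z) ∂(invVolume n)
      ≤ ∫ z, u z * invLaplacian (truncGreen s) z ∂(invVolume n) := by
    rw [← integral_invLaplacian_symm cu cψ hc hsub]
    refine integral_mono_ae i1 i2 ?_
    filter_upwards [hball] with z hz
    exact mul_le_mul_of_nonneg_left (invLaplacian_exp_mul_le hF (contDiffAt_of_ball hφ hz) hz)
      (truncGreen_nonneg hs hz)
  -- The flux rises near the pole and falls near the boundary. The rise enters with a favourable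
  -- sign and is dropped; in the limit it is the term -u(0). The fall is carried by μ, whose
  -- derivative vanishes for r² < 1 - 2/s.
  set μ : ℝ → ℝ := fun x => -lam s (1 - x) with hμ
  have cμ : ContDiff ℝ ((⊤ : ℕ∞) : WithTop ℕ∞) μ :=
    ((lam_contDiff s).comp (contDiff_const.sub contDiff_id)).neg
  have hμd : ∀ x, 0 ≤ deriv μ x := fun x => by
    rw [hμ, deriv_neg_lam]; exact deriv_lam_nonneg hs0.le _
  have hm : Measurable (fluxKernel n μ) := (contDiff_fluxKernel cμ (δ := 1 / 2) (by norm_num)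
    fun y hy => by
      rw [hμ, deriv_neg_lam]
      exact deriv_lam_eq_zero_right hs0 ((div_le_iff₀ hs0).2 (by nlinarith))).continuous.measurable
  have h2 : ∀ᵐ z ∂(invVolume n), ENNReal.ofReal (u z * invLaplacian (truncGreen s) z) ≤
      ENNReal.ofReal (1 / n) * (ENNReal.ofReal (fluxKernel n μ (‖z‖ ^ 2)) * ‖F z‖ₑ ^ 2) := by
    filter_upwards [hball] with z hz
    have hx1 := one_sub_norm_sq_pos hz
    have hfl0 : 0 ≤ fluxKernel n μ (‖z‖ ^ 2) :=
      div_nonneg (mul_nonneg (hμd _) (by positivity)) (by positivity)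
    rw [invLaplacian_truncGreen hn hs hz, ← ofReal_norm, ← ENNReal.ofReal_pow (norm_nonneg _),
      ← ENNReal.ofReal_mul hfl0,
      ← ENNReal.ofReal_mul (by positivity)]
    refine ENNReal.ofReal_le_ofReal ?_
    have hfl : -fluxKernel n (flux s) (‖z‖ ^ 2) ≤ fluxKernel n μ (‖z‖ ^ 2) := by
      rw [fluxKernel, fluxKernel, ← neg_div, ← neg_mul]
      exact div_le_div_of_nonneg_right (mul_le_mul_of_nonneg_right (deriv_flux_ge hs _)
        (by positivity)) (by positivity)
    have hu0 : 0 ≤ u z := by positivity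
    have hu1 : u z ≤ ‖F z‖ ^ 2 := by
      have : Real.exp (φ z) ≤ 1 := Real.exp_le_one_iff.2 (hφ0 z hz)
      exact mul_le_of_le_one_left (by positivity) this
    calc u z * (-(1 / n) * fluxKernel n (flux s) (‖z‖ ^ 2))
        = 1 / n * (u z * -fluxKernel n (flux s) (‖z‖ ^ 2)) := by ring
      _ ≤ 1 / n * (u z * fluxKernel n μ (‖z‖ ^ 2)) := by gcongr
      _ ≤ 1 / n * (‖F z‖ ^ 2 * fluxKernel n μ (‖z‖ ^ 2)) := by gcongr
      _ = _ := by ring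
  have h3 : ∫⁻ z, ENNReal.ofReal (fluxKernel n μ (‖z‖ ^ 2)) * ‖F z‖ₑ ^ 2 ∂(invVolume n) ≤
      ENNReal.ofReal (sphereConst n) * (ENNReal.ofReal (1 / 2) * B) := by
    rw [lintegral_fluxKernel hn hm (hF.continuous.enorm.measurable.pow_const 2)]
    gcongr
    have h4 : ∀ r ∈ Set.Ioo (0 : ℝ) 1, ENNReal.ofReal (r * deriv μ (r ^ 2)) *
        ∫⁻ ξ, ‖F (r • (ξ : Cn n))‖ₑ ^ 2 ∂(sphereMeasure n) ≤
        ENNReal.ofReal (r * deriv μ (r ^ 2)) * B := fun r hr => by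
      by_cases hr2 : 1 - 2 / s ≤ r ^ 2
      · gcongr; exact hB r hr.1 hr.2 hr2
      · have : deriv μ (r ^ 2) = 0 := by
          rw [hμ, deriv_neg_lam]
          exact deriv_lam_eq_zero_right hs0 (by linarith)
        simp [this]
    refine (setLIntegral_mono' measurableSet_Ioo h4).trans_eq ?_
    rw [lintegral_mul_const, lintegral_mul_deriv_sq (contDiff_infty.1 cμ 1) hμd]
    · simp only [hμ]
      rw [sub_self, sub_zero, lam_eq_zero (x := 0) (by simp), lam_eq_one (x := 1) (by linarith)]
      norm_num
    · have : Continuous (deriv μ) := (contDiff_infty.1 cμ 1).continuous_deriv le_rfl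
      fun_prop
  have h5 : ∫⁻ z, ENNReal.ofReal (truncGreen s z * (u z * invLaplacian φ z)) ∂(invVolume n) ≤
      ENNReal.ofReal (1 / n) * (ENNReal.ofReal (sphereConst n) * (ENNReal.ofReal (1 / 2) * B)) := by
    rw [← ofReal_integral_eq_lintegral_ofReal i1]
    · refine (ENNReal.ofReal_le_ofReal h1).trans ((ofReal_integral_le i3).trans ?_)
      refine (lintegral_mono_ae h2).trans ?_
      rw [lintegral_const_mul' _ _ ENNReal.ofReal_ne_top]
      gcongr
    · filter_upwards [hball] with z hz
      have := truncGreen_nonneg hs hz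
      have := hL z hz
      positivity
  refine (mul_le_mul_right h5 _).trans_eq ?_
  simp only [← mul_assoc]
  rw [← ENNReal.ofReal_mul (by positivity), ← ENNReal.ofReal_mul (by positivity),
    ← ENNReal.ofReal_mul (by have := sphereConst_pos hn; positivity)]
  -- The factor 1/n comes from the Laplacian of the truncation, `sphereConst` from polar coordinates
  -- and 1/2 from d(r²) = 2r dr. The normalization of the measure makes the constant exactly one.
  have : (n.factorial : ℝ) / Real.pi ^ n * (1 / n) * sphereConst n * (1 / 2) = 1 := by
    have := Real.pi_pos
    have : (0 : ℝ) < n.factorial := by exact_mod_cast n.factorial_pos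
    rw [sphereConst]; field_simp
  rw [this]; simp

end green

/-! ### Passage to Green's function -/

section greenLimit

lemma measurable_green : Measurable (green (n := n)) := by
  have h : Antitone fun r : ℝ => ENNReal.ofReal (((n : ℝ) + 1) / (2 * (n : ℝ))) *
      ∫⁻ t in Set.Ioo r 1, ENNReal.ofReal ((1 - t ^ 2) ^ (n - 1) / t ^ (2 * n - 1)) :=
    fun r s hrs => by
      dsimp only
      gcongr
  exact h.measurable.comp measurable_norm

/-- Substitution y = t² in the potential. It shows the truncation as Green's function with the flux
inserted in the integrand; the Jacobian 2t accounts for 4n against 2n in the constants. -/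
lemma ofReal_truncGreen {s : ℝ} (hn : 1 ≤ n) (hs : 4 ≤ s) {z : Cn n} (hz : z ∈ unitBall n) :
    ENNReal.ofReal (truncGreen s z) = ENNReal.ofReal (((n : ℝ) + 1) / (2 * (n : ℝ))) *
      ∫⁻ t in Set.Ioo ‖z‖ 1, ENNReal.ofReal
        (flux s (t ^ 2) * ((1 - t ^ 2) ^ (n - 1) / t ^ (2 * n - 1))) := by
  have hz1 := (mem_unitBall.1 hz)
  have hs0 : (0 : ℝ) < 1 / s := by positivity
  have hc : Continuous (potDensity n (flux s)) := (contDiff_potDensity (m := ((0 : ℕ∞) : WithTop ℕ∞)) (flux_contDiff s)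
    hs0 fun _ hy => flux_eq_zero_left hs hy).continuous
  have h1 : pot n (flux s) (‖z‖ ^ 2) =
      ∫ t in ‖z‖..1, potDensity n (flux s) (t ^ 2) * (2 * t) := by
    have := intervalIntegral.integral_comp_mul_deriv (a := ‖z‖) (b := 1) (f := fun t : ℝ => t ^ 2)
      (f' := fun t => 2 * t) (g := potDensity n (flux s))
      (fun t _ => by simpa using hasDerivAt_pow 2 t) (by fun_prop) hc
    rw [one_pow] at this
    exact this.symm
  have hpos : ∀ t ∈ Set.Ioo ‖z‖ 1, 0 ≤ potDensity n (flux s) (t ^ 2) * (2 * t) := by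
    intro t ht
    have h0 : 0 < t := (norm_nonneg z).trans_lt ht.1
    have := flux_nonneg hs (t ^ 2)
    have : (0 : ℝ) ≤ 1 - t ^ 2 := by nlinarith [ht.2]
    unfold potDensity; positivity
  have hint : IntegrableOn (fun t => potDensity n (flux s) (t ^ 2) * (2 * t)) (Set.Ioo ‖z‖ 1) :=
    ((hc.comp (continuous_pow 2)).mul (continuous_const.mul continuous_id)).continuousOn
      |>.integrableOn_Icc.mono_set Set.Ioo_subset_Icc_self
  rw [truncGreen, h1, intervalIntegral.integral_of_le hz1.le, integral_Ioc_eq_integral_Ioo,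
    show ((n : ℝ) + 1) / (4 * n) = (n + 1) / (2 * n) * (1 / 2) by
      have : (0 : ℝ) < n := by exact_mod_cast hn
      field_simp; norm_num, mul_assoc,
    ENNReal.ofReal_mul (by positivity), ENNReal.ofReal_mul (by positivity),
    ofReal_integral_eq_lintegral_ofReal hint
      ((ae_restrict_iff' measurableSet_Ioo).2 (ae_of_all _ hpos)),
    ← lintegral_const_mul' _ _ ENNReal.ofReal_ne_top]
  congr 1
  refine setLIntegral_congr_fun measurableSet_Ioo fun t ht => ?_
  rw [← ENNReal.ofReal_mul (by positivity)]
  congr 1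
  have h0 : t ≠ 0 := ((norm_nonneg z).trans_lt ht.1).ne'
  have e : (t ^ 2) ^ n = t ^ (2 * n - 1) * t := by
    rw [← pow_succ, ← pow_mul]; congr 1; omega
  rw [potDensity, e]
  field_simp

lemma flux_eq_one {s x : ℝ} (h1 : 2 ≤ s * x) (h2 : 2 ≤ s * (1 - x)) : flux s x = 1 := by
  rw [flux, lam_eq_one h1, lam_eq_one h2]; norm_num

lemma four_le_add (j : ℕ) : (4 : ℝ) ≤ j + 4 := by
  have : (0 : ℝ) ≤ j := j.cast_nonneg
  linarith

/-- Fatou's lemma: for each t in (0,1) the flux at t² is eventually equal to one. Only this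
inequality is needed, so monotonicity in s plays no role. -/
lemma green_le_liminf (hn : 1 ≤ n) {z : Cn n} (hz : z ∈ unitBall n) :
    green z ≤ liminf (fun j : ℕ => ENNReal.ofReal (truncGreen ((j : ℝ) + 4) z)) atTop := by
  simp only [fun j : ℕ => ofReal_truncGreen (n := n) hn (four_le_add j) hz]
  rw [ENNReal.liminf_const_mul_of_ne_top ENNReal.ofReal_ne_top, green]
  gcongr
  refine le_trans ?_ (lintegral_liminf_le' fun j => ?_)
  · refine setLIntegral_mono' measurableSet_Ioo fun t ht => ?_
    have h0 : 0 < t := (norm_nonneg z).trans_lt ht.1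
    refine le_of_eq ?_
    symm
    refine Tendsto.liminf_eq (tendsto_const_nhds.congr' ?_)
    have h1 : Tendsto (fun j : ℕ => ((j : ℝ) + 4)) atTop atTop :=
      tendsto_atTop_add_const_right _ _ tendsto_natCast_atTop_atTop
    have h2 : (0 : ℝ) < 1 - t ^ 2 := by nlinarith [ht.2]
    filter_upwards [(h1.atTop_mul_const (show 0 < t ^ 2 by positivity)).eventually_ge_atTop 2,
      (h1.atTop_mul_const h2).eventually_ge_atTop 2] with j h3 h4
    rw [flux_eq_one h3 h4, one_mul]
  · have : Measurable (flux ((j : ℝ) + 4)) := (flux_contDiff (m := 0) _).continuous.measurable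
    fun_prop

lemma exists_norm_le_of_continuous {F : Cn n → ℂ} (hF : Continuous F) (R : ℝ) :
    ∃ C : ℝ≥0, ∀ z : Cn n, ‖z‖ ≤ R → ‖F z‖ₑ ≤ C := by
  obtain ⟨C, hC⟩ := (isCompact_closedBall (0 : Cn n) R).exists_bound_of_continuousOn hF.continuousOn
  refine ⟨C.toNNReal, fun z hz => ?_⟩
  rw [← ofReal_norm]
  exact ENNReal.ofReal_le_ofReal (hC z (by simpa using hz))

lemma norm_smul_sphere (r : ℝ) (ξ : unitSphere n) : ‖r • (ξ : Cn n)‖ = |r| := by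
  rw [norm_smul, norm_eq_of_mem_sphere ξ, mul_one, Real.norm_eq_abs]

lemma tendsto_mean (hn : 1 ≤ n) {F : Cn n → ℂ} (hF : Continuous F) :
    Tendsto (fun r : ℝ => ∫⁻ ξ, ‖F (r • (ξ : Cn n))‖ₑ ^ 2 ∂(sphereMeasure n)) (𝓝 1)
      (𝓝 (∫⁻ ξ, ‖F (ξ : Cn n)‖ₑ ^ 2 ∂(sphereMeasure n))) := by
  have := isProbabilityMeasure_sphereMeasure hn
  obtain ⟨C, hC⟩ := exists_norm_le_of_continuous hF 2
  refine tendsto_lintegral_filter_of_dominated_convergence (fun _ => (C : ℝ≥0∞) ^ 2) ?_ ?_ ?_ ?_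
  · refine Eventually.of_forall fun r => ?_
    exact (hF.comp (continuous_const_smul r |>.comp continuous_subtype_val)).enorm.measurable.pow_const 2
  · filter_upwards [Ioo_mem_nhds (show (-2 : ℝ) < 1 by norm_num) (show (1 : ℝ) < 2 by norm_num)]
      with r hr
    refine ae_of_all _ fun ξ => ?_
    gcongr
    exact hC _ (by rw [norm_smul_sphere, abs_le]; exact ⟨hr.1.le, hr.2.le⟩)
  · simp
  · refine ae_of_all _ fun ξ => ?_
    have h : Continuous fun r : ℝ => ‖F (r • (ξ : Cn n))‖ₑ :=
      (hF.comp (continuous_id.smul continuous_const)).enorm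
    have := ((ENNReal.continuous_pow 2).comp h).tendsto 1
    simpa [Function.comp_def] using this

lemma eventually_mean_le (hn : 1 ≤ n) {F : Cn n → ℂ} (hF : Continuous F) {B : ℝ≥0∞}
    (hB : ∫⁻ ξ, ‖F (ξ : Cn n)‖ₑ ^ 2 ∂(sphereMeasure n) < B) :
    ∀ᶠ j : ℕ in atTop, ∀ r : ℝ, 0 < r → r < 1 → 1 - 2 / ((j : ℝ) + 4) ≤ r ^ 2 →
      ∫⁻ ξ, ‖F (r • (ξ : Cn n))‖ₑ ^ 2 ∂(sphereMeasure n) ≤ B := by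
  obtain ⟨δ, hδ, h⟩ := Metric.eventually_nhds_iff.1 ((tendsto_mean hn hF).eventually_lt_const hB)
  have h1 : Tendsto (fun j : ℕ => 2 / ((j : ℝ) + 4)) atTop (𝓝 0) :=
    tendsto_const_nhds.div_atTop
      (tendsto_atTop_add_const_right _ _ tendsto_natCast_atTop_atTop)
  filter_upwards [h1.eventually_lt_const hδ] with j hj r h0 h2 h3
  refine (h ?_).le
  rw [Real.dist_eq, abs_lt]
  constructor <;> nlinarith

/-- Passage to the limit from truncated Green's functions. -/
theorem lintegral_green_le (hn : 1 ≤ n) {F : Cn n → ℂ} (hF : Continuous F) {μ : Measure (Cn n)}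
    (hμ : ∀ᵐ z ∂μ, z ∈ unitBall n) {h : Cn n → ℝ≥0∞} (hh : AEMeasurable h μ)
    (hfin : ∀ᵐ z ∂μ, h z ≠ ⊤) {c : ℝ≥0∞} (hc : c ≠ ⊤)
    (H : ∀ s : ℝ, 4 ≤ s → ∀ B : ℝ≥0∞, (∀ r : ℝ, 0 < r → r < 1 → 1 - 2 / s ≤ r ^ 2 →
        ∫⁻ ξ, ‖F (r • (ξ : Cn n))‖ₑ ^ 2 ∂(sphereMeasure n) ≤ B) →
      c * ∫⁻ z, ENNReal.ofReal (truncGreen s z) * h z ∂μ ≤ B) :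
    c * ∫⁻ z, green z * h z ∂μ ≤ ∫⁻ ξ, ‖F (ξ : Cn n)‖ₑ ^ 2 ∂(sphereMeasure n) := by
  have h1 : ∫⁻ z, green z * h z ∂μ ≤ liminf (fun j : ℕ =>
      ∫⁻ z, ENNReal.ofReal (truncGreen ((j : ℝ) + 4) z) * h z ∂μ) atTop := by
    refine le_trans (lintegral_mono_ae ?_) (lintegral_liminf_le' fun j => ?_)
    · filter_upwards [hμ, hfin] with z hz hz2
      rw [ENNReal.liminf_mul_const_of_ne_top hz2]
      rw [mul_comm]
      exact mul_le_mul_right (green_le_liminf hn hz) _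
    · have := (truncGreen_contDiff (n := n) (four_le_add j)).continuous.measurable
      fun_prop
  -- A bound B strictly above the boundary mean also bounds the means over all spheres close to the
  -- boundary, since F is continuous there.
  refine le_of_forall_gt_imp_ge_of_dense fun B hB => ?_
  refine (mul_le_mul_right h1 c).trans ?_
  rw [← ENNReal.liminf_const_mul_of_ne_top hc]
  refine (liminf_le_of_frequently_le' (Eventually.frequently ?_))
  filter_upwards [eventually_mean_le hn hF hB] with j hj
  exact H _ (four_le_add j) B hj

lemma lintegral_uchiyamaMeasure {φ : Cn n → EReal} {m : Measure (Cn n)}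
    (hφ : AEMeasurable (fun z => EReal.exp (φ z)) m) {f : Cn n → ℝ≥0∞} (hf : Measurable f) :
    ∫⁻ z, f z ∂(uchiyamaMeasure φ m) = ENNReal.ofReal ((n.factorial : ℝ) / Real.pi ^ n) *
      ∫⁻ z, green z * (EReal.exp (φ z) * f z) ∂m := by
  rw [uchiyamaMeasure, lintegral_smul_measure, smul_eq_mul, lintegral_withDensity_eq_lintegral_mul₀
    (f := fun z => EReal.exp (φ z) * green z) (hφ.mul measurable_green.aemeasurable) hf.aemeasurable]
  congr 1
  refine lintegral_congr fun z => ?_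
  simp only [Pi.mul_apply]; ring

lemma uchiyamaMeasure_compl {φ : Cn n → EReal} {m : Measure (Cn n)} (hm : m (unitBall n)ᶜ = 0) :
    uchiyamaMeasure φ m (unitBall n)ᶜ = 0 := by
  rw [uchiyamaMeasure, Measure.smul_apply, withDensity_absolutelyContinuous _ _ hm, smul_zero]

lemma ae_invVolume_mem : ∀ᵐ z ∂(invVolume n), z ∈ unitBall n :=
  (withDensity_absolutelyContinuous _ _).ae_le (ae_restrict_mem isOpen_unitBall.measurableSet)

lemma invVolume_absolutelyContinuous : invVolume n ≪ volume.restrict (unitBall n) :=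
  withDensity_absolutelyContinuous _ _

lemma contDiff_eval (p : MvPolynomial (Fin n) ℂ) {m : WithTop ℕ∞} :
    ContDiff ℂ m fun z : Cn n => MvPolynomial.eval (fun i => z i) p := by
  induction p using MvPolynomial.induction_on with
  | C a => simpa using contDiff_const
  | add p q hp hq => simpa using hp.add hq
  | mul_X p i hp =>
    simp only [map_mul, MvPolynomial.eval_X]
    exact hp.mul (EuclideanSpace.proj (𝕜 := ℂ) i).contDiff

/-- The embedding is contractive on holomorphic functions that are smooth up to the boundary, for
exponents of class `C²`. -/
theorem lintegral_le_of_contDiffOn (hn : 1 ≤ n) {φ : Cn n → ℝ}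
    (hφ : ContDiffOn ℝ 2 φ (unitBall n)) (hL : ∀ z ∈ unitBall n, 0 ≤ invLaplacian φ z)
    (hφ0 : ∀ z ∈ unitBall n, φ z ≤ 0) {F : Cn n → ℂ} (cF : ContDiff ℂ 2 F) :
    ∫⁻ z, ‖F z‖ₑ ^ 2 ∂(uchiyamaMeasure (fun z => (φ z : EReal))
        ((invVolume n).withDensity (fun z => ENNReal.ofReal (invLaplacian φ z)))) ≤
      ∫⁻ ξ : unitSphere n, ‖F ξ‖ₑ ^ 2 ∂(sphereMeasure n) := by
  obtain ⟨m, hm⟩ : ∃ m, m = (invVolume n).withDensity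
    (fun z => ENNReal.ofReal (invLaplacian φ z)) := ⟨_, rfl⟩
  rw [← hm]
  have hmm : m ≪ invVolume n := hm ▸ withDensity_absolutelyContinuous _ _
  have hmv : m ≪ volume.restrict (unitBall n) := hmm.trans invVolume_absolutelyContinuous
  have hb : ∀ᵐ z ∂m, z ∈ unitBall n := hmm.ae_le ae_invVolume_mem
  have mφ : AEMeasurable φ (volume.restrict (unitBall n)) :=
    hφ.continuousOn.aemeasurable isOpen_unitBall.measurableSet
  have mL : AEMeasurable (invLaplacian φ) (volume.restrict (unitBall n)) :=
    (continuousOn_invLaplacian hφ).aemeasurable isOpen_unitBall.measurableSet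
  have mexp : AEMeasurable (fun z => EReal.exp (φ z : EReal)) m :=
    (EReal.measurable_exp.comp measurable_coe_real_ereal).comp_aemeasurable (mφ.mono_ac hmv)
  have mF : Measurable fun z => ‖F z‖ₑ ^ 2 := cF.continuous.enorm.measurable.pow_const 2
  rw [lintegral_uchiyamaMeasure mexp mF]
  refine lintegral_green_le (h := fun z => EReal.exp (φ z : EReal) * ‖F z‖ₑ ^ 2) hn cF.continuous hb (mexp.mul mF.aemeasurable) ?_ ENNReal.ofReal_ne_top ?_
  · refine ae_of_all _ fun z => ?_
    rw [EReal.exp_coe]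
    exact ENNReal.mul_ne_top ENNReal.ofReal_ne_top (ENNReal.pow_ne_top enorm_ne_top)
  · intro s hs B hB
    refine le_trans (le_of_eq ?_) (lintegral_truncGreen_le hn hs cF hφ hL hφ0 hB)
    congr 1
    rw [hm, lintegral_withDensity_eq_lintegral_mul₀'
      (mL.mono_ac invVolume_absolutelyContinuous).ennreal_ofReal]
    · refine lintegral_congr_ae ?_
      filter_upwards [ae_invVolume_mem] with z hz
      have h1 := hL z hz
      have h2 := truncGreen_nonneg hs hz
      rw [Pi.mul_apply, EReal.exp_coe, ← ofReal_norm, ← ENNReal.ofReal_pow (norm_nonneg _),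
        ← ENNReal.ofReal_mul (by positivity), ← ENNReal.ofReal_mul h2, ← ENNReal.ofReal_mul h1]
      congr 1; ring
    · rw [← hm]
      exact ((truncGreen_contDiff hs).continuous.measurable.ennreal_ofReal.aemeasurable.mul
        (mexp.mul mF.aemeasurable))

end greenLimit

/-! ### Point evaluations are bounded by the boundary norm -/

section embedding

lemma eLpNorm_two_sq {α : Type*} [MeasurableSpace α] {μ : Measure α} (f : α → ℂ) :
    eLpNorm f 2 μ ^ 2 = ∫⁻ x, ‖f x‖ₑ ^ 2 ∂μ := by
  have := eLpNorm_nnreal_pow_eq_lintegral (μ := μ) (f := f) (p := 2) two_ne_zero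
  simpa using this

/-- The mean value property of the holomorphic function g². -/
lemma enorm_sq_le_circle {g : ℂ → ℂ} (hg : Differentiable ℂ g) :
    ENNReal.ofReal (2 * Real.pi) * ‖g 0‖ₑ ^ 2 ≤
      ∫⁻ θ in Set.Ioc 0 (2 * Real.pi), ‖g (circleMap 0 1 θ)‖ₑ ^ 2 := by
  have h := DiffContOnCl.circleAverage (c := 0) (R := 1) (f := fun w => g w ^ 2)
    ((hg.pow 2).diffContOnCl)
  rw [Real.circleAverage, intervalIntegral.integral_of_le Real.two_pi_pos.le] at h
  have h2 : ‖g 0‖ₑ ^ 2 = ‖(2 * Real.pi)⁻¹‖ₑ *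
      ‖∫ θ in Set.Ioc 0 (2 * Real.pi), g (circleMap 0 1 θ) ^ 2‖ₑ := by
    rw [← enorm_pow, ← enorm_smul, h]
  rw [h2, ← mul_assoc, Real.enorm_eq_ofReal (by positivity), ← ENNReal.ofReal_mul (by positivity),
    mul_inv_cancel₀ (by positivity), ENNReal.ofReal_one, one_mul]
  refine (enorm_integral_le_lintegral_enorm _).trans_eq ?_
  simp only [enorm_pow]

/-- The mean value inequality for the square of the modulus of an entire function. -/
lemma volume_ball_mul_enorm_sq_le {F : Cn n → ℂ} (hF : ContDiff ℂ 2 F) (z : Cn n) (δ : ℝ) :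
    volume (Metric.ball (0 : Cn n) δ) * ‖F z‖ₑ ^ 2 ≤ ∫⁻ w in Metric.ball z δ, ‖F w‖ₑ ^ 2 := by
  have hFd : Differentiable ℂ F := hF.differentiable two_ne_zero
  have hm : Measurable fun w => ‖F w‖ₑ ^ 2 := hF.continuous.enorm.measurable.pow_const 2
  have hpi : ENNReal.ofReal (2 * Real.pi) ≠ 0 := by simp [Real.pi_pos]
  have h1 : ∀ w : Cn n, ENNReal.ofReal (2 * Real.pi) * ‖F z‖ₑ ^ 2 ≤
      ∫⁻ θ in Set.Ioc 0 (2 * Real.pi), ‖F (z + circleMap 0 1 θ • w)‖ₑ ^ 2 := fun w => by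
    have := enorm_sq_le_circle (g := fun l => F (z + l • w))
      (hFd.comp ((differentiable_const z).add (differentiable_id.smul_const w)))
    simpa using this
  -- The map w ↦ z + e^{iθ}w preserves volume and carries the ball about 0 onto the ball about z, so
  -- averaging the circle inequality over w makes the inner integral independent of θ.
  have h2 : ∀ θ : ℝ, ∫⁻ w in Metric.ball (0 : Cn n) δ, ‖F (z + circleMap 0 1 θ • w)‖ₑ ^ 2 =
      ∫⁻ w in Metric.ball z δ, ‖F w‖ₑ ^ 2 := fun θ => by
    have hu : ‖circleMap 0 1 θ‖ = 1 := by simp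
    let U : Cn n ≃ₗᵢ[ℝ] Cn n :=
      { toLinearEquiv := (LinearEquiv.smulOfNeZero ℂ (Cn n) (circleMap 0 1 θ) (by
          rw [← norm_pos_iff, hu]; exact one_pos)).restrictScalars ℝ
        norm_map' := fun w => by
          change ‖circleMap 0 1 θ • w‖ = ‖w‖
          rw [norm_smul, hu, one_mul] }
    have hU : ∀ w, U w = circleMap 0 1 θ • w := fun w => rfl
    have hT := (measurePreserving_add_left volume z).comp U.measurePreserving
    have := hT.setLIntegral_comp_preimage (s := Metric.ball z δ) Metric.isOpen_ball.measurableSet hm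
    have hs : (fun x => z + x) ∘ U ⁻¹' Metric.ball z δ = Metric.ball (0 : Cn n) δ := by
      ext w; simp
    rw [hs] at this
    exact this
  have h3 : ∫⁻ w in Metric.ball (0 : Cn n) δ, (ENNReal.ofReal (2 * Real.pi) * ‖F z‖ₑ ^ 2) ≤
      ∫⁻ w in Metric.ball (0 : Cn n) δ, ∫⁻ θ in Set.Ioc 0 (2 * Real.pi),
        ‖F (z + circleMap 0 1 θ • w)‖ₑ ^ 2 := lintegral_mono fun w => h1 w
  rw [lintegral_lintegral_swap, lintegral_congr h2] at h3
  · simp only [lintegral_const, Measure.restrict_apply MeasurableSet.univ, Set.univ_inter,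
      Real.volume_Ioc, sub_zero] at h3
    rw [mul_comm (∫⁻ w in _, _), mul_assoc, mul_comm (‖F z‖ₑ ^ 2)] at h3
    exact (ENNReal.mul_le_mul_iff_right hpi ENNReal.ofReal_ne_top).1 h3
  · have : Continuous fun x : Cn n × ℝ => F (z + circleMap 0 1 x.2 • x.1) :=
      hF.continuous.comp (continuous_const.add
        (((continuous_circleMap 0 1).comp continuous_snd).smul continuous_fst))
    exact (this.enorm.measurable.pow_const 2).aemeasurable

lemma green_pos_on (hn : 1 ≤ n) {R : ℝ} (h0 : 0 < R) (h1 : R < 1) :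
    ∃ γ : ℝ≥0, 0 < γ ∧ ∀ z : Cn n, ‖z‖ ≤ R → (γ : ℝ≥0∞) ≤ green z := by
  set A : ℝ≥0∞ := ENNReal.ofReal (((n : ℝ) + 1) / (2 * (n : ℝ))) *
    ∫⁻ t in Set.Ioo R 1, ENNReal.ofReal ((1 - t ^ 2) ^ (n - 1) / t ^ (2 * n - 1)) with hA
  have hn0 : (0 : ℝ) < n := by exact_mod_cast hn
  have hA0 : 0 < A := by
    refine ENNReal.mul_pos (by simp; positivity) (ne_of_gt ?_)
    rw [setLIntegral_pos_iff (by fun_prop)]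
    refine lt_of_lt_of_le ?_ (measure_mono (s := Set.Ioo R 1) fun t ht => ⟨?_, ht⟩)
    · simp [h1]
    · rw [Function.mem_support]
      have : 0 < t := h0.trans ht.1
      have : 0 < 1 - t ^ 2 := by nlinarith [ht.2]
      simp; positivity
  -- The minimum with 1 dispenses with the finiteness of A.
  refine ⟨(min A 1).toNNReal, ENNReal.toNNReal_pos (by simp [hA0.ne']) (by simp), fun z hz => ?_⟩
  rw [ENNReal.coe_toNNReal (by simp)]
  refine (min_le_left _ _).trans ?_
  rw [hA, green]
  gcongr

/-- Holomorphic functions are bounded on compact sets by their norm in `L²` of the sphere. -/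
lemma exists_enorm_sq_le (hn : 1 ≤ n) {R : ℝ} (h0 : 0 < R) (h1 : R < 1) :
    ∃ C : ℝ≥0, ∀ F : Cn n → ℂ, ContDiff ℂ 2 F → ∀ z, ‖z‖ ≤ R →
      ‖F z‖ₑ ^ 2 ≤ C * ∫⁻ ξ : unitSphere n, ‖F ξ‖ₑ ^ 2 ∂(sphereMeasure n) := by
  -- Since R' = R + (1-R)/2, balls of radius (1-R)/2 about points with norm at most R stay in the
  -- ball of radius R'.
  set R' := (1 + R) / 2 with hR'
  have hR1 : R' < 1 := by linarith
  obtain ⟨γ, hγ0, hγ⟩ := green_pos_on (n := n) hn (R := R') (by positivity) hR1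
  have hn1 : (1 : ℝ) ≤ n := by exact_mod_cast hn
  -- A nonpositive exponent with explicit Laplacian, positive throughout the ball. The contraction
  -- for it controls the solid L² norm on compact balls by the boundary norm.
  set φ : Cn n → ℝ := fun z => ‖z‖ ^ 2 - 1 with hφ
  have cφ : ContDiff ℝ 2 φ := contDiff_norm_sq'.sub contDiff_const
  have Lφ : ∀ z ∈ unitBall n, invLaplacian φ z = (1 - ‖z‖ ^ 2) / (n + 1) * (4 * (n - ‖z‖ ^ 2)) := by
    intro z hz
    rw [invLaplacian_eq cφ.contDiffAt]
    congr 1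
    have : φ = fun z => ‖z‖ ^ 2 + (-1) := by ext z; simp [hφ]; ring
    rw [this, Lop_add contDiff_norm_sq'.contDiffAt contDiffAt_const, Lop_norm_sq]
    simp [Lop, D2, bergmanTrace]
  have L0 : ∀ z ∈ unitBall n, 0 ≤ invLaplacian φ z := fun z hz => by
    have := one_sub_norm_sq_pos hz
    rw [Lφ z hz]
    have : (0 : ℝ) ≤ n - ‖z‖ ^ 2 := by linarith
    positivity
  have hφ0 : ∀ z ∈ unitBall n, φ z ≤ 0 := fun z hz => by
    have := one_sub_norm_sq_pos hz
    simp only [hφ]; linarith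
  -- A lower bound, for ‖z‖ ≤ R', of e^φ Δ̃φ times the density of dg: the density is at least 1, φ ≥
  -- -1, and n - ‖z‖² ≥ 1 - R'².
  set κ : ℝ := (1 - R' ^ 2) / (n + 1) * (4 * (1 - R' ^ 2)) * Real.exp (-1) with hκ
  have hR2 : 0 < 1 - R' ^ 2 := by nlinarith
  have hκ0 : 0 < κ := by positivity
  have hc0 : (0 : ℝ) < (n.factorial : ℝ) / Real.pi ^ n := by positivity
  have key : ∀ F : Cn n → ℂ, ContDiff ℂ 2 F →
      (ENNReal.ofReal ((n.factorial : ℝ) / Real.pi ^ n) * (γ * ENNReal.ofReal κ)) *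
        ∫⁻ z in Metric.closedBall 0 R', ‖F z‖ₑ ^ 2 ≤
      ∫⁻ ξ : unitSphere n, ‖F ξ‖ₑ ^ 2 ∂(sphereMeasure n) := by
    intro F hF
    have hm : Measurable fun w => ‖F w‖ₑ ^ 2 := hF.continuous.enorm.measurable.pow_const 2
    refine le_trans ?_ (lintegral_le_of_contDiffOn hn cφ.contDiffOn L0 hφ0 hF)
    rw [lintegral_uchiyamaMeasure
      ((EReal.measurable_exp.comp measurable_coe_real_ereal).comp cφ.continuous.measurable).aemeasurable hm,
      mul_assoc]
    gcongr
    have mL : AEMeasurable (fun z => ENNReal.ofReal (invLaplacian φ z)) (invVolume n) :=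
      (((continuousOn_invLaplacian cφ.contDiffOn).aemeasurable
        isOpen_unitBall.measurableSet).mono_ac invVolume_absolutelyContinuous).ennreal_ofReal
    have mexp : Measurable fun z => EReal.exp (φ z : EReal) :=
      (EReal.measurable_exp.comp measurable_coe_real_ereal).comp cφ.continuous.measurable
    have mG := measurable_green (n := n)
    rw [lintegral_withDensity_eq_lintegral_mul₀ mL (by fun_prop)]
    rw [invVolume, lintegral_withDensity_eq_lintegral_mul₀'
      invVolume_density_measurable.aemeasurable]
    · rw [← lintegral_const_mul' _ _ (by finiteness)]
      have hsub : Metric.closedBall (0 : Cn n) R' ⊆ unitBall n := closedBall_subset_unitBall hR1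
      refine le_trans ?_ (lintegral_mono_set hsub)
      refine setLIntegral_mono' Metric.isClosed_closedBall.measurableSet fun z hz => ?_
      have hzb := hsub hz
      have hzR : ‖z‖ ≤ R' := by simpa using hz
      have hz2 := one_sub_norm_sq_pos hzb
      have hzR2 : 1 - R' ^ 2 ≤ 1 - ‖z‖ ^ 2 := by
        have := pow_le_pow_left₀ (norm_nonneg z) hzR 2
        linarith
      simp only [Pi.mul_apply]
      have e1 : ENNReal.ofReal κ ≤ ENNReal.ofReal (1 / (1 - ‖z‖ ^ 2) ^ (n + 1)) *
          (ENNReal.ofReal (invLaplacian φ z) * EReal.exp (φ z : EReal)) := by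
        rw [EReal.exp_coe, ← ENNReal.ofReal_mul (L0 z hzb), ← ENNReal.ofReal_mul (by positivity),
          Lφ z hzb]
        refine ENNReal.ofReal_le_ofReal ?_
        have a1 : 1 ≤ 1 / (1 - ‖z‖ ^ 2) ^ (n + 1) := by
          rw [le_div_iff₀ (by positivity), one_mul]
          exact pow_le_one₀ hz2.le (by nlinarith [norm_nonneg z])
        have a2 : Real.exp (-1) ≤ Real.exp (φ z) :=
          Real.exp_le_exp.2 (by simp only [hφ]; nlinarith [norm_nonneg z])
        have a3 : 1 - R' ^ 2 ≤ n - ‖z‖ ^ 2 := by linarith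
        calc κ = 1 * ((1 - R' ^ 2) / (n + 1) * (4 * (1 - R' ^ 2)) * Real.exp (-1)) := by
              rw [one_mul, hκ]
          _ ≤ _ := by
            have a4 : 0 ≤ n - ‖z‖ ^ 2 := by linarith
            gcongr
      calc (γ : ℝ≥0∞) * ENNReal.ofReal κ * ‖F z‖ₑ ^ 2
          ≤ green z * (ENNReal.ofReal (1 / (1 - ‖z‖ ^ 2) ^ (n + 1)) *
          (ENNReal.ofReal (invLaplacian φ z) * EReal.exp (φ z : EReal))) * ‖F z‖ₑ ^ 2 := by
            gcongr; exact hγ z hzR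
        _ = _ := by ring
    · have := mL
      rw [invVolume] at this
      exact this.mul (show Measurable fun z => green z * (EReal.exp (φ z : EReal) * ‖F z‖ₑ ^ 2) by
        fun_prop).aemeasurable
  have hδ : 0 < (1 - R) / 2 := by linarith
  set V := volume (Metric.ball (0 : Cn n) ((1 - R) / 2)) with hV
  have hV0 : V ≠ 0 := (Metric.measure_ball_pos _ _ hδ).ne'
  have hVt : V ≠ ⊤ := measure_ball_lt_top.ne
  set A := ENNReal.ofReal ((n.factorial : ℝ) / Real.pi ^ n) * (γ * ENNReal.ofReal κ) with hA
  have hA0 : A ≠ 0 := by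
    simp only [hA, ne_eq, mul_eq_zero, ENNReal.ofReal_eq_zero, not_or, not_le, ENNReal.coe_eq_zero]
    exact ⟨hc0, hγ0.ne', hκ0⟩
  have hAt : A ≠ ⊤ := by finiteness
  refine ⟨((A * V)⁻¹).toNNReal, fun F hF z hz => ?_⟩
  rw [ENNReal.coe_toNNReal (ENNReal.inv_ne_top.2 (mul_ne_zero hA0 hV0)), mul_comm,
    ← div_eq_mul_inv, ENNReal.le_div_iff_mul_le (Or.inl (mul_ne_zero hA0 hV0))
      (Or.inl (ENNReal.mul_ne_top hAt hVt)), mul_comm, mul_assoc]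
  refine le_trans ?_ (key F hF)
  gcongr
  refine (volume_ball_mul_enorm_sq_le hF z _).trans (lintegral_mono_set fun w hw => ?_)
  rw [Metric.mem_ball, dist_eq_norm] at hw
  rw [mem_closedBall_zero_iff]
  have := norm_add_le (w - z) z
  rw [sub_add_cancel] at this
  linarith

end embedding

/-! ### Analytic continuation and the embedding of the Hardy space -/

section continuation

/-- The polynomial `p` as a function on `ℂⁿ`. -/
def polyFun (p : MvPolynomial (Fin n) ℂ) (z : Cn n) : ℂ := MvPolynomial.eval (fun i => z i) p

lemma polyFun_contDiff (p : MvPolynomial (Fin n) ℂ) {m : WithTop ℕ∞} : ContDiff ℂ m (polyFun p) :=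
  contDiff_eval p

lemma aestronglyMeasurable_polyFun (p : MvPolynomial (Fin n) ℂ) :
    AEStronglyMeasurable (fun ξ : unitSphere n => polyFun p ξ) (sphereMeasure n) :=
  ((polyFun_contDiff (m := 2) p).continuous.comp continuous_subtype_val).aestronglyMeasurable

/-- Every function of the Hardy space has an analytic continuation. -/
theorem exists_isContinuation (hn : 1 ≤ n) {F : Lp ℂ 2 (sphereMeasure n)} (hF : F ∈ hardySpace n) :
    ∃ f : Cn n → ℂ, IsContinuation F f := by
  obtain ⟨G, hG, hlim⟩ := mem_closure_iff_seq_limit.1 hF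
  choose p hp using hG
  have hsub : ∀ k l, ∫⁻ ξ : unitSphere n, ‖polyFun (p k) ξ - polyFun (p l) ξ‖ₑ ^ 2 ∂(sphereMeasure n)
      = ‖G k - G l‖ₑ ^ 2 := by
    intro k l
    rw [Lp.enorm_def, eLpNorm_two_sq]
    refine lintegral_congr_ae ?_
    filter_upwards [hp k, hp l, Lp.coeFn_sub (G k) (G l)] with ξ h1 h2 h3
    rw [h3, Pi.sub_apply, h1, h2]; rfl
  have hcauchy : ∀ ε : ℝ≥0∞, 0 < ε → ∃ N, ∀ k ≥ N, ∀ l ≥ N, ‖G k - G l‖ₑ < ε := by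
    intro ε hε
    obtain ⟨N, hN⟩ := EMetric.cauchySeq_iff.1 hlim.cauchySeq ε hε
    refine ⟨N, fun k hk l hl => ?_⟩
    rw [← edist_eq_enorm_sub]; exact hN k hk l hl
  -- The bound for point evaluations, applied to differences, turns the L² Cauchy property on the
  -- sphere into a uniform one on smaller balls.
  have hunif : ∀ R : ℝ, 0 < R → R < 1 →
      UniformCauchySeqOn (fun k => polyFun (p k)) atTop (Metric.closedBall (0 : Cn n) R) := by
    intro R h0 h1
    obtain ⟨C, hC⟩ := exists_enorm_sq_le (n := n) hn h0 h1
    rw [Metric.uniformCauchySeqOn_iff]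
    intro ε hε
    have hlt : ∃ δ : ℝ≥0∞, 0 < δ ∧ C * δ ^ 2 < ENNReal.ofReal ε ^ 2 := by
      have : Tendsto (fun δ : ℝ≥0∞ => C * δ ^ 2) (𝓝 0) (𝓝 0) := by
        have := ENNReal.Tendsto.const_mul (a := (C : ℝ≥0∞))
          ((ENNReal.continuous_pow 2).tendsto 0) (Or.inr ENNReal.coe_ne_top)
        simpa using this
      have h2 := (this.eventually_lt_const (show 0 < ENNReal.ofReal ε ^ 2 by positivity)).filter_mono
        (nhdsWithin_le_nhds (s := Set.Ioi 0))
      exact (h2.and self_mem_nhdsWithin).exists.imp fun δ h => ⟨h.2, h.1⟩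
    obtain ⟨δ, hδ, hδ2⟩ := hlt
    obtain ⟨N, hN⟩ := hcauchy δ hδ
    refine ⟨N, fun k hk l hl z hz => ?_⟩
    have := hC _ ((polyFun_contDiff (p k)).sub (polyFun_contDiff (p l))) z (by simpa using hz)
    simp only [hsub] at this
    have h2 : ‖polyFun (p k) z - polyFun (p l) z‖ₑ ^ 2 < ENNReal.ofReal ε ^ 2 := by
      refine (this.trans ?_).trans_lt hδ2
      gcongr
      exact (hN k hk l hl).le
    have h3 := lt_of_not_ge fun h => h2.not_ge (pow_le_pow_left' h 2)
    rw [dist_eq_norm]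
    rwa [← ofReal_norm, ENNReal.ofReal_lt_ofReal_iff hε] at h3
  have hpt : ∀ z ∈ unitBall n, ∃ w, Tendsto (fun k => polyFun (p k) z) atTop (𝓝 w) := by
    intro z hz
    have hz1 := mem_unitBall.1 hz
    refine cauchySeq_tendsto_of_complete ((hunif ((1 + ‖z‖) / 2) (by positivity) (by linarith)).cauchySeq ?_)
    rw [mem_closedBall_zero_iff]; linarith
  classical
  refine ⟨fun z => if h : z ∈ unitBall n then (hpt z h).choose else 0, p, ?_, ?_⟩
  · have h1 := (Lp.tendsto_Lp_iff_tendsto_eLpNorm' G F).1 hlim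
    refine h1.congr fun k => eLpNorm_congr_ae ?_
    filter_upwards [hp k] with ξ h2
    rw [Pi.sub_apply, h2]
  · intro u hu z hz
    have hz1 := mem_unitBall.1 hz
    set R := (1 + ‖z‖) / 2 with hR
    have hR1 : R < 1 := by linarith
    have hlim : TendstoUniformlyOn (fun k => polyFun (p k))
        (fun z => if h : z ∈ unitBall n then (hpt z h).choose else 0) atTop
        (Metric.closedBall (0 : Cn n) R) := by
      refine (hunif R (by positivity) hR1).tendstoUniformlyOn_of_tendsto fun w hw => ?_
      have hwb := closedBall_subset_unitBall hR1 hw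
      rw [dif_pos hwb]
      exact (hpt w hwb).choose_spec
    refine ⟨Metric.closedBall 0 R, mem_nhdsWithin_of_mem_nhds ?_, hlim u hu⟩
    exact mem_of_superset (Metric.isOpen_ball.mem_nhds (show z ∈ Metric.ball (0 : Cn n) R by
      rw [mem_ball_zero_iff]; linarith)) Metric.ball_subset_closedBall

/-- Contractivity passes from polynomials to the Hardy space. -/
theorem embedsContractively_of_le (hn : 1 ≤ n) {ν : Measure (Cn n)} (hν : ν (unitBall n)ᶜ = 0)
    (H : ∀ F : Cn n → ℂ, ContDiff ℂ 2 F →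
      ∫⁻ z, ‖F z‖ₑ ^ 2 ∂ν ≤ ∫⁻ ξ : unitSphere n, ‖F ξ‖ₑ ^ 2 ∂(sphereMeasure n)) :
    EmbedsContractively ν := by
  intro F hF
  refine ⟨exists_isContinuation hn hF, ?_⟩
  rintro f ⟨p, hp, hpf⟩
  -- The measure ν lives on the ball, so the values of f elsewhere are irrelevant. This convergence
  -- supplies both measurability of f and the hypothesis for Fatou's lemma.
  have hae : ∀ᵐ z ∂ν, Tendsto (fun k => polyFun (p k) z) atTop (𝓝 (f z)) := by
    have : ∀ᵐ z ∂ν, z ∈ unitBall n := by rw [ae_iff]; exact hν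
    filter_upwards [this] with z hz
    exact hpf.tendsto_at hz
  have hm : AEStronglyMeasurable f ν := aestronglyMeasurable_of_tendsto_ae atTop
    (fun k => (polyFun_contDiff (m := 2) (p k)).continuous.aestronglyMeasurable) hae
  have hle : ∫⁻ z, ‖f z‖ₑ ^ 2 ∂ν ≤ ‖F‖ₑ ^ 2 := by
    have h1 : ∫⁻ z, ‖f z‖ₑ ^ 2 ∂ν ≤ liminf (fun k => ∫⁻ z, ‖polyFun (p k) z‖ₑ ^ 2 ∂ν) atTop := by
      refine le_trans (lintegral_mono_ae ?_) (lintegral_liminf_le' fun k =>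
        ((polyFun_contDiff (m := 2) (p k)).continuous.enorm.measurable.pow_const 2).aemeasurable)
      filter_upwards [hae] with z hz
      exact (((ENNReal.continuous_pow 2).tendsto _).comp hz.enorm).liminf_eq.ge
    have h2 : ∀ k, ∫⁻ z, ‖polyFun (p k) z‖ₑ ^ 2 ∂ν ≤
        (eLpNorm (fun ξ : unitSphere n => polyFun (p k) ξ - F ξ) 2 (sphereMeasure n) + ‖F‖ₑ) ^ 2 := by
      intro k
      refine (H _ (polyFun_contDiff (p k))).trans ?_
      rw [← eLpNorm_two_sq, Lp.enorm_def]
      gcongr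
      have := eLpNorm_add_le ((aestronglyMeasurable_polyFun (p k)).sub (Lp.aestronglyMeasurable F))
        (Lp.aestronglyMeasurable F) (p := 2) (by norm_num)
      rw [sub_add_cancel] at this
      exact this
    have h3 : Tendsto (fun k => (eLpNorm (fun ξ : unitSphere n => polyFun (p k) ξ - F ξ) 2
        (sphereMeasure n) + ‖F‖ₑ) ^ 2) atTop (𝓝 ((0 + ‖F‖ₑ) ^ 2)) :=
      ((ENNReal.continuous_pow 2).tendsto _).comp (Tendsto.add hp tendsto_const_nhds)
    rw [zero_add] at h3
    rw [← h3.liminf_eq]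
    exact h1.trans (liminf_le_liminf (Eventually.of_forall h2))
  refine ⟨⟨hm, ?_⟩, hle⟩
  rw [← eLpNorm_two_sq] at hle
  have : eLpNorm f 2 ν ^ 2 < ⊤ := hle.trans_lt (by finiteness)
  simpa using this

end continuation

/-! ### The Carleson condition -/

section carleson

lemma norm_inner_le_of_mem {a z : Cn n} (hz : ‖z‖ ≤ 1) : ‖inner ℂ a z‖ ≤ ‖a‖ :=
  (norm_inner_le_norm a z).trans (mul_le_of_le_one_right (norm_nonneg a) hz)

lemma one_sub_norm_le {a z : Cn n} (hz : ‖z‖ ≤ 1) : 1 - ‖a‖ ≤ ‖1 - inner ℂ a z‖ := by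
  have := norm_sub_norm_le (1 : ℂ) (inner ℂ a z)
  have := norm_inner_le_of_mem (a := a) hz
  simp at *
  linarith

/-- An estimate for the normalized reproducing kernels. -/
lemma lintegral_sphere_kernel_le (hn : 1 ≤ n) : ∃ C : ℝ≥0, ∀ a ∈ unitBall n,
    ENNReal.ofReal ((1 - ‖a‖) ^ (n + 2)) * ∫⁻ η : unitSphere n,
      ENNReal.ofReal ((‖1 - inner ℂ a (η : Cn n)‖ ^ 2)⁻¹ ^ (n + 1)) ∂(sphereMeasure n) ≤ C := by
  have hS := sphereConst_pos hn
  set V := volume (unitBall n) with hV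
  have hVt : V ≠ ⊤ := measure_ball_lt_top.ne
  -- Times (1 - ‖a‖²)^{n+1} the integrand is the Jacobian of b_a, and b_a maps the ball onto itself,
  -- so the integral is its volume.
  have solid : ∀ a ∈ unitBall n, ENNReal.ofReal ((1 - ‖a‖) ^ (n + 1)) * ∫⁻ z in unitBall n,
      ENNReal.ofReal ((‖1 - inner ℂ a z‖ ^ 2)⁻¹ ^ (n + 1)) ≤ V := by
    intro a ha
    have h := lintegral_ballAut ha (fun _ => 1)
    simp only [mul_one, lintegral_const, Measure.restrict_apply MeasurableSet.univ, Set.univ_inter,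
      one_mul] at h
    have ha1 := mem_unitBall.1 ha
    rw [hV, h, ← lintegral_const_mul' _ _ ENNReal.ofReal_ne_top]
    refine lintegral_mono fun z => ?_
    rw [← ENNReal.ofReal_mul (by have := sub_pos.2 ha1; positivity)]
    refine ENNReal.ofReal_le_ofReal ?_
    rw [← mul_pow, div_eq_mul_inv]
    have : 1 - ‖a‖ ≤ 1 - ‖a‖ ^ 2 := by nlinarith [norm_nonneg a]
    have := sub_pos.2 ha1
    gcongr
  -- The factor 2^{2n-1} comes from radii ρ ≥ 1/2 and (9/4)^{n+1} from the comparison constant 3/2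
  -- below. The leading 2 compensates for the interval of radii having length (1 - ‖a‖)/2.
  set K : ℝ := 2 * 2 ^ (2 * n - 1) * ((9 / 4) ^ (n + 1)) with hK
  refine ⟨(ENNReal.ofReal K * (ENNReal.ofReal (sphereConst n))⁻¹ * V).toNNReal, fun a ha => ?_⟩
  rw [ENNReal.coe_toNNReal (by
    refine ENNReal.mul_ne_top (ENNReal.mul_ne_top ENNReal.ofReal_ne_top ?_) hVt
    simp [hS])]
  have ha1 := mem_unitBall.1 ha
  have ha2 := sub_pos.2 ha1
  set J := ∫⁻ η : unitSphere n,
      ENNReal.ofReal ((‖1 - inner ℂ a (η : Cn n)‖ ^ 2)⁻¹ ^ (n + 1)) ∂(sphereMeasure n) with hJ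
  set f : Cn n → ℝ≥0∞ := fun z => ENNReal.ofReal ((‖1 - inner ℂ a z‖ ^ 2)⁻¹ ^ (n + 1)) with hf
  have mf : Measurable f := by
    have : Measurable fun z : Cn n => inner ℂ a z := (innerSL ℂ a).continuous.measurable
    fun_prop
  have hpol := lintegral_polar hn mf
  have h1 : ∀ ρ ∈ Set.Ioo ((1 + ‖a‖) / 2) 1, ENNReal.ofReal K⁻¹ * (2 * J) ≤
      ENNReal.ofReal (ρ ^ (2 * n - 1)) * ∫⁻ η, f (ρ • (η : Cn n)) ∂(sphereMeasure n) := by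
    intro ρ hρ
    have hρ0 : 1 / 2 ≤ ρ := by linarith [hρ.1, norm_nonneg a]
    have e : ENNReal.ofReal K⁻¹ * 2 ≤ ENNReal.ofReal (ρ ^ (2 * n - 1)) *
        ENNReal.ofReal ((4 / 9) ^ (n + 1)) := by
      rw [show (2 : ℝ≥0∞) = ENNReal.ofReal 2 by simp, ← ENNReal.ofReal_mul (by positivity),
        ← ENNReal.ofReal_mul (by positivity)]
      refine ENNReal.ofReal_le_ofReal ?_
      calc K⁻¹ * 2 = (1 / 2) ^ (2 * n - 1) * (4 / 9) ^ (n + 1) := by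
            rw [hK, show (4 / 9 : ℝ) = (9 / 4)⁻¹ by norm_num, inv_pow, one_div, inv_pow]
            field_simp
        _ ≤ _ := by gcongr
    rw [← mul_assoc]
    refine (mul_le_mul_left e J).trans ?_
    rw [mul_assoc, hJ, ← lintegral_const_mul' _ _ ENNReal.ofReal_ne_top]
    gcongr with η
    rw [← ENNReal.ofReal_mul (by positivity)]
    refine ENNReal.ofReal_le_ofReal ?_
    rw [← mul_pow]
    have hη : ‖(η : Cn n)‖ = 1 := norm_eq_of_mem_sphere η
    have b1 := one_sub_norm_le (a := a) hη.le
    -- The displacement is at most 1 - ρ ≤ (1 - ‖a‖)/2, hence at most half of |1 - ⟨η,a⟩|.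
    have b2 : ‖1 - inner ℂ a (ρ • (η : Cn n))‖ ≤ 3 / 2 * ‖1 - inner ℂ a (η : Cn n)‖ := by
      have e2 : 1 - inner ℂ a (ρ • (η : Cn n)) =
          (1 - inner ℂ a (η : Cn n)) + ((1 - ρ : ℝ) : ℂ) * inner ℂ a (η : Cn n) := by
        rw [inner_smul_right_eq_smul, Complex.real_smul]; push_cast; ring
      rw [e2]
      refine (norm_add_le _ _).trans ?_
      rw [norm_mul, Complex.norm_real, Real.norm_of_nonneg (by linarith [hρ.2])]
      have b3 := norm_inner_le_of_mem (a := a) hη.le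
      nlinarith [hρ.1, hρ.2, norm_nonneg (inner ℂ a (η : Cn n))]
    have hηρ : ‖ρ • (η : Cn n)‖ ≤ 1 := by
      rw [norm_smul_sphere, abs_of_pos (by linarith)]; exact hρ.2.le
    have b4 := one_sub_norm_le (a := a) hηρ
    have b5 : 0 < ‖1 - inner ℂ a (ρ • (η : Cn n))‖ := by linarith
    have b6 : 0 < ‖1 - inner ℂ a (η : Cn n)‖ := by linarith
    have b7 : (4 / 9 : ℝ) * (‖1 - inner ℂ a (η : Cn n)‖ ^ 2)⁻¹ ≤
        (‖1 - inner ℂ a (ρ • (η : Cn n))‖ ^ 2)⁻¹ := by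
      rw [show (4 / 9 : ℝ) * (‖1 - inner ℂ a (η : Cn n)‖ ^ 2)⁻¹ =
        ((3 / 2 * ‖1 - inner ℂ a (η : Cn n)‖) ^ 2)⁻¹ by field_simp; norm_num]
      gcongr
    gcongr
  have h2 : ENNReal.ofReal ((1 - ‖a‖) / 2) * (ENNReal.ofReal K⁻¹ * (2 * J)) ≤
      ∫⁻ ρ in Set.Ioo (0 : ℝ) 1, ENNReal.ofReal (ρ ^ (2 * n - 1)) *
        ∫⁻ η, f (ρ • (η : Cn n)) ∂(sphereMeasure n) := by
    calc ENNReal.ofReal ((1 - ‖a‖) / 2) * (ENNReal.ofReal K⁻¹ * (2 * J))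
        = ∫⁻ ρ in Set.Ioo ((1 + ‖a‖) / 2) 1, ENNReal.ofReal K⁻¹ * (2 * J) := by
          rw [setLIntegral_const, Real.volume_Ioo, mul_comm]
          congr 2; ring
      _ ≤ ∫⁻ ρ in Set.Ioo ((1 + ‖a‖) / 2) 1, ENNReal.ofReal (ρ ^ (2 * n - 1)) *
        ∫⁻ η, f (ρ • (η : Cn n)) ∂(sphereMeasure n) := setLIntegral_mono' measurableSet_Ioo h1
      _ ≤ _ := lintegral_mono_set (Set.Ioo_subset_Ioo_left (by positivity))
  have h3 := solid a ha
  change _ * ∫⁻ z in unitBall n, f z ≤ V at h3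
  rw [hpol] at h3
  change _ * (ENNReal.ofReal (sphereConst n) * _) ≤ V at h3
  have hK0 : 0 < K := by positivity
  have h4 : ENNReal.ofReal (sphereConst n) * (ENNReal.ofReal K⁻¹ *
      (ENNReal.ofReal ((1 - ‖a‖) ^ (n + 2)) * J)) ≤ V := by
    refine le_trans (le_of_eq ?_) ((mul_le_mul_right (mul_le_mul_right h2 _) _).trans h3)
    have : ENNReal.ofReal ((1 - ‖a‖) ^ (n + 2)) = ENNReal.ofReal ((1 - ‖a‖) ^ (n + 1)) *
        (ENNReal.ofReal ((1 - ‖a‖) / 2) * 2) := by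
      have h2' : (2 : ℝ≥0∞) = ENNReal.ofReal (2 : ℝ) := by simp
      calc ENNReal.ofReal ((1 - ‖a‖) ^ (n + 2))
          = ENNReal.ofReal ((1 - ‖a‖) ^ (n + 1) * ((1 - ‖a‖) / 2 * 2)) := by congr 1; ring
        _ = _ := by rw [ENNReal.ofReal_mul (by positivity), ENNReal.ofReal_mul (by positivity), ← h2']
    rw [this]; ring
  rw [ENNReal.ofReal_inv_of_pos hK0] at h4
  have c1 : ENNReal.ofReal K ≠ 0 := by simpa using hK0
  have c2 : ENNReal.ofReal (sphereConst n) ≠ 0 := by simpa using hS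
  calc ENNReal.ofReal ((1 - ‖a‖) ^ (n + 2)) * J
      = ENNReal.ofReal K * (ENNReal.ofReal (sphereConst n))⁻¹ * (ENNReal.ofReal (sphereConst n) *
        ((ENNReal.ofReal K)⁻¹ * (ENNReal.ofReal ((1 - ‖a‖) ^ (n + 2)) * J))) := by
        rw [show ∀ A B C D E : ℝ≥0∞, A * B * (C * (D * E)) = (A * D) * (B * C) * E by
          intros; ring, ENNReal.mul_inv_cancel c1 ENNReal.ofReal_ne_top,
          ENNReal.inv_mul_cancel c2 ENNReal.ofReal_ne_top]; simp
    _ ≤ _ := by gcongr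

/-- A partial sum of the power of a reproducing kernel. -/
def kernelSum (a : Cn n) (N : ℕ) (z : Cn n) : ℂ := (∑ k ∈ Finset.range N, inner ℂ a z ^ k) ^ (n + 1)

lemma contDiff_kernelSum (a : Cn n) (N : ℕ) : ContDiff ℂ 2 (kernelSum a N) := by
  have : ContDiff ℂ 2 fun z : Cn n => inner ℂ a z := (innerSL ℂ a).contDiff
  exact (ContDiff.sum fun k _ => this.pow k).pow (n + 1)

lemma tendsto_kernelSum {a z : Cn n} (ha : a ∈ unitBall n) (hz : ‖z‖ ≤ 1) :
    Tendsto (fun N => ‖kernelSum a N z‖ₑ ^ 2) atTop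
      (𝓝 (ENNReal.ofReal ((‖1 - inner ℂ a z‖ ^ 2)⁻¹ ^ (n + 1)))) := by
  have h1 : ‖inner ℂ a z‖ < 1 := (norm_inner_le_of_mem hz).trans_lt (mem_unitBall.1 ha)
  have h2 := ((hasSum_geometric_of_norm_lt_one h1).tendsto_sum_nat.pow (n + 1))
  have h3 := ((ENNReal.continuous_pow 2).tendsto _).comp h2.enorm
  have e : ENNReal.ofReal ((‖1 - inner ℂ a z‖ ^ 2)⁻¹ ^ (n + 1)) =
      ‖(1 - inner ℂ a z)⁻¹ ^ (n + 1)‖ₑ ^ 2 := by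
    rw [← ofReal_norm, ← ENNReal.ofReal_pow (norm_nonneg _), norm_pow, norm_inv, ← pow_mul,
      ← inv_pow, ← pow_mul, mul_comm]
  rw [e]
  exact h3

/-- The kernel (1 - ⟨z,a⟩)^{-(n+1)} is not entire for a ≠ 0, so its partial sums serve as test
functions. On the sphere they are dominated by (1 - ‖a‖)^{-(n+1)}. -/
lemma tendsto_lintegral_kernelSum (hn : 1 ≤ n) {a : Cn n} (ha : a ∈ unitBall n) :
    Tendsto (fun N => ∫⁻ η : unitSphere n, ‖kernelSum a N η‖ₑ ^ 2 ∂(sphereMeasure n)) atTop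
      (𝓝 (∫⁻ η : unitSphere n,
        ENNReal.ofReal ((‖1 - inner ℂ a (η : Cn n)‖ ^ 2)⁻¹ ^ (n + 1)) ∂(sphereMeasure n))) := by
  have := isProbabilityMeasure_sphereMeasure hn
  have ha1 := mem_unitBall.1 ha
  refine tendsto_lintegral_of_dominated_convergence
    (fun _ => ENNReal.ofReal (((1 - ‖a‖)⁻¹ ^ (n + 1)) ^ 2)) (fun N => ?_) (fun N => ?_) ?_ ?_
  · exact (((contDiff_kernelSum a N).continuous.comp
      continuous_subtype_val).enorm.measurable.pow_const 2)
  · refine ae_of_all _ fun η => ?_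
    dsimp only
    rw [← ofReal_norm, ← ENNReal.ofReal_pow (norm_nonneg _), kernelSum, norm_pow]
    refine ENNReal.ofReal_le_ofReal ?_
    gcongr
    refine (norm_sum_le _ _).trans ?_
    have hη : ‖(η : Cn n)‖ = 1 := norm_eq_of_mem_sphere η
    calc ∑ k ∈ Finset.range N, ‖inner ℂ a (η : Cn n) ^ k‖
        ≤ ∑ k ∈ Finset.range N, ‖a‖ ^ k := by
          refine Finset.sum_le_sum fun k _ => ?_
          rw [norm_pow]
          exact pow_le_pow_left₀ (norm_nonneg _) (norm_inner_le_of_mem hη.le) k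
      _ ≤ (1 - ‖a‖)⁻¹ := by
          rw [← tsum_geometric_of_lt_one (norm_nonneg a) ha1]
          exact (summable_geometric_of_lt_one (norm_nonneg a) ha1).sum_le_tsum _
            fun k _ => by positivity
  · simp
  · exact ae_of_all _ fun η => tendsto_kernelSum ha (norm_eq_of_mem_sphere η).le

/-- A measure for which the embedding is contractive on entire functions is a Carleson measure. -/
theorem isCarlesonMeasure_of_le (hn : 1 ≤ n) {ν : Measure (Cn n)} (hν : ν (unitBall n)ᶜ = 0)
    (H : ∀ F : Cn n → ℂ, ContDiff ℂ 2 F →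
      ∫⁻ z, ‖F z‖ₑ ^ 2 ∂ν ≤ ∫⁻ ξ : unitSphere n, ‖F ξ‖ₑ ^ 2 ∂(sphereMeasure n)) :
    IsCarlesonMeasure ν := by
  have := isProbabilityMeasure_sphereMeasure hn
  refine ⟨hν, ?_⟩
  have hνae : ∀ᵐ z ∂ν, z ∈ unitBall n := by rw [ae_iff]; exact hν
  have hmass : ν Set.univ ≤ 1 := by simpa using H (fun _ => 1) contDiff_const
  obtain ⟨C, hC⟩ := lintegral_sphere_kernel_le (n := n) hn
  refine ⟨max 1 (4 ^ (n + 1) * C), fun ξ hξ r hr => ?_⟩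
  set E : Set (Cn n) := {z | z ∈ unitBall n ∧ ‖1 - inner ℂ ξ z‖ < r} with hE
  have hξ1 : ‖ξ‖ = 1 := by simpa using hξ
  rcases le_or_gt 1 r with h1 | h1
  · calc ν E ≤ ν Set.univ := measure_mono (Set.subset_univ _)
      _ ≤ 1 * 1 := by rw [one_mul]; exact hmass
      _ ≤ _ := by
        gcongr
        · rw [← ENNReal.coe_one, ENNReal.coe_le_coe]; exact le_max_left _ _
        · rw [← ENNReal.ofReal_one]; exact ENNReal.ofReal_le_ofReal (one_le_pow₀ h1)
  -- On the region E this choice gives |1 - ⟨z,a⟩| ≤ |1 - ⟨z,ξ⟩| + r|⟨z,ξ⟩| ≤ 2r, so the kernel is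
  -- large there.
  set a : Cn n := (1 - r) • ξ with ha
  have hna : ‖a‖ = 1 - r := by rw [ha, norm_smul, hξ1, mul_one, Real.norm_of_nonneg (by linarith)]
  have hab : a ∈ unitBall n := by rw [mem_unitBall, hna]; linarith
  have mE : MeasurableSet E := by
    have : Continuous fun z : Cn n => inner ℂ ξ z := (innerSL ℂ ξ).continuous
    have h2 : IsOpen {z : Cn n | ‖1 - inner ℂ ξ z‖ < r} := isOpen_lt (by fun_prop) continuous_const
    exact (isOpen_unitBall.inter h2).measurableSet
  have h2 : ENNReal.ofReal (((2 * r) ^ 2)⁻¹ ^ (n + 1)) * ν E ≤ ∫⁻ η : unitSphere n,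
      ENNReal.ofReal ((‖1 - inner ℂ a (η : Cn n)‖ ^ 2)⁻¹ ^ (n + 1)) ∂(sphereMeasure n) := by
    rw [← setLIntegral_const, ← (tendsto_lintegral_kernelSum hn hab).liminf_eq]
    refine le_trans ?_ (liminf_le_liminf (Eventually.of_forall fun N => H _ (contDiff_kernelSum a N)))
    refine le_trans ?_ (lintegral_liminf_le' fun N =>
      ((contDiff_kernelSum a N).continuous.enorm.measurable.pow_const 2).aemeasurable)
    refine le_trans (setLIntegral_mono' mE fun z hz => ?_) (setLIntegral_le_lintegral E _)
    have hz1 := (mem_unitBall.1 hz.1).le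
    rw [(tendsto_kernelSum hab hz1).liminf_eq]
    refine ENNReal.ofReal_le_ofReal ?_
    have b1 : ‖1 - inner ℂ a z‖ ≤ 2 * r := by
      have e2 : 1 - inner ℂ a z = (1 - inner ℂ ξ z) + (r : ℂ) * inner ℂ ξ z := by
        rw [ha, inner_smul_left_eq_smul, Complex.real_smul]; push_cast; ring
      rw [e2]
      refine (norm_add_le _ _).trans ?_
      rw [norm_mul, Complex.norm_real, Real.norm_of_nonneg hr.le]
      have := norm_inner_le_of_mem (a := ξ) hz1
      have := hz.2
      nlinarith
    have b2 := one_sub_norm_le (a := a) hz1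
    have b3 : 0 < ‖1 - inner ℂ a z‖ := by rw [hna] at b2; linarith
    gcongr
  have h3 := hC a hab
  rw [hna, sub_sub_cancel] at h3
  have h4 : ENNReal.ofReal (r ^ (n + 2)) * (ENNReal.ofReal (((2 * r) ^ 2)⁻¹ ^ (n + 1)) * ν E) ≤ C :=
    (mul_le_mul_right h2 _).trans h3
  rw [← mul_assoc, ← ENNReal.ofReal_mul (by positivity)] at h4
  -- The exponents match: r^{n+2}(2r)^{-2(n+1)} = 4^{-(n+1)} r^{-n}.
  have e : ENNReal.ofReal (4 ^ (n + 1) * r ^ n) *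
      ENNReal.ofReal (r ^ (n + 2) * ((2 * r) ^ 2)⁻¹ ^ (n + 1)) = 1 := by
    rw [← ENNReal.ofReal_mul (by positivity), ← ENNReal.ofReal_one]
    congr 1
    rw [inv_pow, mul_pow, show (2 : ℝ) ^ 2 = 4 by norm_num, mul_pow, ← pow_mul]
    field_simp
    ring
  calc ν E = ENNReal.ofReal (4 ^ (n + 1) * r ^ n) *
      (ENNReal.ofReal (r ^ (n + 2) * ((2 * r) ^ 2)⁻¹ ^ (n + 1)) * ν E) := by
        rw [← mul_assoc, e, one_mul]
    _ ≤ ENNReal.ofReal (4 ^ (n + 1) * r ^ n) * C := by gcongr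
    _ = ((4 ^ (n + 1) * C : ℝ≥0) : ℝ≥0∞) * ENNReal.ofReal (r ^ n) := by
        rw [ENNReal.ofReal_mul (by positivity), ENNReal.ofReal_pow (by norm_num)]
        push_cast
        rw [show ENNReal.ofReal 4 = 4 by simp]; ring
    _ ≤ _ := by gcongr; exact le_max_right _ _

end carleson

/-! ### Mean inequalities for -φ and local integrability -/

section superMean

open Classical in
/-- The function `-φ` on the ball, and zero outside of the ball. -/
def negPart (φ : Cn n → EReal) (z : Cn n) : ℝ≥0∞ :=
  if z ∈ unitBall n then (-φ z).toENNReal else 0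

variable {φ : Cn n → EReal} {a z : Cn n}

lemma measurableSet_lt_of_usc (h : UpperSemicontinuousOn φ (unitBall n)) (y : EReal) :
    MeasurableSet {z | z ∈ unitBall n ∧ φ z < y} := by
  obtain ⟨u, hu, hu2⟩ := upperSemicontinuousOn_iff_preimage_Iio.1 h y
  have : {z | z ∈ unitBall n ∧ φ z < y} = unitBall n ∩ φ ⁻¹' Set.Iio y := rfl
  rw [this, hu2]
  exact (isOpen_unitBall.inter hu).measurableSet

lemma aemeasurable_of_usc (h : UpperSemicontinuousOn φ (unitBall n)) {μ : Measure (Cn n)}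
    (hμ : ∀ᵐ z ∂μ, z ∈ unitBall n) : AEMeasurable φ μ := by
  classical
  -- With the value ⊤ off the ball, strict sublevel sets stay inside the ball, where semicontinuity
  -- applies.
  refine ⟨fun z => if z ∈ unitBall n then φ z else ⊤, measurable_of_Iio fun y => ?_, ?_⟩
  · convert measurableSet_lt_of_usc h y using 1
    ext z
    by_cases hz : ‖z‖ < 1 <;> simp [hz]
  · filter_upwards [hμ] with z hz
    rw [if_pos hz]

lemma negPart_eq (hz : z ∈ unitBall n) : negPart φ z = (-φ z).toENNReal := if_pos hz

lemma measurable_negPart (h : UpperSemicontinuousOn φ (unitBall n)) : Measurable (negPart φ) := by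
  refine measurable_of_Ioi fun y => ?_
  have : negPart φ ⁻¹' Set.Ioi y = {z | z ∈ unitBall n ∧ φ z < -(y : EReal)} := by
    ext z
    by_cases hz : z ∈ unitBall n
    · simp only [Set.mem_preimage, negPart_eq hz, Set.mem_Ioi, Set.mem_ofPred_eq, hz, true_and]
      rw [EReal.lt_neg_comm, ← EReal.coe_ennreal_lt_coe_ennreal_iff, EReal.coe_toENNReal_eq_max, lt_max_iff]
      exact or_iff_right fun h => absurd h (not_lt.2 (EReal.coe_ennreal_nonneg y))
    · rw [mem_unitBall] at hz
      simp [negPart, hz]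
  rw [this]
  exact measurableSet_lt_of_usc h _

lemma measurable_bx (a : Cn n) : Measurable (bx a) := by
  have : Measurable fun z : Cn n => inner ℂ a z := (innerSL ℂ a).continuous.measurable
  unfold bx
  fun_prop

/-- As φ ≤ 0, the positive part contributes nothing and the extended integral is minus a Lebesgue
integral; no difference of infinities arises. -/
lemma lintegral_negPart_ballAut_le (hφ : InvSubharmonic φ) (h0 : ∀ z ∈ unitBall n, φ z ≤ 0)
    (ha : a ∈ unitBall n) {r : ℝ} (hr0 : 0 < r) (hr1 : r < 1) :
    ∫⁻ ξ, negPart φ (ballAut a (r • (ξ : Cn n))) ∂(sphereMeasure n) ≤ negPart φ a := by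
  have h := hφ.sub_mean a ha r hr0 hr1
  have hb : ∀ ξ : unitSphere n, ballAut a ((r : ℂ) • (ξ : Cn n)) ∈ unitBall n := fun ξ => by
    refine ballAut_mem ha (mem_unitBall.2 ?_)
    have := norm_smul_sphere r ξ
    rw [norm_smul, norm_eq_of_mem_sphere ξ]; simpa [abs_of_pos hr0] using hr1
  have e1 : ∀ ξ : unitSphere n, (φ (ballAut a ((r : ℂ) • (ξ : Cn n)))).toENNReal = 0 := fun ξ =>
    EReal.toENNReal_of_nonpos (h0 _ (hb ξ))
  have e2 : ∀ ξ : unitSphere n, (-φ (ballAut a ((r : ℂ) • (ξ : Cn n)))).toENNReal =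
      negPart φ (ballAut a (r • (ξ : Cn n))) := fun ξ => by
    rw [← negPart_eq (hb ξ)]; rfl
  simp only [erealIntegral, e1, e2, lintegral_zero, EReal.coe_ennreal_zero, zero_sub] at h
  rw [negPart_eq ha, ← EReal.toENNReal_coe (x := ∫⁻ ξ, negPart φ (ballAut a (r • (ξ : Cn n)))
    ∂(sphereMeasure n))]
  exact EReal.toENNReal_le_toENNReal (EReal.le_neg_of_le_neg h)

/-- Invariant means of a negative invariant subharmonic function with respect to a radial weight. -/
theorem lintegral_negPart_mul_le (hn : 1 ≤ n) (hφ : InvSubharmonic φ) (h0 : ∀ z ∈ unitBall n, φ z ≤ 0)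
    (ha : a ∈ unitBall n) {β : ℝ → ℝ≥0∞} (hβ : Measurable β) :
    ∫⁻ z, β (bx a z) * negPart φ z ∂(invVolume n) ≤
      (∫⁻ w : Cn n, β (‖w‖ ^ 2) ∂(invVolume n)) * negPart φ a := by
  have := isProbabilityMeasure_sphereMeasure hn
  have mP := measurable_negPart hφ.usc
  have mb := measurable_bx a
  have mA := measurable_ballAut ha
  -- Moving the pole to the origin makes the weight radial; polar coordinates then reduce the claim
  -- to the means over invariant spheres.
  rw [← lintegral_invVolume_ballAut ha (by fun_prop)]
  have e : ∫⁻ z, β (bx a (ballAut a z)) * negPart φ (ballAut a z) ∂(invVolume n) =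
      ∫⁻ z : Cn n, β (‖z‖ ^ 2) * negPart φ (ballAut a z) ∂(invVolume n) := by
    refine lintegral_congr_ae ?_
    filter_upwards [ae_invVolume_mem] with z hz
    rw [bx_ballAut ha hz]
  rw [e, lintegral_invVolume_polar hn (by fun_prop), lintegral_invVolume_polar hn (by fun_prop)]
  generalize ENNReal.ofReal (2 * n * (Real.pi ^ n / n.factorial)) = c
  rw [mul_assoc, ← lintegral_mul_const]
  · gcongr _ * ?_
    refine setLIntegral_mono' measurableSet_Ioo fun r hr => ?_
    simp only [norm_smul_sphere, sq_abs]
    rw [lintegral_const_mul, lintegral_const, measure_univ, mul_one, ← mul_assoc]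
    · gcongr
      exact lintegral_negPart_ballAut_le hφ h0 ha hr.1 hr.2
    · fun_prop
  · simp only [norm_smul_sphere, sq_abs]
    fun_prop

lemma exists_bx_le {K : Set (Cn n)} (hK : IsCompact K) (hs : K ⊆ unitBall n) (ha : a ∈ unitBall n) :
    ∃ R < 1, ∀ z ∈ K, bx a z ≤ R := by
  rcases K.eq_empty_or_nonempty with rfl | hne
  · exact ⟨0, zero_lt_one, by simp⟩
  have hc : ContinuousOn (bx a) K := fun z hz =>
    ((contDiffAt_bx (m := 0) (inner_ne_one ha (mem_unitBall.1 (hs hz)).le)).continuousAt).continuousWithinAt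
  obtain ⟨w, hw, hmax⟩ := hK.exists_isMaxOn hne hc
  exact ⟨bx a w, bx_lt_one ha (hs hw), fun z hz => hmax hz⟩

/-- A negative invariant subharmonic function is locally integrable. -/
theorem setLIntegral_negPart_lt_top (hn : 1 ≤ n) (hφ : InvSubharmonic φ)
    (h0 : ∀ z ∈ unitBall n, φ z ≤ 0) {K : Set (Cn n)} (hK : IsCompact K) (hs : K ⊆ unitBall n) :
    ∫⁻ z in K, negPart φ z ∂(invVolume n) < ⊤ := by
  obtain ⟨a, ha, hab⟩ := hφ.exists_ne_bot
  obtain ⟨R, hR, hKR⟩ := exists_bx_le hK hs ha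
  have hR0 : Real.sqrt R < 1 := by rw [Real.sqrt_lt' one_pos]; simpa using hR
  have hfin : negPart φ a < ⊤ := by
    rw [negPart_eq ha]
    refine lt_top_iff_ne_top.2 fun h => hab ?_
    rw [EReal.toENNReal_eq_top_iff] at h
    simpa using h
  -- The weight is the indicator of an invariant ball that contains K, centred at a point where φ is
  -- finite. Its mass is finite because R < 1.
  set β : ℝ → ℝ≥0∞ := (Set.Iic R).indicator 1 with hβ
  have mβ : Measurable β := measurable_one.indicator measurableSet_Iic
  have h1 := lintegral_negPart_mul_le hn hφ h0 ha mβ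
  refine lt_of_le_of_lt ?_ (h1.trans_lt (ENNReal.mul_lt_top ?_ hfin))
  · rw [← lintegral_indicator hK.measurableSet]
    refine lintegral_mono fun z => ?_
    by_cases hz : z ∈ K
    · rw [Set.indicator_of_mem hz, hβ, Set.indicator_of_mem (show bx a z ∈ Set.Iic R from hKR z hz)]; simp
    · rw [Set.indicator_of_notMem hz]; exact zero_le
  · refine lt_of_le_of_lt ?_ (invVolume_lt_top_of_isCompact
      (isCompact_closedBall (0 : Cn n) (Real.sqrt R)) (closedBall_subset_unitBall hR0))
    rw [← lintegral_indicator_one Metric.isClosed_closedBall.measurableSet]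
    refine lintegral_mono fun z => ?_
    by_cases hz : ‖z‖ ^ 2 ≤ R
    · rw [hβ, Set.indicator_of_mem (show ‖z‖ ^ 2 ∈ Set.Iic R from hz), Set.indicator_of_mem]; simp
      rw [mem_closedBall_zero_iff]
      exact Real.le_sqrt_of_sq_le hz
    · rw [hβ, Set.indicator_of_notMem (show ‖z‖ ^ 2 ∉ Set.Iic R from hz)]; exact zero_le

lemma exhaustion_subset (k : ℕ) : Metric.closedBall (0 : Cn n) (1 - 1 / ((k : ℝ) + 1)) ⊆ unitBall n :=
  closedBall_subset_unitBall (by have : (0 : ℝ) < 1 / ((k : ℝ) + 1) := by positivity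
                                 linarith)

lemma unitBall_eq_iUnion :
    unitBall n = ⋃ k : ℕ, Metric.closedBall (0 : Cn n) (1 - 1 / ((k : ℝ) + 1)) := by
  refine Set.Subset.antisymm (fun z hz => ?_) (Set.iUnion_subset exhaustion_subset)
  obtain ⟨k, hk⟩ := exists_nat_one_div_lt (sub_pos.2 (mem_unitBall.1 hz))
  refine Set.mem_iUnion.2 ⟨k, ?_⟩
  rw [mem_closedBall_zero_iff]; linarith

lemma ae_negPart_lt_top (hn : 1 ≤ n) (hφ : InvSubharmonic φ) (h0 : ∀ z ∈ unitBall n, φ z ≤ 0) :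
    ∀ᵐ z ∂(invVolume n), negPart φ z < ⊤ := by
  have h : ∀ᵐ z ∂(invVolume n).restrict (unitBall n), negPart φ z < ⊤ := by
    rw [unitBall_eq_iUnion, ae_restrict_iUnion_iff]
    intro k
    exact ae_lt_top (measurable_negPart hφ.usc)
      (setLIntegral_negPart_lt_top hn hφ h0 (isCompact_closedBall _ _) (exhaustion_subset k)).ne
  filter_upwards [(ae_restrict_iff' isOpen_unitBall.measurableSet).1 h, ae_invVolume_mem] with z h1 h2
  exact h1 h2

lemma toReal_eq_neg_negPart (h0 : ∀ z ∈ unitBall n, φ z ≤ 0) (hz : z ∈ unitBall n) :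
    (φ z).toReal = -(negPart φ z).toReal := by
  have := h0 z hz
  rw [negPart_eq hz]
  induction h : φ z with
  | bot => simp
  | top => simp
  | coe x =>
    rw [h] at this
    have hx : x ≤ 0 := by exact_mod_cast this
    rw [← EReal.coe_neg, EReal.toENNReal_of_ne_top (by simp)]
    simp [hx]

lemma integrableOn_negPart (hn : 1 ≤ n) (hφ : InvSubharmonic φ) (h0 : ∀ z ∈ unitBall n, φ z ≤ 0)
    {K : Set (Cn n)} (hK : IsCompact K) (hs : K ⊆ unitBall n) :
    IntegrableOn (fun z => (negPart φ z).toReal) K (invVolume n) :=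
  integrable_toReal_of_lintegral_ne_top (measurable_negPart hφ.usc).aemeasurable
    (setLIntegral_negPart_lt_top hn hφ h0 hK hs).ne

end superMean

/-! ### Radial integral operators as approximate identities -/

section kernelOp

/-- Functions that are integrable over the compact subsets of the ball. -/
def BallIntegrable (v : Cn n → ℝ) : Prop :=
  ∀ K : Set (Cn n), IsCompact K → K ⊆ unitBall n → IntegrableOn v K (invVolume n)

/-- The invariant integral operator with radial kernel `k`. -/
def kernelOp (k : ℝ → ℝ) (h : Cn n → ℝ) (a : Cn n) : ℝ := ∫ z, k (bx a z) * h z ∂(invVolume n)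

variable {a z : Cn n} {k : ℝ → ℝ} {R ρ : ℝ} {v h : Cn n → ℝ}

instance : SFinite (invVolume n) := by unfold invVolume; infer_instance

lemma measurable_bx_uncurry : Measurable fun p : Cn n × Cn n => bx p.1 p.2 := by
  have : Measurable fun p : Cn n × Cn n => inner ℂ p.1 p.2 :=
    (continuous_fst.inner continuous_snd).measurable
  unfold bx
  fun_prop

lemma eq_zero_off_closedBall (h0 : ∀ z, ρ < ‖z‖ → h z = 0) {z : Cn n}
    (hz : z ∉ Metric.closedBall (0 : Cn n) ρ) : h z = 0 := h0 z (by simpa using hz)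

lemma BallIntegrable.integrable_mul (hv : BallIntegrable v) (hh : ContinuousOn h (unitBall n)) (hρ : ρ < 1)
    (h0 : ∀ z, ρ < ‖z‖ → h z = 0) : Integrable (fun z => v z * h z) (invVolume n) := by
  have hs := closedBall_subset_unitBall (n := n) hρ
  rw [← integrableOn_iff_integrable_of_support_subset (s := Metric.closedBall (0 : Cn n) ρ)]
  · exact (hv _ (isCompact_closedBall _ _) hs).mul_continuousOn (hh.mono hs) (isCompact_closedBall _ _)
  · intro z hz
    by_contra hc
    exact hz (by simp [eq_zero_off_closedBall h0 hc])

lemma integrable_of_test (hh : ContinuousOn h (unitBall n)) (hρ : ρ < 1) (h0 : ∀ z, ρ < ‖z‖ → h z = 0) :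
    Integrable h (invVolume n) := by
  have hs := closedBall_subset_unitBall (n := n) hρ
  exact integrable_of_continuousOn_zero_off (isCompact_closedBall (0 : Cn n) ρ)
    (invVolume_lt_top_of_isCompact (isCompact_closedBall _ _) hs) (hh.mono hs)
    fun z hz => eq_zero_off_closedBall h0 hz

lemma exists_kernel_bound (hk : Continuous k) :
    ∃ M : ℝ, ∀ a ∈ unitBall n, ∀ z ∈ unitBall n, ‖k (bx a z)‖ ≤ M := by
  obtain ⟨M, hM⟩ := (isCompact_Icc (a := (0 : ℝ)) (b := 1)).exists_bound_of_continuousOn hk.continuousOn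
  exact ⟨M, fun a ha z hz => hM _ ⟨bx_nonneg ha hz, (bx_lt_one ha hz).le⟩⟩

lemma ae_prod_mem_ball : ∀ᵐ p ∂((invVolume n).prod (invVolume n)),
    p.1 ∈ unitBall n ∧ p.2 ∈ unitBall n :=
  (Measure.quasiMeasurePreserving_fst.ae ae_invVolume_mem).and
    (Measure.quasiMeasurePreserving_snd.ae ae_invVolume_mem)

/-- The support of h confines the second variable, and the kernel then confines the first to a
compact set, where v is integrable. -/
lemma integrable_prod_kernel (hv : BallIntegrable v) (hk : Continuous k) (hR : R < 1)
    (hk0 : ∀ x, R ≤ x → k x = 0) (hh : ContinuousOn h (unitBall n)) (hρ : ρ < 1)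
    (h0 : ∀ z, ρ < ‖z‖ → h z = 0) :
    Integrable (fun p : Cn n × Cn n => v p.1 * (k (bx p.1 p.2) * h p.2))
      ((invVolume n).prod (invVolume n)) := by
  obtain ⟨M, hM⟩ := exists_kernel_bound (n := n) hk
  set K := Metric.closedBall (0 : Cn n) (suppRadius R ρ) with hK
  have hv' : Integrable (K.indicator v) (invVolume n) :=
    (integrable_indicator_iff Metric.isClosed_closedBall.measurableSet).2
      (hv K (isCompact_closedBall _ _) (closedBall_subset_unitBall (suppRadius_lt_one hR hρ)))
  have h1 := (hv'.mul_prod (integrable_of_test hh hρ h0)).bdd_mul (c := M)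
    (f := fun p : Cn n × Cn n => k (bx p.1 p.2))
    (hk.measurable.comp measurable_bx_uncurry).aestronglyMeasurable
    (by filter_upwards [ae_prod_mem_ball] with p hp; exact hM _ hp.1 _ hp.2)
  refine h1.congr (ae_of_all _ fun p => ?_)
  dsimp only
  by_cases hp1 : p.1 ∈ K
  · rw [Set.indicator_of_mem hp1]; ring
  · rw [Set.indicator_of_notMem hp1]
    rcases le_or_gt ‖p.2‖ ρ with h2 | h2
    · rw [bx_comm, kernel_eq_zero hρ h2 hR.le hk0 hp1]; ring
    · rw [h0 _ h2]; ring

/-- Fubini's theorem and the symmetry of the kernel. -/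
lemma integral_mul_kernelOp (hv : BallIntegrable v) (hk : Continuous k) (hR : R < 1)
    (hk0 : ∀ x, R ≤ x → k x = 0) (hh : ContinuousOn h (unitBall n)) (hρ : ρ < 1)
    (h0 : ∀ z, ρ < ‖z‖ → h z = 0) :
    ∫ a, v a * kernelOp k h a ∂(invVolume n) = ∫ z, h z * kernelOp k v z ∂(invVolume n) := by
  have := integral_integral_swap (μ := invVolume n) (ν := invVolume n)
    (f := fun a z => v a * (k (bx a z) * h z)) (integrable_prod_kernel hv hk hR hk0 hh hρ h0)
  simp only [integral_const_mul] at this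
  refine this.trans (integral_congr_ae (ae_of_all _ fun z => ?_))
  dsimp only
  rw [kernelOp, ← integral_const_mul]
  refine integral_congr_ae (ae_of_all _ fun a => ?_)
  dsimp only
  rw [bx_comm]; ring

lemma integrable_mul_kernelOp (hv : BallIntegrable v) (hk : Continuous k) (hR : R < 1)
    (hk0 : ∀ x, R ≤ x → k x = 0) (hh : ContinuousOn h (unitBall n)) (hρ : ρ < 1)
    (h0 : ∀ z, ρ < ‖z‖ → h z = 0) :
    Integrable (fun a => v a * kernelOp k h a) (invVolume n) := by
  have := (integrable_prod_kernel hv hk hR hk0 hh hρ h0).integral_prod_left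
  simp only [integral_const_mul] at this
  exact this

lemma lintegral_kernel (ha : a ∈ unitBall n) (hk : Continuous k) :
    ∫⁻ z, ENNReal.ofReal (k (bx a z)) ∂(invVolume n) =
      ∫⁻ w : Cn n, ENNReal.ofReal (k (‖w‖ ^ 2)) ∂(invVolume n) := by
  have mb := measurable_bx a
  have mk := hk.measurable
  rw [← lintegral_invVolume_ballAut ha (by fun_prop)]
  refine lintegral_congr_ae ?_
  filter_upwards [ae_invVolume_mem] with z hz
  rw [bx_ballAut ha hz]

lemma kernel_test (ha : a ∈ unitBall n) (hk : Continuous k) (hR : R < 1) (hk0 : ∀ x, R ≤ x → k x = 0) :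
    Continuous (fun z => k (bx a z)) ∧ ∀ z, suppRadius R ‖a‖ < ‖z‖ → k (bx a z) = 0 :=
  ⟨(contDiff_kernel_right (contDiff_zero.2 hk) hR.le hk0 ha).continuous, fun z hz =>
    kernel_eq_zero (mem_unitBall.1 ha) le_rfl hR.le hk0 (by simpa using hz)⟩

lemma integral_kernel (ha : a ∈ unitBall n) (hk : Continuous k) (hR : R < 1)
    (hk0 : ∀ x, R ≤ x → k x = 0) (hpos : ∀ x, 0 ≤ x → x ≤ 1 → 0 ≤ k x) :
    ∫ z, k (bx a z) ∂(invVolume n) =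
      (∫⁻ w : Cn n, ENNReal.ofReal (k (‖w‖ ^ 2)) ∂(invVolume n)).toReal := by
  rw [← lintegral_kernel ha hk, integral_eq_lintegral_of_nonneg_ae]
  · filter_upwards [ae_invVolume_mem] with z hz
    exact hpos _ (bx_nonneg ha hz) (bx_lt_one ha hz).le
  · exact (kernel_test ha hk hR hk0).1.aestronglyMeasurable

/-- The kernels with small support are approximate identities. -/
lemma abs_kernelOp_sub_le (ha : a ∈ unitBall n) (hk : Continuous k) (hR : R < 1)
    (hk0 : ∀ x, R ≤ x → k x = 0) (hpos : ∀ x, 0 ≤ x → x ≤ 1 → 0 ≤ k x)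
    {δ : ℝ} (hδ : ∀ z ∈ unitBall n, bx a z < R → |h z - h a| ≤ δ) (hh : ContinuousOn h (unitBall n)) :
    |kernelOp k h a - (∫⁻ w : Cn n, ENNReal.ofReal (k (‖w‖ ^ 2)) ∂(invVolume n)).toReal * h a| ≤
      δ * (∫⁻ w : Cn n, ENNReal.ofReal (k (‖w‖ ^ 2)) ∂(invVolume n)).toReal := by
  obtain ⟨c1, c2⟩ := kernel_test ha hk hR hk0
  have hr := suppRadius_lt_one hR (mem_unitBall.1 ha)
  have i1 := integrable_of_test c1.continuousOn hr c2
  have i2 : Integrable (fun z => k (bx a z) * h z) (invVolume n) :=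
    integrable_of_test (c1.continuousOn.mul hh) hr fun z hz => by rw [c2 z hz, zero_mul]
  rw [← integral_kernel ha hk hR hk0 hpos, kernelOp, ← integral_mul_const, ← integral_const_mul,
    ← integral_sub i2 (i1.mul_const _)]
  refine (abs_integral_le_integral_abs).trans ?_
  refine integral_mono_ae ((i2.sub (i1.mul_const _)).abs) (i1.const_mul δ) ?_
  filter_upwards [ae_invVolume_mem] with z hz
  have hp := hpos _ (bx_nonneg ha hz) (bx_lt_one ha hz).le
  rcases lt_or_ge (bx a z) R with h1 | h1
  · rw [← mul_sub, abs_mul, abs_of_nonneg hp, mul_comm]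
    gcongr
    exact hδ z hz h1
  · simp [hk0 _ h1]

lemma continuous_of_test (hh : ContinuousOn h (unitBall n)) (hρ : ρ < 1)
    (h0 : ∀ z, ρ < ‖z‖ → h z = 0) : Continuous h := by
  refine continuous_iff_continuousAt.2 fun z => ?_
  rcases lt_or_ge ‖z‖ 1 with hz | hz
  · exact hh.continuousAt (isOpen_unitBall.mem_nhds (mem_unitBall.2 hz))
  · have : h =ᶠ[𝓝 z] fun _ => 0 := by
      filter_upwards [(continuous_norm.tendsto z).eventually (lt_mem_nhds (hρ.trans_le hz))] with w hw
      exact h0 w hw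
    exact continuousAt_const.congr this.symm

/-- Uniform continuity of test functions with respect to the invariant distance. -/
lemma exists_modulus (hh : ContinuousOn h (unitBall n)) (hρ0 : 0 ≤ ρ) (hρ : ρ < 1)
    (h0 : ∀ z, ρ < ‖z‖ → h z = 0) {δ : ℝ} (hδ : 0 < δ) :
    ∃ ε > 0, ∀ a ∈ unitBall n, ∀ z ∈ unitBall n, bx a z < ε → |h z - h a| ≤ δ := by
  have hc := continuous_of_test hh hρ h0
  have hcs : HasCompactSupport h := HasCompactSupport.intro (isCompact_closedBall (0 : Cn n) ρ)
    fun z hz => eq_zero_off_closedBall h0 hz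
  obtain ⟨r, hr, hu⟩ := Metric.uniformContinuous_iff.1
    (hcs.uniformContinuous_of_continuous hc) δ hδ
  have hρ2 : 0 < 1 - ρ ^ 2 := by nlinarith
  -- By `bx_lower` this smallness of bx forces ‖z - a‖ < r. It suffices that one of the two points
  -- has norm at most ρ, since bx is symmetric and h vanishes farther out.
  have key : ∀ a ∈ unitBall n, ∀ z ∈ unitBall n, ‖a‖ ≤ ρ → bx a z < (1 - ρ ^ 2) * r ^ 2 / 4 →
      |h z - h a| ≤ δ := fun a ha z hz hab hb => by
    have h1 := bx_lower ha hz
    have h2 : 1 - ρ ^ 2 ≤ 1 - ‖a‖ ^ 2 := by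
      have := pow_le_pow_left₀ (norm_nonneg a) hab 2
      linarith
    have h3 : (1 - ρ ^ 2) * ‖z - a‖ ^ 2 < (1 - ρ ^ 2) * r ^ 2 := by
      have : (1 - ρ ^ 2) * ‖z - a‖ ^ 2 ≤ (1 - ‖a‖ ^ 2) * ‖z - a‖ ^ 2 := by gcongr
      linarith
    have h4 : ‖z - a‖ < r := lt_of_pow_lt_pow_left₀ 2 hr.le (lt_of_mul_lt_mul_left h3 hρ2.le)
    exact (hu (by rwa [dist_eq_norm])).le
  refine ⟨(1 - ρ ^ 2) * r ^ 2 / 4, by positivity, fun a ha z hz hb => ?_⟩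
  rcases le_or_gt ‖a‖ ρ with h1 | h1
  · exact key a ha z hz h1 hb
  rcases le_or_gt ‖z‖ ρ with h2 | h2
  · rw [abs_sub_comm]
    exact key z hz a ha h2 (by rwa [bx_comm])
  · simp [h0 a h1, h0 z h2, hδ.le]

lemma kernelOp_eq_zero (hρ : ρ < 1) (h0 : ∀ z, ρ < ‖z‖ → h z = 0) (hR : R ≤ 1)
    (hk0 : ∀ x, R ≤ x → k x = 0) (ha : a ∉ Metric.closedBall (0 : Cn n) (suppRadius R ρ)) :
    kernelOp k h a = 0 := by
  rw [kernelOp]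
  refine integral_eq_zero_of_ae (ae_of_all _ fun z => ?_)
  dsimp only
  rcases le_or_gt ‖z‖ ρ with h1 | h1
  · rw [bx_comm, kernel_eq_zero hρ h1 hR hk0 ha]; simp
  · rw [h0 z h1]; simp

lemma le_suppRadius (hR0 : 0 ≤ R) (hρ0 : 0 ≤ ρ) (hρ : ρ < 1) : ρ ≤ suppRadius R ρ := by
  refine Real.le_sqrt_of_sq_le ?_
  nlinarith [mul_nonneg hR0 (sq_nonneg (1 - ρ))]

/-- Integrated form of the approximate identity. -/
lemma abs_integral_kernelOp_sub_le (hv : BallIntegrable v) (hv0 : ∀ z, 0 ≤ v z) (hk : Continuous k)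
    (hR : R ≤ 1 / 2) (hk0 : ∀ x, R ≤ x → k x = 0) (hpos : ∀ x, 0 ≤ x → x ≤ 1 → 0 ≤ k x)
    {δ : ℝ} (hδ : ∀ a ∈ unitBall n, ∀ z ∈ unitBall n, bx a z < R → |h z - h a| ≤ δ)
    (hh : ContinuousOn h (unitBall n)) (hρ0 : 0 ≤ ρ) (hρ : ρ < 1) (h0 : ∀ z, ρ < ‖z‖ → h z = 0) :
    |∫ a, v a * kernelOp k h a ∂(invVolume n) -
      (∫⁻ w : Cn n, ENNReal.ofReal (k (‖w‖ ^ 2)) ∂(invVolume n)).toReal *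
        ∫ a, v a * h a ∂(invVolume n)| ≤
      δ * (∫⁻ w : Cn n, ENNReal.ofReal (k (‖w‖ ^ 2)) ∂(invVolume n)).toReal *
        ∫ a in Metric.closedBall (0 : Cn n) (suppRadius (1 / 2) ρ), v a ∂(invVolume n) := by
  have hR1 : R < 1 := by linarith
  set c := (∫⁻ w : Cn n, ENNReal.ofReal (k (‖w‖ ^ 2)) ∂(invVolume n)).toReal with hc
  set K := Metric.closedBall (0 : Cn n) (suppRadius (1 / 2) ρ) with hK
  have hKs : K ⊆ unitBall n := closedBall_subset_unitBall (suppRadius_lt_one (by norm_num) hρ)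
  have mK : MeasurableSet K := Metric.isClosed_closedBall.measurableSet
  have i1 := integrable_mul_kernelOp hv hk hR1 hk0 hh hρ h0
  have i2 := hv.integrable_mul hh hρ h0
  have i3 : Integrable (K.indicator v) (invVolume n) :=
    (integrable_indicator_iff mK).2 (hv K (isCompact_closedBall _ _) hKs)
  rw [← integral_const_mul, ← integral_sub i1 (i2.const_mul c), ← integral_indicator mK,
    ← integral_const_mul]
  refine (abs_integral_le_integral_abs).trans ?_
  refine integral_mono_ae ((i1.sub (i2.const_mul c)).abs) (i3.const_mul _) ?_
  filter_upwards [ae_invVolume_mem] with a ha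
  rw [show v a * kernelOp k h a - c * (v a * h a) = v a * (kernelOp k h a - c * h a) by ring, abs_mul,
    abs_of_nonneg (hv0 a)]
  by_cases haK : a ∈ K
  · rw [Set.indicator_of_mem haK, mul_comm]
    gcongr
    · exact hv0 a
    · exact abs_kernelOp_sub_le ha hk hR1 hk0 hpos (hδ a ha) hh
  -- The bound R ≤ 1/2 places all supports in one compact set independent of the kernel, which later
  -- allows the kernels to shrink.
  · rw [Set.indicator_of_notMem haK, kernelOp_eq_zero (R := 1 / 2) hρ h0 (by norm_num)
      (fun x hx => hk0 x (hR.trans hx)) haK, h0 a]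
    · simp
    · refine lt_of_le_of_lt (le_suppRadius (R := 1 / 2) (by norm_num) hρ0 hρ) ?_
      simpa [hK] using haK

end kernelOp

/-! ### Potentials whose Laplacian is a difference of two mean kernels -/

section potential

variable {s t : ℝ}

/-- The difference of two cutoff functions. -/
def lamDiff (s t y : ℝ) : ℝ := lam t y - lam s y

lemma lamDiff_contDiff {m : ℕ∞} (s t : ℝ) : ContDiff ℝ m (lamDiff s t) :=
  (lam_contDiff t).sub (lam_contDiff s)

lemma lamDiff_eq_zero_left (hs : 0 < s) (hst : s ≤ t) {y : ℝ} (hy : y ≤ 1 / t) : lamDiff s t y = 0 := by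
  have ht : 0 < t := hs.trans_le hst
  have h1 : y ≤ 1 / s := hy.trans (one_div_le_one_div_of_le hs hst)
  rw [lamDiff, lam_eq_zero (s := t) (by rw [mul_comm]; exact (le_div_iff₀ ht).1 hy),
    lam_eq_zero (s := s) (by rw [mul_comm]; exact (le_div_iff₀ hs).1 h1), sub_zero]

lemma lamDiff_eq_zero_right (hs : 0 < s) (hst : s ≤ t) {y : ℝ} (hy : 2 / s ≤ y) : lamDiff s t y = 0 := by
  have h1 : 2 ≤ s * y := by rw [mul_comm]; exact (div_le_iff₀ hs).1 hy
  have h2 : 0 < y := lt_of_lt_of_le (by positivity) hy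
  rw [lamDiff, lam_eq_one h1, lam_eq_one (h1.trans (by gcongr)), sub_self]

lemma lamDiff_nonneg (hst : s ≤ t) {y : ℝ} (hy : 0 ≤ y) : 0 ≤ lamDiff s t y :=
  sub_nonneg.2 (lam_mono hst hy)

lemma continuous_potDensity_lamDiff (hs : 0 < s) (hst : s ≤ t) :
    Continuous (potDensity n (lamDiff s t)) :=
  (contDiff_potDensity (m := ((0 : ℕ∞) : WithTop ℕ∞)) (lamDiff_contDiff s t) (one_div_pos.2 (hs.trans_le hst))
    fun _ hy => lamDiff_eq_zero_left hs hst hy).continuous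

lemma contDiff_pot_lamDiff (hs : 0 < s) (hst : s ≤ t) :
    ContDiff ℝ ((⊤ : ℕ∞) : WithTop ℕ∞) (pot n (lamDiff s t)) :=
  contDiff_pot (lamDiff_contDiff s t) (one_div_pos.2 (hs.trans_le hst))
    fun _ hy => lamDiff_eq_zero_left hs hst hy

lemma pot_lamDiff_eq_zero (hs : 2 ≤ s) (hst : s ≤ t) (x : ℝ) (hx : 2 / s ≤ x) :
    pot n (lamDiff s t) x = 0 :=
  pot_eq_zero ((div_le_one (by linarith)).2 hs)
    (fun _ hy => lamDiff_eq_zero_right (by linarith) hst hy) hx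

lemma pot_lamDiff_nonneg (hst : s ≤ t) (x : ℝ) (h0 : 0 ≤ x) (h1 : x ≤ 1) :
    0 ≤ pot n (lamDiff s t) x :=
  pot_nonneg (fun _ hy _ => lamDiff_nonneg hst hy) h0 h1

lemma pot_lamDiff_mono {t' : ℝ} (hs : 0 < s) (hst : s ≤ t) (ht : t ≤ t') {x : ℝ} (h0 : 0 ≤ x) (h1 : x ≤ 1) :
    pot n (lamDiff s t) x ≤ pot n (lamDiff s t') x := by
  refine intervalIntegral.integral_mono_on h1
    ((continuous_potDensity_lamDiff hs hst).intervalIntegrable _ _)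
    ((continuous_potDensity_lamDiff hs (hst.trans ht)).intervalIntegrable _ _) fun y hy => ?_
  have hy0 : 0 ≤ y := h0.trans hy.1
  have : 0 ≤ 1 - y := by linarith [hy.2]
  have : lamDiff s t y ≤ lamDiff s t' y := sub_le_sub_right (lam_mono ht hy0) _
  unfold potDensity
  gcongr

/-- The density of the potential is nonnegative and is positive at y = 1/s, where the cutoff with
parameter 2s is already 1 and that with s still 0. -/
lemma pot_lamDiff_pos (hs : 2 ≤ s) {x : ℝ} (h0 : 0 ≤ x) (h1 : x < 1 / s) :
    0 < pot n (lamDiff s (2 * s)) x := by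
  have hs0 : 0 < s := by linarith
  have h2 : 1 / s < 1 := (div_lt_one hs0).2 (by linarith)
  refine intervalIntegral.integral_pos (h1.trans h2)
    (continuous_potDensity_lamDiff hs0 (by linarith)).continuousOn (fun y hy => ?_)
    ⟨1 / s, ⟨h1.le, h2.le⟩, ?_⟩
  · have hy0 : 0 ≤ y := h0.trans hy.1.le
    have : 0 ≤ 1 - y := by linarith [hy.2]
    have := lamDiff_nonneg (s := s) (t := 2 * s) (by linarith) hy0
    unfold potDensity
    positivity
  · have e : lamDiff s (2 * s) (1 / s) = 1 := by
      rw [lamDiff, lam_eq_one (by field_simp; norm_num), lam_eq_zero (by field_simp; norm_num), sub_zero]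
    have : 0 < 1 - 1 / s := by linarith
    rw [potDensity, e]
    positivity

/-- The kernel is linear in the flux. Consequently the Laplacian of this potential compares the
means at the scales s and t. -/
lemma fluxKernel_lamDiff (hn : 1 ≤ n) (s t x : ℝ) :
    fluxKernel n (lamDiff s t) x = sphereConst n / 2 * (kern n t x - kern n s x) := by
  have hC := sphereConst_pos hn
  have d : deriv (lamDiff s t) x = deriv (lam t) x - deriv (lam s) x :=
    deriv_fun_sub ((lam_contDiff (m := 1) t).differentiable (by simp) x)
      ((lam_contDiff (m := 1) s).differentiable (by simp) x)
  simp only [kern, fluxKernel, d]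
  field_simp

/-- The mass of the potential. -/
def potMass (n : ℕ) (s t : ℝ) : ℝ :=
  (∫⁻ w : Cn n, ENNReal.ofReal (pot n (lamDiff s t) (‖w‖ ^ 2)) ∂(invVolume n)).toReal

lemma two_div_lt_one (hs : 4 ≤ s) : 2 / s < 1 := (div_lt_one (by linarith)).2 (by linarith)

lemma potMass_eq (hs : 4 ≤ s) (hst : s ≤ t) :
    potMass n s t = ∫ z : Cn n, pot n (lamDiff s t) (bx 0 z) ∂(invVolume n) :=
  (integral_kernel zero_mem_unitBall (contDiff_pot_lamDiff (by linarith) hst).continuous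
    (two_div_lt_one hs) (pot_lamDiff_eq_zero (by linarith) hst) (pot_lamDiff_nonneg hst)).symm

lemma integrable_pot (hs : 4 ≤ s) (hst : s ≤ t) :
    Integrable (fun z : Cn n => pot n (lamDiff s t) (bx 0 z)) (invVolume n) := by
  obtain ⟨h1, h2⟩ := kernel_test (n := n) zero_mem_unitBall
    (contDiff_pot_lamDiff (n := n) (by linarith) hst).continuous
    (two_div_lt_one hs) (pot_lamDiff_eq_zero (by linarith) hst)
  exact integrable_of_test h1.continuousOn (suppRadius_lt_one (two_div_lt_one hs) (by simp)) h2

/-- Keeps the mass bounded below by its value at t = 2s while t tends to infinity. -/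
lemma potMass_mono {t' : ℝ} (hs : 4 ≤ s) (hst : s ≤ t) (ht : t ≤ t') : potMass n s t ≤ potMass n s t' := by
  rw [potMass_eq hs hst, potMass_eq hs (hst.trans ht)]
  refine integral_mono_ae (integrable_pot hs hst) (integrable_pot hs (hst.trans ht)) ?_
  filter_upwards [ae_invVolume_mem] with z hz
  exact pot_lamDiff_mono (by linarith) hst ht (bx_nonneg zero_mem_unitBall hz)
    (bx_lt_one zero_mem_unitBall hz).le

lemma volume_le_invVolume {A : Set (Cn n)} (hA : MeasurableSet A) (hs : A ⊆ unitBall n) :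
    volume A ≤ invVolume n A := by
  rw [invVolume, withDensity_apply _ hA, Measure.restrict_restrict hA,
    Set.inter_eq_self_of_subset_left hs, ← setLIntegral_one]
  refine setLIntegral_mono' hA fun z hz => ?_
  have := one_sub_norm_sq_pos (hs hz)
  rw [← ENNReal.ofReal_one]
  refine ENNReal.ofReal_le_ofReal ?_
  rw [le_div_iff₀ (by positivity), one_mul]
  exact pow_le_one₀ this.le (by nlinarith [norm_nonneg z])

lemma potMass_pos (hs : 4 ≤ s) : 0 < potMass n s (2 * s) := by
  have hs0 : 0 < s := by linarith
  have hr : 0 < Real.sqrt (1 / s) := Real.sqrt_pos.2 (by positivity)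
  have hr1 : Real.sqrt (1 / s) ≤ 1 := by
    rw [Real.sqrt_le_one]; rw [div_le_one hs0]; linarith
  rw [potMass_eq hs (by linarith), integral_pos_iff_support_of_nonneg_ae _
    (integrable_pot hs (by linarith))]
  · have hsub : Metric.ball (0 : Cn n) (Real.sqrt (1 / s)) ⊆ unitBall n := Metric.ball_subset_ball hr1
    refine lt_of_lt_of_le (Metric.measure_ball_pos volume (0 : Cn n) hr)
      ((volume_le_invVolume Metric.isOpen_ball.measurableSet hsub).trans (measure_mono fun z hz => ?_))
    rw [Function.mem_support, bx_zero]
    refine (pot_lamDiff_pos (by linarith) (by positivity) ?_).ne'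
    rw [mem_ball_zero_iff] at hz
    exact (Real.lt_sqrt (norm_nonneg z)).1 hz
  · filter_upwards [ae_invVolume_mem] with z hz
    exact pot_lamDiff_nonneg (by linarith) _ (bx_nonneg zero_mem_unitBall hz)
      (bx_lt_one zero_mem_unitBall hz).le

end potential

/-! ### Positivity of the distribution Δ̃φ -/

section positivity

variable {φ : Cn n → EReal} {ψ : Cn n → ℝ}

lemma exists_radius {K : Set (Cn n)} (hK : IsCompact K) (hs : K ⊆ unitBall n) :
    ∃ ρ, 0 ≤ ρ ∧ ρ < 1 ∧ ∀ z ∈ K, ‖z‖ ≤ ρ := by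
  rcases K.eq_empty_or_nonempty with rfl | hne
  · exact ⟨0, le_rfl, zero_lt_one, by simp⟩
  obtain ⟨w, hw, hmax⟩ := hK.exists_isMaxOn hne continuous_norm.continuousOn
  exact ⟨‖w‖, norm_nonneg w, mem_unitBall.1 (hs hw), fun z hz => hmax hz⟩

lemma kern_radius {s : ℝ} (hs : 4 ≤ s) : 2 / s ≤ 1 / 2 := by
  rw [div_le_div_iff₀ (by linarith) (by norm_num)]; linarith

/-- Invariant means of `-φ` are smaller than `-φ`. -/
lemma kernelOp_negPart_le (hn : 1 ≤ n) (hφ : InvSubharmonic φ) (h0 : ∀ z ∈ unitBall n, φ z ≤ 0)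
    {a : Cn n} (ha : a ∈ unitBall n) (hfin : negPart φ a < ⊤) {s : ℝ} (hs : 4 ≤ s) :
    kernelOp (kern n s) (fun z => (negPart φ z).toReal) a ≤ (negPart φ a).toReal := by
  have hs0 : 0 < s := by linarith
  have mk : Measurable (kern n s) := (kern_contDiff hs0).continuous.measurable
  have mb := measurable_bx a
  have mP := measurable_negPart hφ.usc
  rw [kernelOp, integral_eq_lintegral_of_nonneg_ae]
  · refine ENNReal.toReal_mono hfin.ne ?_
    have h1 := lintegral_negPart_mul_le hn hφ h0 ha (β := fun x => ENNReal.ofReal (kern n s x))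
      (by fun_prop)
    rw [lintegral_kern hn (by linarith), one_mul] at h1
    refine le_trans (lintegral_mono_ae ?_) h1
    filter_upwards [ae_invVolume_mem] with z hz
    rw [ENNReal.ofReal_mul (kern_nonneg hs0 (bx_nonneg ha hz) (bx_lt_one ha hz).le)]
    gcongr
    exact ENNReal.ofReal_toReal_le
  · filter_upwards [ae_invVolume_mem] with z hz
    exact mul_nonneg (kern_nonneg hs0 (bx_nonneg ha hz) (bx_lt_one ha hz).le) ENNReal.toReal_nonneg
  · exact (by fun_prop : Measurable fun z => kern n s (bx a z) * (negPart φ z).toReal).aestronglyMeasurable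

/-- Symmetry of the Laplacian moves it from ψ to the potential, where it is a difference of two mean
kernels. -/
lemma kernelOp_pot {s t : ℝ} (hn : 1 ≤ n) (hs : 4 ≤ s) (hst : s ≤ t)
    (hψ : ContDiff ℝ 2 ψ) (hc : HasCompactSupport ψ) (hsub : tsupport ψ ⊆ unitBall n)
    {a : Cn n} (ha : a ∈ unitBall n) :
    kernelOp (pot n (lamDiff s t)) (invLaplacian ψ) a = -(2 * sphereConst n / (n + 1)) *
      (kernelOp (kern n t) ψ a - kernelOp (kern n s) ψ a) := by
  have hs0 : 0 < s := by linarith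
  have ht0 : 0 < t := by linarith
  obtain ⟨ρ, hρ0, hρ1, hρ⟩ := exists_radius hc hsub
  have hψ0 : ∀ z, ρ < ‖z‖ → ψ z = 0 := fun z hz =>
    image_eq_zero_of_notMem_tsupport fun h => absurd (hρ z h) (not_le.2 hz)
  have hi : ∀ u : ℝ, 4 ≤ u → Integrable (fun z => kern n u (bx a z) * ψ z) (invVolume n) := fun u hu => by
    obtain ⟨h1, -⟩ := kernel_test ha (kern_contDiff (n := n) (s := u) (by linarith)).continuous
      (two_div_lt_one hu) fun x hx => kern_eq_zero (by linarith) hx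
    exact integrable_of_test (h1.mul hψ.continuous).continuousOn hρ1 fun z hz => by simp [hψ0 z hz]
  have hu : ContDiffOn ℝ 2 (fun z => pot n (lamDiff s t) (bx a z)) (unitBall n) :=
    (contDiff_infty.1 (contDiff_kernel_right (contDiff_pot_lamDiff (n := n) hs0 hst)
      (two_div_lt_one hs).le (pot_lamDiff_eq_zero (by linarith) hst) ha) 2).contDiffOn
  rw [kernelOp, ← integral_invLaplacian_symm hu hψ hc hsub, kernelOp, kernelOp,
    ← integral_sub (hi t (by linarith)) (hi s hs), ← integral_const_mul]
  refine integral_congr_ae ?_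
  filter_upwards [ae_invVolume_mem] with z hz
  rw [invLaplacian_pot hn (lamDiff_contDiff s t) (one_div_pos.2 ht0)
    (fun _ hy => lamDiff_eq_zero_left hs0 hst hy) ha hz, fluxKernel_lamDiff hn]
  field_simp
  ring

/-- The distributional invariant Laplacian of an invariant subharmonic function is positive. -/
theorem integral_negPart_mul_invLaplacian_nonpos (hn : 1 ≤ n) (hφ : InvSubharmonic φ)
    (h0 : ∀ z ∈ unitBall n, φ z ≤ 0) (hψ : ContDiff ℝ 2 ψ) (hc : HasCompactSupport ψ)
    (hsub : tsupport ψ ⊆ unitBall n) (hpos : ∀ z, 0 ≤ ψ z) :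
    ∫ z, (negPart φ z).toReal * invLaplacian ψ z ∂(invVolume n) ≤ 0 := by
  set v : Cn n → ℝ := fun z => (negPart φ z).toReal with hv
  have iv : BallIntegrable v := fun K hK hs => integrableOn_negPart hn hφ h0 hK hs
  have hv0 : ∀ z, 0 ≤ v z := fun z => ENNReal.toReal_nonneg
  obtain ⟨ρ, hρ0, hρ1, hρ⟩ := exists_radius hc hsub
  have hψ0 : ∀ z, ρ < ‖z‖ → ψ z = 0 := fun z hz =>
    image_eq_zero_of_notMem_tsupport fun h => absurd (hρ z h) (not_le.2 hz)
  have hL0 : ∀ z, ρ < ‖z‖ → invLaplacian ψ z = 0 := fun z hz =>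
    invLaplacian_eq_zero_of_notMem_tsupport fun h => absurd (hρ z h) (not_le.2 hz)
  have cψ : ContinuousOn ψ (unitBall n) := hψ.continuous.continuousOn
  have cL : ContinuousOn (invLaplacian ψ) (unitBall n) := continuousOn_invLaplacian hψ.contDiffOn
  set V := ∫ a in Metric.closedBall (0 : Cn n) (suppRadius (1 / 2) ρ), v a ∂(invVolume n) with hV
  have hV0 : 0 ≤ V := integral_nonneg hv0
  have hC := sphereConst_pos hn
  set κ := 2 * sphereConst n / (n + 1) with hκ
  have hκ0 : 0 < κ := by positivity
  have tends : ∀ ε : ℝ, 0 < ε → ∀ N : ℝ, ∃ s : ℝ, 4 ≤ s ∧ N ≤ s ∧ 2 / s ≤ ε := fun ε hε N => by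
    refine ⟨max (max 4 N) (2 / ε), (le_max_left _ _).trans (le_max_left _ _),
      (le_max_right _ _).trans (le_max_left _ _), ?_⟩
    rw [div_le_iff₀ (lt_of_lt_of_le (by norm_num : (0 : ℝ) < 4)
      ((le_max_left _ _).trans (le_max_left _ _)))]
    have := (div_le_iff₀ hε).1 (le_max_right (max 4 N) (2 / ε))
    linarith
  -- Apply the potential P with scales s ≤ t to Δ̃ψ and integrate against v. The result is close to
  -- mass(P) ∫ v Δ̃ψ, and it equals κ(∫ v K_sψ - ∫ v K_tψ). The first integral is at most ∫ vψ and
  -- the second is close to it.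
  have main : ∀ δ : ℝ, 0 < δ → ∫ z, v z * invLaplacian ψ z ∂(invVolume n) ≤ 2 * δ * V := by
    intro δ hδ
    obtain ⟨ε₁, hε₁, hm₁⟩ := exists_modulus cL hρ0 hρ1 hL0 hδ
    obtain ⟨s, hs, -, hsε⟩ := tends ε₁ hε₁ 0
    have hs0 : 0 < s := by linarith
    have hc0 := potMass_pos (n := n) hs
    -- The scale s is fixed before t. The tolerance is scaled by the mass for t = 2s, a lower bound
    -- for the mass of the potential finally used, so the error remains small after division by that
    -- mass.
    obtain ⟨ε₂, hε₂, hm₂⟩ := exists_modulus cψ hρ0 hρ1 hψ0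
      (show 0 < δ * potMass n s (2 * s) / κ by positivity)
    obtain ⟨t, ht, h2s, htε⟩ := tends ε₂ hε₂ (2 * s)
    have ht0 : 0 < t := by linarith
    have hst : s ≤ t := by linarith
    have hcm : potMass n s (2 * s) ≤ potMass n s t := potMass_mono hs (by linarith) h2s
    have A := abs_integral_kernelOp_sub_le iv hv0 (contDiff_pot_lamDiff (n := n) hs0 hst).continuous
      (kern_radius hs) (pot_lamDiff_eq_zero (by linarith) hst) (pot_lamDiff_nonneg hst)
      (fun a ha z hz hb => hm₁ a ha z hz (hb.trans_le hsε)) cL hρ0 hρ1 hL0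
    rw [← potMass.eq_def] at A
    have B := abs_integral_kernelOp_sub_le iv hv0 (kern_contDiff (n := n) ht0).continuous
      (kern_radius ht) (fun x hx => kern_eq_zero ht0 hx) (fun x h0 h1 => kern_nonneg ht0 h0 h1)
      (fun a ha z hz hb => hm₂ a ha z hz (hb.trans_le htε)) cψ hρ0 hρ1 hψ0
    rw [lintegral_kern hn (by linarith), ENNReal.toReal_one, one_mul, mul_one] at B
    -- Here the mean inequality for v and the sign of ψ enter, after symmetry has moved the mean
    -- from ψ to v.
    have C : ∫ a, v a * kernelOp (kern n s) ψ a ∂(invVolume n) ≤ ∫ z, v z * ψ z ∂(invVolume n) := by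
      rw [integral_mul_kernelOp iv (kern_contDiff (n := n) hs0).continuous (two_div_lt_one hs)
        (fun x hx => kern_eq_zero hs0 hx) cψ hρ1 hψ0]
      refine integral_mono_ae ?_ (iv.integrable_mul cψ hρ1 hψ0) ?_
      · have := (integrable_prod_kernel iv (kern_contDiff (n := n) hs0).continuous (two_div_lt_one hs)
          (fun x hx => kern_eq_zero hs0 hx) cψ hρ1 hψ0).integral_prod_right
        refine this.congr (ae_of_all _ fun z => ?_)
        dsimp only
        rw [kernelOp, ← integral_const_mul]
        refine integral_congr_ae (ae_of_all _ fun a => ?_)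
        dsimp only
        rw [bx_comm]; ring
      · filter_upwards [ae_invVolume_mem, ae_negPart_lt_top hn hφ h0] with z hz hfin
        rw [mul_comm (v z)]
        exact mul_le_mul_of_nonneg_left (kernelOp_negPart_le hn hφ h0 hz hfin hs) (hpos z)
    have D : ∫ a, v a * kernelOp (pot n (lamDiff s t)) (invLaplacian ψ) a ∂(invVolume n) =
        -κ * (∫ a, v a * kernelOp (kern n t) ψ a ∂(invVolume n) -
          ∫ a, v a * kernelOp (kern n s) ψ a ∂(invVolume n)) := by
      rw [← integral_sub, ← integral_const_mul]
      · refine integral_congr_ae ?_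
        filter_upwards [ae_invVolume_mem] with a ha
        rw [kernelOp_pot hn hs hst hψ hc hsub ha]
        ring
      · exact integrable_mul_kernelOp iv (kern_contDiff (n := n) ht0).continuous (two_div_lt_one ht)
          (fun x hx => kern_eq_zero ht0 hx) cψ hρ1 hψ0
      · exact integrable_mul_kernelOp iv (kern_contDiff (n := n) hs0).continuous (two_div_lt_one hs)
          (fun x hx => kern_eq_zero hs0 hx) cψ hρ1 hψ0
    rw [D] at A
    set X := ∫ z, v z * invLaplacian ψ z ∂(invVolume n)
    set Y := ∫ z, v z * ψ z ∂(invVolume n)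
    set T := ∫ a, v a * kernelOp (kern n t) ψ a ∂(invVolume n)
    set S := ∫ a, v a * kernelOp (kern n s) ψ a ∂(invVolume n)
    have A' := (abs_le.1 A).1
    have B' := (abs_le.1 B).1
    have hct : 0 < potMass n s t := hc0.trans_le hcm
    have e1 : κ * (δ * potMass n s (2 * s) / κ * V) = δ * potMass n s (2 * s) * V := by
      field_simp
    have e2 : κ * (S - T) ≤ δ * potMass n s (2 * s) * V := by
      rw [← e1]; gcongr; linarith
    have e3 : δ * potMass n s (2 * s) * V ≤ δ * potMass n s t * V := by gcongr
    refine le_of_mul_le_mul_left ?_ hct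
    linarith
  refine le_of_forall_pos_le_add fun ε hε => ?_
  have := main (ε / (2 * (V + 1))) (by positivity)
  rw [zero_add]
  refine this.trans ?_
  rw [show 2 * (ε / (2 * (V + 1))) * V = ε * (V / (V + 1)) by field_simp]
  have : V / (V + 1) ≤ 1 := (div_le_one (by linarith)).2 (by linarith)
  nlinarith

end positivity

/-! ### Existence of the measure Δ̃φ dg -/

section riesz

open scoped CompactlySupported

instance : LocallyCompactSpace (unitBall n) := isOpen_unitBall.locallyCompactSpace

/-- Test functions on the ball. -/
def IsTest (ψ : Cn n → ℝ) : Prop :=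
  ContDiff ℝ ((⊤ : ℕ∞) : WithTop ℕ∞) ψ ∧ HasCompactSupport ψ ∧ tsupport ψ ⊆ unitBall n

variable {ψ χ : Cn n → ℝ}

lemma IsTest.contDiff (h : IsTest ψ) : ContDiff ℝ 2 ψ := contDiff_infty.1 h.1 2

lemma IsTest.add (h : IsTest ψ) (h' : IsTest χ) : IsTest (ψ + χ) :=
  ⟨h.1.add h'.1, h.2.1.add h'.2.1, (tsupport_add ψ χ).trans (Set.union_subset h.2.2 h'.2.2)⟩

lemma IsTest.const_smul (h : IsTest ψ) (c : ℝ) : IsTest (c • ψ) :=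
  ⟨h.1.const_smul c, h.2.1.smul_left (f := fun _ => c),
    (closure_mono fun z hz => by
      rw [Function.mem_support] at hz ⊢
      exact fun h0 => hz (by simp [h0])).trans h.2.2⟩

lemma isTest_zero : IsTest (0 : Cn n → ℝ) :=
  ⟨contDiff_const, HasCompactSupport.zero, by simp [tsupport]⟩

lemma IsTest.exists_radius (h : IsTest ψ) : ∃ ρ, 0 ≤ ρ ∧ ρ < 1 ∧ (∀ z, ρ < ‖z‖ → ψ z = 0) ∧
    ∀ z, ρ < ‖z‖ → invLaplacian ψ z = 0 := by
  obtain ⟨ρ, hρ0, hρ1, hρ⟩ := BallUchiyama.exists_radius h.2.1 h.2.2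
  exact ⟨ρ, hρ0, hρ1, fun z hz =>
    image_eq_zero_of_notMem_tsupport fun h => absurd (hρ z h) (not_le.2 hz), fun z hz =>
    invLaplacian_eq_zero_of_notMem_tsupport fun h => absurd (hρ z h) (not_le.2 hz)⟩

lemma invLaplacian_add (h : ContDiff ℝ 2 ψ) (h' : ContDiff ℝ 2 χ) (z : Cn n) :
    invLaplacian (ψ + χ) z = invLaplacian ψ z + invLaplacian χ z := by
  have hs : ContDiffAt ℝ 2 (ψ + χ) z := (h.add h').contDiffAt
  rw [invLaplacian_eq h.contDiffAt, invLaplacian_eq h'.contDiffAt, invLaplacian_eq hs, ← mul_add]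
  congr 1
  exact Lop_add h.contDiffAt h'.contDiffAt

/-- Extension of a compactly supported function by zero. -/
def extZero (g : C_c(unitBall n, ℝ)) : Cn n → ℝ := Function.extend Subtype.val g 0

lemma extZero_apply (g : C_c(unitBall n, ℝ)) (z : unitBall n) : extZero g z = g z :=
  Subtype.val_injective.extend_apply g 0 z

lemma extZero_eq {g : C_c(unitBall n, ℝ)} (h : ∀ z : unitBall n, g z = ψ z)
    (h0 : ∀ z ∉ unitBall n, ψ z = 0) : extZero g = ψ := by
  ext z
  by_cases hz : z ∈ unitBall n
  · exact (extZero_apply g ⟨z, hz⟩).trans (h ⟨z, hz⟩)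
  · rw [h0 z hz, extZero, Function.extend_apply' _ _ _ (by rintro ⟨w, rfl⟩; exact hz w.2)]; rfl

lemma extZero_add (g g' : C_c(unitBall n, ℝ)) : extZero (g + g') = extZero g + extZero g' :=
  extZero_eq (fun z => by simp [extZero_apply]) fun z hz => by
    simp [extZero, Function.extend_apply' _ _ _ (show ¬ ∃ w : unitBall n, w.1 = z by
      rintro ⟨w, rfl⟩; exact hz w.2)]

lemma extZero_smul (c : ℝ) (g : C_c(unitBall n, ℝ)) : extZero (c • g) = c • extZero g :=
  extZero_eq (fun z => by simp [extZero_apply]) fun z hz => by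
    simp [extZero, Function.extend_apply' _ _ _ (show ¬ ∃ w : unitBall n, w.1 = z by
      rintro ⟨w, rfl⟩; exact hz w.2)]

/-- The restrictions of test functions to the ball. -/
def testSpace (n : ℕ) : Submodule ℝ C_c(unitBall n, ℝ) where
  carrier := {g | IsTest (extZero g)}
  add_mem' {g g'} h h' := by
    simp only [Set.mem_ofPred_eq, extZero_add] at *
    exact IsTest.add h h'
  zero_mem' := by
    simp only [Set.mem_ofPred_eq]
    rw [extZero_eq (ψ := 0) (by simp) (by simp)]
    exact isTest_zero
  smul_mem' c g h := by
    simp only [Set.mem_ofPred_eq, extZero_smul] at *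
    exact IsTest.const_smul h c

lemma IsTest.notMem (h : IsTest ψ) {z : Cn n} (hz : z ∉ unitBall n) : ψ z = 0 :=
  image_eq_zero_of_notMem_tsupport fun h' => hz (h.2.2 h')

/-- The restriction of a test function to the ball. -/
def IsTest.restrict (h : IsTest ψ) : C_c(unitBall n, ℝ) where
  toFun z := ψ z
  continuous_toFun := h.1.continuous.comp continuous_subtype_val
  hasCompactSupport' := by
    refine HasCompactSupport.intro (K := Subtype.val ⁻¹' tsupport ψ) ?_ fun z hz =>
      image_eq_zero_of_notMem_tsupport hz
    rw [Topology.IsInducing.subtypeVal.isCompact_preimage_iff]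
    · exact h.2.1
    · rw [Subtype.range_coe]; exact h.2.2

lemma IsTest.extZero_restrict (h : IsTest ψ) : extZero h.restrict = ψ :=
  extZero_eq (fun _ => rfl) fun _ hz => h.notMem hz

lemma IsTest.restrict_mem (h : IsTest ψ) : h.restrict ∈ testSpace n := by
  change IsTest (extZero h.restrict)
  rw [h.extZero_restrict]; exact h

/-- Test functions dominate all compactly supported functions. -/
lemma exists_isTest_ge (g : C_c(unitBall n, ℝ)) :
    ∃ ψ : Cn n → ℝ, IsTest ψ ∧ ∀ z : unitBall n, 0 ≤ ψ z + g z := by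
  have hK : IsCompact (Subtype.val '' tsupport g : Set (Cn n)) :=
    IsCompact.image g.hasCompactSupport continuous_subtype_val
  obtain ⟨ρ, hρ0, hρ1, hρ⟩ := exists_radius hK (by rintro _ ⟨z, -, rfl⟩; exact z.2)
  obtain ⟨M, hM⟩ := g.hasCompactSupport.exists_bound_of_continuous g.continuous
  have hρ2 : 0 < 1 - ρ ^ 2 := by nlinarith
  -- With this s the cutoff of 1 - ‖z‖² equals one for ‖z‖ ≤ ρ, hence on the support of g.
  set s := 2 / (1 - ρ ^ 2) with hs
  have hs0 : 0 < s := by positivity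
  set k : ℝ → ℝ := fun x => M * lam s (1 - x) with hk
  have ck : ContDiff ℝ ((⊤ : ℕ∞) : WithTop ℕ∞) k :=
    contDiff_const.mul ((lam_contDiff s).comp (contDiff_const.sub contDiff_id))
  have hk0 : ∀ x, 1 - 1 / s ≤ x → k x = 0 := fun x hx => by
    have h1 : s * (1 - x) ≤ 1 := by
      rw [mul_comm]; exact (le_div_iff₀ hs0).1 (by linarith)
    simp [hk, lam_eq_zero h1]
  have hR : 1 - 1 / s < 1 := by
    have : 0 < 1 / s := by positivity
    linarith
  refine ⟨fun z => k (bx 0 z), ⟨contDiff_kernel_right ck hR.le hk0 zero_mem_unitBall,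
    kernel_hasCompactSupport hR.le hk0 zero_mem_unitBall,
    (kernel_tsupport_subset (ρ := 0) one_pos (by simp) hR.le hk0).trans
      (closedBall_subset_unitBall (suppRadius_lt_one hR one_pos))⟩, fun z => ?_⟩
  have hM' := abs_le.1 (hM z)
  by_cases hz : z ∈ tsupport g
  · have h1 := hρ z.1 ⟨z, hz, rfl⟩
    have h2 : 2 ≤ s * (1 - bx 0 z.1) := by
      rw [bx_zero, hs, div_mul_eq_mul_div, le_div_iff₀ hρ2]
      have := pow_le_pow_left₀ (norm_nonneg z.1) h1 2
      linarith
    simp only [hk, lam_eq_one h2]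
    linarith [hM'.1]
  · rw [image_eq_zero_of_notMem_tsupport hz, add_zero]
    have : 0 ≤ M := (norm_nonneg _).trans (hM z)
    exact mul_nonneg this (lam_nonneg _ _)

/-- The cone of nonnegative functions. -/
def nonnegCone (n : ℕ) : PointedCone ℝ C_c(unitBall n, ℝ) where
  carrier := {g | ∀ z, 0 ≤ g z}
  add_mem' h h' z := add_nonneg (h z) (h' z)
  zero_mem' _ := le_rfl
  smul_mem' c _ h z := mul_nonneg c.2 (h z)

variable {φ : Cn n → EReal}

/-- Existence of the measure `Δφ dg`. -/
theorem exists_isInvLaplacianMeasure (hn : 1 ≤ n) (hφ : InvSubharmonic φ)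
    (h0 : ∀ z ∈ unitBall n, φ z ≤ 0) : ∃ m : Measure (Cn n), IsInvLaplacianMeasure φ m := by
  set v : Cn n → ℝ := fun z => (negPart φ z).toReal with hv
  have iv : BallIntegrable v := fun K hK hs => integrableOn_negPart hn hφ h0 hK hs
  have hint : ∀ ψ : Cn n → ℝ, IsTest ψ → Integrable (fun z => v z * invLaplacian ψ z) (invVolume n) :=
    fun ψ h => by
      obtain ⟨ρ, -, hρ1, -, hL⟩ := h.exists_radius
      exact iv.integrable_mul (continuousOn_invLaplacian h.contDiff.contDiffOn) hρ1 hL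
  let f : C_c(unitBall n, ℝ) →ₗ.[ℝ] ℝ :=
    { domain := testSpace n
      toFun :=
        { toFun := fun g => -∫ z, v z * invLaplacian (extZero g.1) z ∂(invVolume n)
          map_add' := fun g g' => by
            have h1 : IsTest (extZero g.1) := g.2
            have h2 : IsTest (extZero g'.1) := g'.2
            simp only [Submodule.coe_add, extZero_add, invLaplacian_add h1.contDiff h2.contDiff, mul_add]
            rw [integral_add (hint _ h1) (hint _ h2), neg_add]
          map_smul' := fun c g => by
            have h1 : IsTest (extZero g.1) := g.2
            have h2 : ∀ z, invLaplacian (c • extZero g.1) z = c * invLaplacian (extZero g.1) z :=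
              fun z => invLaplacian_const_mul c h1.contDiff.contDiffAt
            simp only [Submodule.coe_smul, extZero_smul, h2, RingHom.id_apply, smul_eq_mul,
              mul_left_comm _ c]
            rw [integral_const_mul, mul_neg] } }
  have hf : ∀ g : f.domain, f g = -∫ z, v z * invLaplacian (extZero g.1) z ∂(invVolume n) := fun _ => rfl
  -- Positivity on test functions, and the fact that they dominate all compactly supported
  -- functions, permit a positive extension without any density or continuity argument.
  obtain ⟨Λ, hΛf, hΛ0⟩ := riesz_extension (nonnegCone n) f (fun g hg => by
    have h1 : IsTest (extZero g.1) := g.2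
    rw [hf, neg_nonneg]
    refine integral_negPart_mul_invLaplacian_nonpos hn hφ h0 h1.contDiff h1.2.1 h1.2.2 fun z => ?_
    by_cases hz : z ∈ unitBall n
    · exact (hg ⟨z, hz⟩).trans_eq (extZero_apply g.1 ⟨z, hz⟩).symm
    · exact (h1.notMem hz).ge) (fun g => by
    obtain ⟨ψ, hψ, h⟩ := exists_isTest_ge g
    exact ⟨⟨hψ.restrict, hψ.restrict_mem⟩, h⟩)
  let Λ' : C_c(unitBall n, ℝ) →ₚ[ℝ] ℝ := PositiveLinearMap.mk₀ Λ fun g hg => hΛ0 g fun z => hg z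
  set μ := RealRMK.rieszMeasure Λ' with hμ
  have hemb : MeasurableEmbedding (Subtype.val : unitBall n → Cn n) :=
    MeasurableEmbedding.subtype_coe isOpen_unitBall.measurableSet
  refine ⟨μ.map Subtype.val, ?_, ?_, ?_, ?_, ?_⟩
  · rw [hemb.map_apply]
    have : (Subtype.val ⁻¹' (unitBall n)ᶜ : Set (unitBall n)) = ∅ := by
      ext z; simp
    rw [this, measure_empty]
  · intro K hK hs
    rw [hemb.map_apply]
    refine IsCompact.measure_lt_top ?_
    rwa [Topology.IsInducing.subtypeVal.isCompact_preimage_iff]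
    rwa [Subtype.range_coe]
  · filter_upwards [ae_negPart_lt_top hn hφ h0, ae_invVolume_mem] with z hz hzb hbot
    rw [negPart_eq hzb, hbot] at hz
    simp at hz
  · intro K hK hs
    have := (iv K hK hs).neg
    refine this.congr ?_
    filter_upwards [ae_restrict_mem hK.measurableSet] with z hz
    exact (toReal_eq_neg_negPart h0 (hs hz)).symm
  · intro ψ h1 h2 h3
    have hψ : IsTest ψ := ⟨h1, h2, h3⟩
    rw [hemb.integral_map]
    have e1 : ∫ z : unitBall n, ψ z ∂μ = Λ' hψ.restrict := RealRMK.integral_rieszMeasure Λ' hψ.restrict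
    have e2 : Λ' hψ.restrict = f ⟨hψ.restrict, hψ.restrict_mem⟩ := hΛf ⟨hψ.restrict, hψ.restrict_mem⟩
    rw [e1, e2, hf]
    dsimp only
    rw [hψ.extZero_restrict, ← integral_neg]
    refine integral_congr_ae ?_
    filter_upwards [ae_invVolume_mem] with z hz
    rw [toReal_eq_neg_negPart h0 hz, neg_mul]

end riesz

/-! ### Differentiation under the integral sign -/

section parametric

set_option linter.unusedSectionVars false

variable {E α G : Type*} [NormedAddCommGroup E] [NormedSpace ℝ E] [ProperSpace E]
  [NormedAddCommGroup α] [NormedSpace ℝ α] [MeasurableSpace α] [BorelSpace α] [SecondCountableTopology α]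
  [NormedAddCommGroup G] [NormedSpace ℝ G]
  {F : E → α → G} {w : α → ℝ} {μ : Measure α} {U : Set E} {K : Set α} {a : E}

lemma exists_local_bound (hU : IsOpen U) (hK : IsCompact K)
    (hF : ∀ a ∈ U, ∀ z, ContinuousAt (Function.uncurry F) (a, z)) (ha : a ∈ U) :
    ∃ ε > 0, ∃ M, Metric.ball a ε ⊆ U ∧ ∀ x ∈ Metric.ball a ε, ∀ z ∈ K, ‖F x z‖ ≤ M := by
  obtain ⟨ε, hε, hs⟩ := Metric.nhds_basis_closedBall.mem_iff.1 (hU.mem_nhds ha)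
  obtain ⟨M, hM⟩ := ((isCompact_closedBall a ε).prod hK).exists_bound_of_continuousOn
    (f := Function.uncurry F) fun p hp => (hF p.1 (hs hp.1) p.2).continuousWithinAt
  exact ⟨ε, hε, M, Metric.ball_subset_closedBall.trans hs, fun x hx z hz =>
    hM (x, z) ⟨Metric.ball_subset_closedBall hx, hz⟩⟩

lemma continuous_section (hF : ∀ z, ContinuousAt (Function.uncurry F) (a, z)) :
    Continuous (F a) :=
  continuous_iff_continuousAt.2 fun z =>
    ContinuousAt.comp (f := fun z => (a, z)) (hF z) (by fun_prop)

lemma aestronglyMeasurable_weighted (hw : IntegrableOn w K μ)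
    (hF : ∀ z, ContinuousAt (Function.uncurry F) (a, z)) :
    AEStronglyMeasurable (fun z => w z • F a z) (μ.restrict K) :=
  hw.aestronglyMeasurable.smul (continuous_section hF).aestronglyMeasurable

lemma continuousAt_setIntegral (hU : IsOpen U) (hK : IsCompact K) (hw : IntegrableOn w K μ)
    (hF : ∀ a ∈ U, ∀ z, ContinuousAt (Function.uncurry F) (a, z)) (ha : a ∈ U) :
    ContinuousAt (fun x => ∫ z in K, w z • F x z ∂μ) a := by
  obtain ⟨ε, hε, M, hs, hM⟩ := exists_local_bound hU hK hF ha
  have hball := Metric.ball_mem_nhds a hε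
  refine continuousAt_of_dominated (bound := fun z => ‖w z‖ * M) ?_ ?_ (hw.norm.mul_const M) ?_
  · filter_upwards [hball] with x hx using aestronglyMeasurable_weighted hw (hF x (hs hx))
  · filter_upwards [hball] with x hx
    filter_upwards [ae_restrict_mem hK.measurableSet] with z hz
    rw [norm_smul]
    gcongr
    exact hM x hx z hz
  · refine ae_of_all _ fun z => ?_
    exact (ContinuousAt.comp (f := fun x => (x, z)) (hF a ha z) (by fun_prop)).const_smul (w z)

lemma contDiffAt_fderiv_left {m k : WithTop ℕ∞} {z : α}
    (hF : ContDiffAt ℝ k (Function.uncurry F) (a, z)) (hm : m + 1 ≤ k) :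
    ContDiffAt ℝ m (Function.uncurry fun a z => fderiv ℝ (fun x => F x z) a) (a, z) := by
  have h0 : ContDiffAt ℝ k (fun q : (E × α) × E => (q.2, q.1.2)) ((a, z), a) := by fun_prop
  have h1 : ContDiffAt ℝ k (Function.uncurry fun (p : E × α) (x : E) => F x p.2) ((a, z), a) :=
    ContDiffAt.comp (f := fun q : (E × α) × E => (q.2, q.1.2)) ((a, z), a) hF h0
  exact ContDiffAt.fderiv (m := m) (f := fun (p : E × α) (x : E) => F x p.2)
      (g := fun p : E × α => p.1) (x₀ := (a, z)) h1 (by fun_prop) hm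

lemma hasFDerivAt_setIntegral (hU : IsOpen U) (hK : IsCompact K) (hw : IntegrableOn w K μ)
    (hF : ∀ a ∈ U, ∀ z, ContDiffAt ℝ 1 (Function.uncurry F) (a, z)) (ha : a ∈ U) :
    HasFDerivAt (fun x => ∫ z in K, w z • F x z ∂μ)
      (∫ z in K, w z • fderiv ℝ (fun x => F x z) a ∂μ) a := by
  have hF' : ∀ a ∈ U, ∀ z, ContinuousAt
      (Function.uncurry fun a z => fderiv ℝ (fun x => F x z) a) (a, z) := fun a ha z =>
    (contDiffAt_fderiv_left (m := 0) (hF a ha z) (by simp)).continuousAt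
  obtain ⟨ε, hε, M, hs, hM⟩ := exists_local_bound hU hK hF' ha
  have hball := Metric.ball_mem_nhds a hε
  have hc : ∀ a ∈ U, ∀ z, ContinuousAt (Function.uncurry F) (a, z) :=
    fun a ha z => (hF a ha z).continuousAt
  obtain ⟨ε', hε', M', -, hM'⟩ := exists_local_bound hU hK hc ha
  refine hasFDerivAt_integral_of_dominated_of_fderiv_le (bound := fun z => ‖w z‖ * M)
    (F' := fun x z => w z • fderiv ℝ (fun x => F x z) x) hball ?_ ?_ ?_ ?_ (hw.norm.mul_const M) ?_
  · filter_upwards [hball] with x hx using aestronglyMeasurable_weighted hw (hc x (hs hx))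
  · refine (hw.norm.mul_const M').mono' (aestronglyMeasurable_weighted hw (hc a ha)) ?_
    filter_upwards [ae_restrict_mem hK.measurableSet] with z hz
    rw [norm_smul]
    gcongr
    exact hM' a (Metric.mem_ball_self hε') z hz
  · exact aestronglyMeasurable_weighted hw (hF' a ha)
  · filter_upwards [ae_restrict_mem hK.measurableSet] with z hz x hx
    rw [norm_smul]
    gcongr
    exact hM x hx z hz
  · refine ae_of_all _ fun z x hx => ?_
    have : ContDiffAt ℝ 1 (fun x => F x z) x :=
      ContDiffAt.comp (f := fun x => (x, z)) x (hF x (hs hx) z) (by fun_prop)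
    exact (this.differentiableAt one_ne_zero).hasFDerivAt.const_smul (w z)

/-- Differentiation under the integral sign, twice. -/
lemma contDiffOn_two_setIntegral (hU : IsOpen U) (hK : IsCompact K) (hw : IntegrableOn w K μ)
    (hF : ∀ a ∈ U, ∀ z, ContDiffAt ℝ 2 (Function.uncurry F) (a, z)) :
    ContDiffOn ℝ 2 (fun x => ∫ z in K, w z • F x z ∂μ) U ∧
    ∀ a ∈ U, fderiv ℝ (fderiv ℝ fun x => ∫ z in K, w z • F x z ∂μ) a =
      ∫ z in K, w z • fderiv ℝ (fderiv ℝ fun x => F x z) a ∂μ := by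
  set Φ := fun x => ∫ z in K, w z • F x z ∂μ
  have hF1 : ∀ a ∈ U, ∀ z, ContDiffAt ℝ 1
      (Function.uncurry fun a z => fderiv ℝ (fun x => F x z) a) (a, z) := fun a ha z =>
    contDiffAt_fderiv_left (hF a ha z) (by norm_num)
  have hF2 : ∀ a ∈ U, ∀ z, ContDiffAt ℝ 0
      (Function.uncurry fun a z => fderiv ℝ (fderiv ℝ fun x => F x z) a) (a, z) := fun a ha z =>
    contDiffAt_fderiv_left (F := fun a z => fderiv ℝ (fun x => F x z) a) (hF1 a ha z) (by norm_num)
  have h1 : ∀ a ∈ U, HasFDerivAt Φ (∫ z in K, w z • fderiv ℝ (fun x => F x z) a ∂μ) a :=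
    fun a ha => hasFDerivAt_setIntegral hU hK hw
      (fun a ha z => (hF a ha z).of_le one_le_two) ha
  have h2 : ∀ a ∈ U, HasFDerivAt (fun a => ∫ z in K, w z • fderiv ℝ (fun x => F x z) a ∂μ)
      (∫ z in K, w z • fderiv ℝ (fderiv ℝ fun x => F x z) a ∂μ) a :=
    fun a ha => hasFDerivAt_setIntegral (F := fun a z => fderiv ℝ (fun x => F x z) a) hU hK hw hF1 ha
  have h2' : ∀ a ∈ U, HasFDerivAt (fderiv ℝ Φ)
      (∫ z in K, w z • fderiv ℝ (fderiv ℝ fun x => F x z) a ∂μ) a := fun a ha =>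
    (h2 a ha).congr_of_eventuallyEq (by
      filter_upwards [hU.mem_nhds ha] with x hx using (h1 x hx).fderiv)
  refine ⟨?_, fun a ha => (h2' a ha).fderiv⟩
  rw [← one_add_one_eq_two, contDiffOn_succ_iff_fderiv_of_isOpen hU]
  refine ⟨fun a ha => (h1 a ha).differentiableAt.differentiableWithinAt, by simp, ?_⟩
  rw [← zero_add 1, contDiffOn_succ_iff_fderiv_of_isOpen hU]
  refine ⟨fun a ha => (h2' a ha).differentiableAt.differentiableWithinAt, by simp, ?_⟩
  rw [contDiffOn_zero]
  refine ContinuousOn.congr (f := fun a => ∫ z in K, w z • fderiv ℝ (fderiv ℝ fun x => F x z) a ∂μ) ?_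
    fun a ha => (h2' a ha).fderiv
  exact fun a ha => (continuousAt_setIntegral
    (F := fun a z => fderiv ℝ (fderiv ℝ fun x => F x z) a) hU hK hw
    (fun a ha z => (hF2 a ha z).continuousAt) ha).continuousWithinAt

lemma integrableOn_weighted (hK : IsCompact K) (hw : IntegrableOn w K μ)
    (hF : ∀ z, ContinuousAt (Function.uncurry F) (a, z)) :
    IntegrableOn (fun z => w z • F a z) K μ := by
  obtain ⟨M, hM⟩ := hK.exists_bound_of_continuousOn (continuous_section hF).continuousOn
  refine (hw.norm.mul_const M).mono' (aestronglyMeasurable_weighted hw hF) ?_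
  filter_upwards [ae_restrict_mem hK.measurableSet] with z hz
  rw [norm_smul]
  gcongr
  exact hM z hz

end parametric

/-! ### Laplacians of regularizations -/

section smoothing

variable {a z : Cn n} {k : ℝ → ℝ} {R ρ : ℝ} {h : Cn n → ℝ}

lemma bergmanTrace_integral {α : Type*} [MeasurableSpace α] {μ : Measure α}
    {f : α → Cn n → Cn n → ℝ} (h1 : ∀ v w, Integrable (fun x => f x v w) μ) (z : Cn n) :
    bergmanTrace z (fun v w => ∫ x, f x v w ∂μ) = ∫ x, bergmanTrace z (f x) ∂μ := by
  have h3 : ∀ i, Integrable (fun x => f x (EuclideanSpace.single i 1) (EuclideanSpace.single i 1)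
    + f x (EuclideanSpace.single i Complex.I) (EuclideanSpace.single i Complex.I)) μ := fun i =>
    (h1 _ _).add (h1 _ _)
  have h4 := integrable_finsetSum Finset.univ fun i _ => h3 i
  have h5 : Integrable (fun x => (∑ i : Fin n, (f x (EuclideanSpace.single i 1) (EuclideanSpace.single i 1)
    + f x (EuclideanSpace.single i Complex.I) (EuclideanSpace.single i Complex.I))) - f x z z) μ :=
    h4.sub (h1 _ _)
  simp only [bergmanTrace]
  rw [integral_sub h5 (h1 _ _), integral_sub h4 (h1 _ _), integral_finsetSum _ fun i _ => h3 i]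
  simp only [integral_add (h1 _ _) (h1 _ _)]

/-- By `Lop_comp_bx` the Laplacian in either variable is the same function of the symmetric quantity
`bx a z`. -/
lemma invLaplacian_kernel_comm (ha : a ∈ unitBall n) (hz : z ∈ unitBall n) (hk : ContDiff ℝ 2 k) :
    invLaplacian (fun y => k (bx y z)) a = invLaplacian (fun y => k (bx a y)) z := by
  have h1 := inner_ne_one ha (mem_unitBall.1 hz).le
  have h2 := inner_ne_one hz (mem_unitBall.1 ha).le
  simp only [bx_comm _ z]
  have e1 := Lop_comp_bx h1 (hk.contDiffAt (x := bx a z))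
  have e2 := Lop_comp_bx h2 (hk.contDiffAt (x := bx z a))
  have c1 : ContDiffAt ℝ 2 (fun y => k (bx a y)) z := hk.contDiffAt.comp z (contDiffAt_bx h1)
  have c2 : ContDiffAt ℝ 2 (fun y => k (bx z y)) a := hk.contDiffAt.comp a (contDiffAt_bx h2)
  rw [invLaplacian_eq c1, invLaplacian_eq c2, div_mul_eq_mul_div, div_mul_eq_mul_div, e1, e2, bx_comm z a]

lemma kernelOp_eq_setIntegral (hρ : ρ < 1) (hR : R < 1) (hk0 : ∀ x, R ≤ x → k x = 0) (ha : ‖a‖ ≤ ρ) :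
    kernelOp k h a = ∫ z in Metric.closedBall 0 (suppRadius R ρ), h z • k (bx a z) ∂(invVolume n) := by
  rw [setIntegral_eq_integral_of_forall_compl_eq_zero fun z hz => by
    rw [kernel_eq_zero hρ ha hR.le hk0 hz, smul_zero]]
  simp only [kernelOp, smul_eq_mul, mul_comm]

/-- Differentiate twice under the integral, then pass from the Laplacian in the pole a to that in
the variable z. The resulting right side is the pairing of h with the Laplacian of a test function.
-/
lemma kernelOp_two (hh : BallIntegrable h) (hk : ContDiff ℝ 2 k) (hR : R < 1)
    (hk0 : ∀ x, R ≤ x → k x = 0) (ha : a ∈ unitBall n) :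
    ContDiffAt ℝ 2 (kernelOp k h) a ∧ invLaplacian (kernelOp k h) a =
      ∫ z, h z * invLaplacian (fun y => k (bx a y)) z ∂(invVolume n) := by
  -- A radius larger than ‖a‖ gives one compact set that contains the kernel supports for all poles
  -- near a.
  obtain ⟨ρ, hρa, hρ⟩ := exists_between (mem_unitBall.1 ha)
  set K := Metric.closedBall (0 : Cn n) (suppRadius R ρ) with hKdef
  have hKs : K ⊆ unitBall n := closedBall_subset_unitBall (suppRadius_lt_one hR hρ)
  have hK : IsCompact K := isCompact_closedBall _ _
  have haU : a ∈ Metric.ball (0 : Cn n) ρ := by simpa using hρa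
  have hU : Metric.ball (0 : Cn n) ρ ∈ 𝓝 a := Metric.isOpen_ball.mem_nhds haU
  have hUs : Metric.ball (0 : Cn n) ρ ⊆ unitBall n := Metric.ball_subset_ball hρ.le
  have hF : ∀ x ∈ Metric.ball (0 : Cn n) ρ, ∀ z : Cn n,
      ContDiffAt ℝ 2 (Function.uncurry fun x z => k (bx x z)) (x, z) := fun x hx z =>
    contDiffAt_kernel hk hR.le hk0 (hUs hx) z
  obtain ⟨h1, h2⟩ := contDiffOn_two_setIntegral Metric.isOpen_ball hK (hh K hK hKs) hF
  have heq : kernelOp k h =ᶠ[𝓝 a] fun x => ∫ z in K, h z • k (bx x z) ∂(invVolume n) := by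
    filter_upwards [hU] with x hx
    exact kernelOp_eq_setIntegral hρ hR hk0 (by simpa using (Metric.mem_ball.1 hx).le)
  have hc : ContDiffAt ℝ 2 (kernelOp k h) a := (h1.contDiffAt hU).congr_of_eventuallyEq heq
  refine ⟨hc, ?_⟩
  have hD : D2 (kernelOp k h) a = ∫ z in K, h z • D2 (fun x => k (bx x z)) a ∂(invVolume n) :=
    (D2_congr heq).trans (h2 a haU)
  have hF2 : ∀ z : Cn n, ContinuousAt
      (Function.uncurry fun a z => D2 (fun x => k (bx x z)) a) (a, z) := fun z =>
    (contDiffAt_fderiv_left (m := 0) (k := 1) (F := fun a z => fderiv ℝ (fun x => k (bx x z)) a)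
      (contDiffAt_fderiv_left (F := fun a z => k (bx a z)) (hF a haU z) (by norm_num))
      (by norm_num)).continuousAt
  have hint := integrableOn_weighted (F := fun a z => D2 (fun x => k (bx x z)) a) hK (hh K hK hKs) hF2
  rw [invLaplacian_eq hc, Lop, hD]
  have i1 := fun v => hint.apply_continuousLinearMap v
  have i2 := fun v w => (i1 v).apply_continuousLinearMap w
  simp only [ContinuousLinearMap.integral_apply hint, fun v w => ContinuousLinearMap.integral_apply (i1 v) w]
  rw [bergmanTrace_integral i2, ← integral_const_mul,
    ← setIntegral_eq_integral_of_forall_compl_eq_zero (s := K)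
      (f := fun z => h z * invLaplacian (fun y => k (bx a y)) z)]
  · refine setIntegral_congr_fun hK.measurableSet fun z hz => ?_
    have c1 : ContDiffAt ℝ 2 (fun x => k (bx x z)) a :=
      ContDiffAt.comp (f := fun x => (x, z)) a (hF a haU z) (by fun_prop)
    rw [← invLaplacian_kernel_comm ha (hKs hz) hk, invLaplacian_eq c1, Lop]
    have := bergmanTrace_smul a (h z) fun v w => D2 (fun x => k (bx x z)) a v w
    refine (congrArg _ this).trans ?_
    ring
  · intro z hz
    rw [invLaplacian_eq_zero_of_notMem_tsupport, mul_zero]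
    exact fun hz' => hz (kernel_tsupport_subset hρ hρa.le hR.le hk0 hz')

lemma contDiffOn_kernelOp (hh : BallIntegrable h) (hk : ContDiff ℝ 2 k) (hR : R < 1)
    (hk0 : ∀ x, R ≤ x → k x = 0) : ContDiffOn ℝ 2 (kernelOp k h) (unitBall n) :=
  fun _ ha => (kernelOp_two hh hk hR hk0 ha).1.contDiffWithinAt

variable {φ : Cn n → EReal} {m : Measure (Cn n)}

/-- The regularizations of `φ` have the regularizations of `m` as Laplacians. -/
lemma IsInvLaplacianMeasure.ofReal_invLaplacian_kernelOp (hm : IsInvLaplacianMeasure φ m)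
    (hk : ContDiff ℝ ((⊤ : ℕ∞) : WithTop ℕ∞) k) (hR : R < 1)
    (hk0 : ∀ x, R ≤ x → k x = 0) (hpos : ∀ x, 0 ≤ x → x ≤ 1 → 0 ≤ k x) (ha : a ∈ unitBall n) :
    0 ≤ invLaplacian (kernelOp k fun z => (φ z).toReal) a ∧
    ENNReal.ofReal (invLaplacian (kernelOp k fun z => (φ z).toReal) a) =
      ∫⁻ z, ENNReal.ofReal (k (bx a z)) ∂m := by
  have hk2 : ContDiff ℝ 2 k := hk.of_le (WithTop.coe_le_coe.2 le_top)
  have hsm := contDiff_kernel_right hk hR.le hk0 ha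
  have hcs := kernel_hasCompactSupport hR.le hk0 ha
  have hts := (kernel_tsupport_subset (mem_unitBall.1 ha) le_rfl hR.le hk0).trans
    (closedBall_subset_unitBall (n := n) (suppRadius_lt_one hR (mem_unitBall.1 ha)))
  have hnn : 0 ≤ᵐ[m] fun z => k (bx a z) := by
    have : ∀ᵐ z ∂m, z ∈ unitBall n := by
      rw [ae_iff]; exact hm.compl_ball
    filter_upwards [this] with z hz
    exact hpos _ (bx_nonneg ha hz) (bx_lt_one ha hz).le
  -- The kernel z ↦ k(bx a z) is itself a test function and may be inserted in the definition of m.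
  rw [(kernelOp_two hm.integrable_on_compacts hk2 hR hk0 ha).2, hm.integral_eq _ hsm hcs hts]
  refine ⟨integral_nonneg_of_ae hnn, ofReal_integral_eq_lintegral_ofReal ?_ hnn⟩
  rw [← integrableOn_iff_integrable_of_support_subset (subset_tsupport _)]
  have := hm.finite_on_compacts _ hcs hts
  exact hsm.continuous.continuousOn.integrableOn_of_subset_isCompact hcs hcs.measurableSet subset_rfl this.ne

end smoothing

/-! ### The inequality for invariant subharmonic exponents -/

section regularization

variable {φ : Cn n → EReal} {m : Measure (Cn n)} {a z : Cn n} {s : ℝ}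

lemma ofReal_kern_eq_zero_or (a z : Cn n) (hs : 0 < s) :
    ENNReal.ofReal (kern n s (bx a z)) = 0 ∨ bx a z < 2 / s := by
  rcases lt_or_ge (bx a z) (2 / s) with h | h
  · exact Or.inr h
  · left; rw [kern_eq_zero hs h, ENNReal.ofReal_zero]

/-- The invariant means of `exp φ` are larger than `exp φ`. -/
lemma exp_le_lintegral_kern (hn : 1 ≤ n) (hφ : InvSubharmonic φ) (h0 : ∀ z ∈ unitBall n, φ z ≤ 0)
    (hz : z ∈ unitBall n) (hs : 4 ≤ s) :
    EReal.exp (φ z) ≤ ∫⁻ a, ENNReal.ofReal (kern n s (bx z a)) *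
      ENNReal.ofReal (Real.exp (-(negPart φ a).toReal)) ∂(invVolume n) := by
  by_cases hbot : φ z = ⊥
  · rw [hbot, EReal.exp_bot]; exact zero_le
  have hs0 : 0 < s := by linarith
  have mk : Measurable (kern n s) := (kern_contDiff hs0).continuous.measurable
  have mb := measurable_bx z
  have mP := measurable_negPart hφ.usc
  set N := (negPart φ z).toReal with hN
  have hNfin : negPart φ z ≠ ⊤ := by
    rw [negPart_eq hz]
    induction h : φ z with
    | bot => exact absurd h hbot
    | coe x => rw [← EReal.coe_neg, EReal.toENNReal_of_ne_top (EReal.coe_ne_top _)]; exact ENNReal.ofReal_ne_top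
    | top => exact absurd h (hφ.ne_top z hz)
  have hφz : φ z = ((-N : ℝ) : EReal) := by
    rw [hN, ← toReal_eq_neg_negPart h0 hz, EReal.coe_toReal (hφ.ne_top z hz) hbot]
  rw [hφz, EReal.exp_coe]
  set E := ENNReal.ofReal (Real.exp (-N)) with hE
  have hmass : ∫⁻ a, ENNReal.ofReal (kern n s (bx z a)) ∂(invVolume n) = 1 := by
    rw [lintegral_kernel hz (kern_contDiff hs0).continuous, lintegral_kern hn (by linarith)]
  have h1 := lintegral_negPart_mul_le hn hφ h0 hz (β := fun x => ENNReal.ofReal (kern n s x))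
    (by fun_prop)
  rw [lintegral_kern hn (by linarith), one_mul] at h1
  -- Jensen's inequality by the tangent line e^{-y} ≥ e^{-N}(1 + N - y), with the negative term
  -- moved to the other side so that everything stays in [0,∞]. After integration the finite term
  -- E·N cancels.
  have h2 : ∀ᵐ a ∂(invVolume n), ENNReal.ofReal (kern n s (bx z a)) * (E * (1 + negPart φ z)) ≤
      ENNReal.ofReal (kern n s (bx z a)) * ENNReal.ofReal (Real.exp (-(negPart φ a).toReal)) +
      E * (ENNReal.ofReal (kern n s (bx z a)) * negPart φ a) := by
    refine ae_of_all _ fun a => ?_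
    rw [mul_left_comm E, ← mul_add]
    gcongr
    set y := (negPart φ a).toReal with hy
    have hy0 : 0 ≤ y := ENNReal.toReal_nonneg
    have hN0 : 0 ≤ N := ENNReal.toReal_nonneg
    calc E * (1 + negPart φ z) = ENNReal.ofReal (Real.exp (-N) * (1 + N)) := by
          rw [ENNReal.ofReal_mul (Real.exp_pos _).le, ENNReal.ofReal_add zero_le_one hN0,
            ENNReal.ofReal_one, hN, ENNReal.ofReal_toReal hNfin]
      _ ≤ ENNReal.ofReal (Real.exp (-y) + Real.exp (-N) * y) := by
          refine ENNReal.ofReal_le_ofReal ?_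
          have h3 := Real.add_one_le_exp (N - y)
          have h4 : Real.exp (-y) = Real.exp (-N) * Real.exp (N - y) := by
            rw [← Real.exp_add]; congr 1; ring
          rw [h4]
          nlinarith [Real.exp_pos (-N)]
      _ = ENNReal.ofReal (Real.exp (-y)) + E * ENNReal.ofReal y := by
          rw [ENNReal.ofReal_add (Real.exp_pos _).le (by positivity), ENNReal.ofReal_mul (Real.exp_pos _).le]
      _ ≤ _ := by
          gcongr
          exact ENNReal.ofReal_toReal_le
  have h3 := lintegral_mono_ae h2
  rw [lintegral_mul_const _ (by fun_prop), hmass, one_mul, lintegral_add_left (by fun_prop),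
    lintegral_const_mul _ (by fun_prop), mul_add, mul_one] at h3
  have h4 := h3.trans (add_le_add_right (mul_le_mul_right h1 E) _)
  exact (ENNReal.add_le_add_iff_right (ENNReal.mul_ne_top ENNReal.ofReal_ne_top hNfin)).1 h4

/-- The regularizations of `φ`. -/
def regular (φ : Cn n → EReal) (s : ℝ) : Cn n → ℝ := kernelOp (kern n s) fun z => (φ z).toReal

lemma regular_eq (h0 : ∀ z ∈ unitBall n, φ z ≤ 0) (s : ℝ) (a : Cn n) :
    regular φ s a = -kernelOp (kern n s) (fun z => (negPart φ z).toReal) a := by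
  rw [regular, kernelOp, kernelOp, ← integral_neg]
  refine integral_congr_ae ?_
  filter_upwards [ae_invVolume_mem] with z hz
  rw [toReal_eq_neg_negPart h0 hz, mul_neg]

lemma regular_nonpos (h0 : ∀ z ∈ unitBall n, φ z ≤ 0) (hs : 0 < s) (ha : a ∈ unitBall n) :
    regular φ s a ≤ 0 := by
  rw [regular_eq h0, neg_nonpos]
  refine integral_nonneg_of_ae ?_
  filter_upwards [ae_invVolume_mem] with z hz
  exact mul_nonneg (kern_nonneg hs (bx_nonneg ha hz) (bx_lt_one ha hz).le) ENNReal.toReal_nonneg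

lemma contDiffOn_regular (hm : IsInvLaplacianMeasure φ m) (hs : 4 ≤ s) :
    ContDiffOn ℝ 2 (regular φ s) (unitBall n) :=
  contDiffOn_kernelOp hm.integrable_on_compacts
    ((kern_contDiff (by linarith)).of_le (WithTop.coe_le_coe.2 le_top)) (two_div_lt_one hs)
    fun _ hx => kern_eq_zero (by linarith) hx

lemma invLaplacian_regular (hm : IsInvLaplacianMeasure φ m) (hs : 4 ≤ s) (ha : a ∈ unitBall n) :
    0 ≤ invLaplacian (regular φ s) a ∧ ENNReal.ofReal (invLaplacian (regular φ s) a) =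
      ∫⁻ z, ENNReal.ofReal (kern n s (bx a z)) ∂m :=
  hm.ofReal_invLaplacian_kernelOp (kern_contDiff (by linarith)) (two_div_lt_one hs)
    (fun _ hx => kern_eq_zero (by linarith) hx) (fun _ h0 h1 => kern_nonneg (by linarith) h0 h1) ha

/-- The mean of `f exp φ`, where `φ` is replaced by its regularization. -/
def meanExp (φ : Cn n → EReal) (f : Cn n → ℝ) (t : ℝ) (z : Cn n) : ℝ≥0∞ :=
  ∫⁻ a, ENNReal.ofReal (f a * Real.exp (regular φ t a)) * ENNReal.ofReal (kern n t (bx a z)) ∂(invVolume n)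

/-- Jensen's inequality bounds e^φ(z) by the mean of e^φ. Almost everywhere φ is at most its
regularization, and f exceeds f(z) - δ on the support of the kernel. -/
lemma le_meanExp (hn : 1 ≤ n) (hφ : InvSubharmonic φ) (h0 : ∀ z ∈ unitBall n, φ z ≤ 0)
    {f : Cn n → ℝ} (hz : z ∈ unitBall n) (hs : 4 ≤ s) {δ : ℝ}
    (hf : ∀ a ∈ unitBall n, bx z a < 2 / s → f z - δ ≤ f a) :
    ENNReal.ofReal (f z - δ) * EReal.exp (φ z) ≤ meanExp φ f s z := by
  have hs0 : 0 < s := by linarith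
  have mk : Measurable (kern n s) := (kern_contDiff hs0).continuous.measurable
  have mb := measurable_bx z
  have mP := measurable_negPart hφ.usc
  refine (mul_le_mul_right (exp_le_lintegral_kern hn hφ h0 hz hs) _).trans ?_
  rw [← lintegral_const_mul _ (by fun_prop), meanExp]
  refine lintegral_mono_ae ?_
  filter_upwards [ae_invVolume_mem, ae_negPart_lt_top hn hφ h0] with a ha hfin
  rw [bx_comm a z]
  rcases ofReal_kern_eq_zero_or z a hs0 with h | h
  · simp [h]
  rw [mul_comm (ENNReal.ofReal (kern n s (bx z a))), ← mul_assoc,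
    ← ENNReal.ofReal_mul' (Real.exp_pos _).le]
  gcongr ?_ * _
  have h1 : -(negPart φ a).toReal ≤ regular φ s a := by
    rw [regular_eq h0, neg_le_neg_iff]
    exact kernelOp_negPart_le hn hφ h0 ha hfin hs
  rcases le_or_gt (f z - δ) 0 with h2 | h2
  · rw [ENNReal.ofReal_of_nonpos (mul_nonpos_of_nonpos_of_nonneg h2 (Real.exp_pos _).le)]
    exact zero_le
  · have h3 := hf a ha h
    have h4 : 0 ≤ f a := h2.le.trans h3
    refine ENNReal.ofReal_le_ofReal ?_
    gcongr

lemma tendsto_two_div : Tendsto (fun j : ℕ => 2 / ((j : ℝ) + 4)) atTop (𝓝 0) :=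
  tendsto_const_nhds.div_atTop (tendsto_atTop_add_const_right _ _ tendsto_natCast_atTop_atTop)

/-- The bound holds at every point of the ball and not just almost everywhere for dg; it will be
integrated against m, which may be singular to dg. -/
lemma le_liminf_meanExp (hn : 1 ≤ n) (hφ : InvSubharmonic φ) (h0 : ∀ z ∈ unitBall n, φ z ≤ 0)
    {f : Cn n → ℝ} (hz : z ∈ unitBall n) (hf : ContinuousOn f (unitBall n)) {ρ : ℝ} (hρ0 : 0 ≤ ρ)
    (hρ : ρ < 1) (hf0 : ∀ z, ρ < ‖z‖ → f z = 0) :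
    ENNReal.ofReal (f z) * EReal.exp (φ z) ≤
      liminf (fun j : ℕ => meanExp φ f ((j : ℝ) + 4) z) atTop := by
  have hexp : EReal.exp (φ z) ≠ ⊤ := by
    refine ne_top_of_le_ne_top ENNReal.one_ne_top ?_
    rw [← EReal.exp_zero]
    exact EReal.exp_monotone (h0 z hz)
  have hlim : Tendsto (fun i : ℕ => ENNReal.ofReal (f z - 1 / ((i : ℝ) + 1)) * EReal.exp (φ z)) atTop
      (𝓝 (ENNReal.ofReal (f z) * EReal.exp (φ z))) := by
    refine ENNReal.Tendsto.mul_const ?_ (Or.inr hexp)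
    have := (tendsto_const_nhds (x := f z)).sub (tendsto_one_div_add_atTop_nhds_zero_nat (𝕜 := ℝ))
    rw [sub_zero] at this
    exact (ENNReal.continuous_ofReal.tendsto _).comp this
  refine le_of_tendsto' hlim fun i => ?_
  obtain ⟨ε, hε, hmod⟩ := exists_modulus hf hρ0 hρ hf0 (δ := 1 / ((i : ℝ) + 1)) (by positivity)
  refine le_liminf_of_le (by isBoundedDefault) ?_
  filter_upwards [tendsto_two_div.eventually (gt_mem_nhds hε)] with j hj
  refine le_meanExp hn hφ h0 hz (four_le_add j) fun a ha hb => ?_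
  have := (abs_le.1 (hmod z hz a ha (hb.trans hj))).1
  linarith

lemma measurable_kern_uncurry (hs : 0 < s) : Measurable fun p : Cn n × Cn n => kern n s (bx p.1 p.2) :=
  (kern_contDiff hs).continuous.measurable.comp measurable_bx_uncurry

/-- Tonelli's theorem moves the mean from the function onto the measure, where it becomes the
Laplacian of the regularization. -/
lemma lintegral_meanExp {f : Cn n → ℝ} {μ : Measure (Cn n)} [SFinite μ] {t : ℝ} (ht : 0 < t)
    (hf : AEMeasurable (fun a => f a * Real.exp (regular φ t a)) (invVolume n)) :
    ∫⁻ z, meanExp φ f t z ∂μ = ∫⁻ a, ENNReal.ofReal (f a * Real.exp (regular φ t a)) *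
      ∫⁻ z, ENNReal.ofReal (kern n t (bx a z)) ∂μ ∂(invVolume n) := by
  have mk := measurable_kern_uncurry (n := n) ht
  simp only [meanExp]
  rw [lintegral_lintegral_swap]
  · refine lintegral_congr fun a => lintegral_const_mul _ ?_
    exact (mk.comp (measurable_const.prodMk measurable_id)).ennreal_ofReal
  · exact (hf.ennreal_ofReal.comp_quasiMeasurePreserving Measure.quasiMeasurePreserving_snd).mul
      (mk.comp measurable_swap).ennreal_ofReal.aemeasurable

lemma aemeasurable_meanExp {f : Cn n → ℝ} {μ : Measure (Cn n)} [SFinite μ] {t : ℝ} (ht : 0 < t)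
    (hf : AEMeasurable (fun a => f a * Real.exp (regular φ t a)) (invVolume n)) :
    AEMeasurable (meanExp φ f t) μ := by
  have mk := measurable_kern_uncurry (n := n) ht
  refine AEMeasurable.lintegral_prod_right' (f := fun p : Cn n × Cn n =>
    ENNReal.ofReal (f p.2 * Real.exp (regular φ t p.2)) * ENNReal.ofReal (kern n t (bx p.2 p.1))) ?_
  exact (hf.ennreal_ofReal.comp_quasiMeasurePreserving Measure.quasiMeasurePreserving_snd).mul
      (mk.comp measurable_swap).ennreal_ofReal.aemeasurable

/-- The estimate for truncated Green functions. -/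
theorem IsInvLaplacianMeasure.lintegral_truncGreen_le (hn : 1 ≤ n) (hφ : InvSubharmonic φ)
    (h0 : ∀ z ∈ unitBall n, φ z ≤ 0) (hm : IsInvLaplacianMeasure φ m) (hs : 4 ≤ s)
    {F : Cn n → ℂ} (hF : ContDiff ℂ 2 F) {B : ℝ≥0∞}
    (hB : ∀ r : ℝ, 0 < r → r < 1 → 1 - 2 / s ≤ r ^ 2 →
      ∫⁻ ξ, ‖F (r • (ξ : Cn n))‖ₑ ^ 2 ∂(sphereMeasure n) ≤ B) :
    ENNReal.ofReal (n.factorial / Real.pi ^ n) * ∫⁻ z, ENNReal.ofReal (truncGreen s z) *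
      (EReal.exp (φ z) * ‖F z‖ₑ ^ 2) ∂m ≤ B := by
  obtain ⟨ρ, hρ0, hρ, hsupp⟩ := exists_radius (truncGreen_hasCompactSupport (n := n) hs)
    (truncGreen_tsupport hs)
  have hoff : ∀ z : Cn n, ρ < ‖z‖ → truncGreen s z = 0 := fun z hz =>
    image_eq_zero_of_notMem_tsupport fun h => absurd (hsupp z h) (not_le.2 hz)
  set K := Metric.closedBall (0 : Cn n) ρ with hK
  have hKs : K ⊆ unitBall n := closedBall_subset_unitBall hρ
  have hKc : IsCompact K := isCompact_closedBall _ _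
  set f : Cn n → ℝ := fun z => truncGreen s z * ‖F z‖ ^ 2 with hf
  have cf : Continuous f :=
    (truncGreen_contDiff hs).continuous.mul (hF.continuous.norm.pow 2)
  have hf0 : ∀ z, ρ < ‖z‖ → f z = 0 := fun z hz => by rw [hf]; simp [hoff z hz]
  -- Off K the truncated Green's function vanishes, and on K the measure is finite, which secures
  -- the s-finiteness needed for interchanging integrals.
  have : IsFiniteMeasure (m.restrict K) := ⟨by
    rw [Measure.restrict_apply_univ]; exact hm.finite_on_compacts K hKc hKs⟩
  have mexp : ∀ j : ℕ, AEMeasurable (fun a => f a * Real.exp (regular φ ((j : ℝ) + 4) a)) (invVolume n) :=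
    fun j => (cf.measurable.aemeasurable).mul (Real.measurable_exp.comp_aemeasurable
      (((contDiffOn_regular hm (four_le_add j)).continuousOn.aemeasurable
        isOpen_unitBall.measurableSet).mono_ac invVolume_absolutelyContinuous))
  have hpos : ∀ j : ℕ, (0 : ℝ) < (j : ℝ) + 4 := fun j => by positivity
  have h1 : ∫⁻ z, ENNReal.ofReal (truncGreen s z) * (EReal.exp (φ z) * ‖F z‖ₑ ^ 2) ∂m ≤
      ∫⁻ z in K, liminf (fun j : ℕ => meanExp φ f ((j : ℝ) + 4) z) atTop ∂m := by
    rw [← lintegral_indicator hKc.measurableSet]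
    refine lintegral_mono fun z => ?_
    by_cases hz : z ∈ K
    · rw [Set.indicator_of_mem hz]
      refine le_trans (le_of_eq ?_) (le_liminf_meanExp hn hφ h0 (hKs hz) cf.continuousOn hρ0 hρ hf0)
      rw [hf, ENNReal.ofReal_mul (truncGreen_nonneg hs (hKs hz)), ENNReal.ofReal_pow (norm_nonneg _),
        ofReal_norm]
      ring
    · rw [Set.indicator_of_notMem hz, hoff z (by simpa [hK] using hz)]
      simp
  refine (mul_le_mul_right (h1.trans (lintegral_liminf_le' fun j =>
    aemeasurable_meanExp (hpos j) (mexp j))) _).trans ?_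
  rw [← ENNReal.liminf_const_mul_of_ne_top ENNReal.ofReal_ne_top]
  refine liminf_le_of_frequently_le' (Eventually.frequently (Eventually.of_forall fun j => ?_))
  rw [lintegral_meanExp (hpos j) (mexp j)]
  have h4 := four_le_add j
  -- The C² inequality for the regularization of φ, which is nonpositive with nonnegative Laplacian.
  -- The restriction to K is dropped first, so that the mean of the whole of m, which is that
  -- Laplacian, appears.
  refine le_trans (mul_le_mul_right (lintegral_mono_ae ?_) _)
    (BallUchiyama.lintegral_truncGreen_le hn hs hF (contDiffOn_regular hm h4)
      (fun a ha => (invLaplacian_regular hm h4 ha).1) (fun a ha => regular_nonpos h0 (hpos j) ha) hB)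
  filter_upwards [ae_invVolume_mem] with a ha
  have hL := invLaplacian_regular hm h4 ha
  refine (mul_le_mul_right (lintegral_mono' Measure.restrict_le_self le_rfl) _).trans ?_
  rw [← hL.2, ← ENNReal.ofReal_mul' hL.1]
  refine ENNReal.ofReal_le_ofReal (le_of_eq ?_)
  simp only [hf]; ring

/-- The embedding inequality for entire functions. -/
theorem lintegral_le_of_invSubharmonic (hn : 1 ≤ n) (hφ : InvSubharmonic φ)
    (h0 : ∀ z ∈ unitBall n, φ z ≤ 0) (hm : IsInvLaplacianMeasure φ m)
    {F : Cn n → ℂ} (hF : ContDiff ℂ 2 F) :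
    ∫⁻ z, ‖F z‖ₑ ^ 2 ∂(uchiyamaMeasure φ m) ≤
      ∫⁻ ξ : unitSphere n, ‖F ξ‖ₑ ^ 2 ∂(sphereMeasure n) := by
  have hb : ∀ᵐ z ∂m, z ∈ unitBall n := by rw [ae_iff]; exact hm.compl_ball
  have mexp : AEMeasurable (fun z => EReal.exp (φ z)) m :=
    EReal.measurable_exp.comp_aemeasurable (aemeasurable_of_usc hφ.usc hb)
  have mF : Measurable fun z => ‖F z‖ₑ ^ 2 := hF.continuous.enorm.measurable.pow_const 2
  rw [lintegral_uchiyamaMeasure mexp mF]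
  refine lintegral_green_le (h := fun z => EReal.exp (φ z) * ‖F z‖ₑ ^ 2) hn hF.continuous hb
    (mexp.mul mF.aemeasurable) ?_ ENNReal.ofReal_ne_top
    fun s hs B hB => hm.lintegral_truncGreen_le hn hφ h0 hs hF hB
  filter_upwards [hb] with z hz
  refine ENNReal.mul_ne_top (ne_top_of_le_ne_top ENNReal.one_ne_top ?_)
    (ENNReal.pow_ne_top enorm_ne_top)
  rw [← EReal.exp_zero]
  exact EReal.exp_monotone (h0 z hz)

end regularization

end

end BallUchiyama

open BallUchiyama

/-- Uchiyama's lemma for the unit ball. The first part is for invariant subharmonic functions of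
class C², where Δ̃φ is a function; the second is for arbitrary invariant subharmonic functions,
where Δ̃φ dg is the measure given by the distribution Δ̃φ. -/
theorem lemma2p1 (n : ℕ) (hn : 1 ≤ n) :
    (∀ φ : Cn n → ℝ, ContDiffOn ℝ 2 φ (unitBall n) →
      (∀ z ∈ unitBall n, 0 ≤ invLaplacian φ z) →
      (∀ z ∈ unitBall n, φ z ≤ 0) →
      IsCarlesonMeasure (uchiyamaMeasure (fun z => (φ z : EReal))
        ((invVolume n).withDensity (fun z => ENNReal.ofReal (invLaplacian φ z)))) ∧
      EmbedsContractively (uchiyamaMeasure (fun z => (φ z : EReal))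
        ((invVolume n).withDensity (fun z => ENNReal.ofReal (invLaplacian φ z))))) ∧
    (∀ φ : Cn n → EReal, InvSubharmonic φ →
      (∀ z ∈ unitBall n, φ z ≤ 0) →
      (∃ m : Measure (Cn n), IsInvLaplacianMeasure φ m) ∧
      ∀ m : Measure (Cn n), IsInvLaplacianMeasure φ m →
        IsCarlesonMeasure (uchiyamaMeasure φ m) ∧
        EmbedsContractively (uchiyamaMeasure φ m)) := by
  refine ⟨fun φ hφ hL h0 => ?_, fun φ hφ h0 =>
    ⟨exists_isInvLaplacianMeasure hn hφ h0, fun m hm => ?_⟩⟩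
  · have hν := uchiyamaMeasure_compl (φ := fun z => (φ z : EReal))
      (withDensity_absolutelyContinuous (invVolume n)
        (fun z => ENNReal.ofReal (invLaplacian φ z)) (ae_iff.1 (ae_invVolume_mem (n := n))))
    have H := fun F (hF : ContDiff ℂ 2 F) => lintegral_le_of_contDiffOn hn hφ hL h0 hF
    exact ⟨isCarlesonMeasure_of_le hn hν H, embedsContractively_of_le hn hν H⟩
  · have hν := uchiyamaMeasure_compl (φ := φ) hm.compl_ball
    have H := fun F (hF : ContDiff ℂ 2 F) => lintegral_le_of_invSubharmonic hn hφ h0 hm hF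
    exact ⟨isCarlesonMeasure_of_le hn hν H, embedsContractively_of_le hn hν H⟩
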